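/- For a class $\mathcal C$ of finite simple undirected graphs and a graph $G$, a minimum deletion set of $G$ to $\mathcal C$ is a set $X \subseteq V(G)$ of minimum cardinality such that $G - X \in \mathcal C$. The problem $\mathcal C_1 \to \mathcal C_2$ asks, given a graph $G \in \mathcal C_1$, for a minimum deletion set of $G$ to $\mathcal C_2$. A graph is an interval graph if its vertices can be assigned closed intervals of the real line such that two distinct vertices are adjacent if and only if their intervals intersect. It is a complete split graph if its vertex set can be partitioned into a clique $C$ and an independent set $I$ (either possibly empty) such that every vertex of $C$ is adjacent to every vertex of $I$. It is a cluster graph if each of its connected components is a clique. Theorem. The problems interval $\to$ complete split and interval $\to$ cluster are solvable in polynomial time. That is, for each of the two target classes $\mathcal C_2$ there are a deterministic (multi-stack) Turing machine $M$ and a polynomial $p$ such that, for every $n \ge 0$ and every interval graph $G$ with vertex set $\{0, \dots, n-1\}$, the machine $M$, started on the adjacency matrix of $G$ (written row by row, with an end marker after each row; no interval model of $G$ is given), halts after at most $p(\ell)$ steps, where $\ell = n^2 + n$ is the length of the input, and outputs the characteristic vector of a minimum deletion set of $G$ to $\mathcal C_2$. -/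

import Mathlib

/-- A class of (undirected, simple) graphs. -/
abbrev GraphClass : Type 1 := ∀ ⦃V : Type⦄, SimpleGraph V → Prop

/-- Interval graphs: every vertex can be assigned a (nonempty) closed interval of the real line so
that two distinct vertices are adjacent exactly when their intervals intersect. -/
def IntervalGraph : GraphClass := fun V G =>
  ∃ lp rp : V → ℝ, (∀ v, lp v ≤ rp v) ∧
    ∀ u v, u ≠ v → (G.Adj u v ↔ (Set.Icc (lp u) (rp u) ∩ Set.Icc (lp v) (rp v)).Nonempty)

/-- Complete split graphs: the vertex set is partitioned into a clique `C` and an independent set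
`I`, either of which may be empty, with every vertex of `C` adjacent to every vertex of `I`. -/
def CompleteSplitGraph : GraphClass := fun V G =>
  ∃ C I : Set V, C ∪ I = Set.univ ∧ Disjoint C I ∧ G.IsClique C ∧ G.IsIndepSet I ∧
    ∀ u ∈ C, ∀ v ∈ I, G.Adj u v

/-- Cluster graphs: every connected component is a clique. -/
def ClusterGraph : GraphClass := fun _ G =>
  ∀ c : G.ConnectedComponent, G.IsClique c.supp

/-- `G - X`, the graph obtained from `G` by deleting the vertices in `X`, belongs to `𝒞`. -/
def IsDeletionSet (𝒞 : GraphClass) {n : ℕ} (G : SimpleGraph (Fin n)) (X : Finset (Fin n)) : Prop :=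
  𝒞 (G.induce {v | v ∉ X})

/-- `X` is a minimum (cardinality) set of vertices whose deletion puts `G` into `𝒞`. -/
def IsMinimumDeletionSet (𝒞 : GraphClass) {n : ℕ} (G : SimpleGraph (Fin n))
    (X : Finset (Fin n)) : Prop :=
  IsDeletionSet 𝒞 G X ∧ ∀ Y : Finset (Fin n), IsDeletionSet 𝒞 G Y → X.card ≤ Y.card

/-- An instance of a vertex deletion problem with source class `𝒞`: a finite graph belonging to
`𝒞`, with vertex set `{0, …, n - 1}`. -/
structure DeletionInstance (𝒞 : GraphClass) where
  /-- the number of vertices -/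
  n : ℕ
  /-- the input graph -/
  graph : SimpleGraph (Fin n)
  mem : 𝒞 graph

open Classical in
/-- The input word of a graph: its adjacency matrix, row by row. An entry is a symbol `some b`
(`b = true` for an edge), and every row is followed by the end marker `none`; the word has
`n ^ 2 + n` symbols. Only the graph is given, and no interval model of it. -/
noncomputable def encodeGraph {n : ℕ} (G : SimpleGraph (Fin n)) : List (Option Bool) :=
  (List.finRange n).flatMap fun i =>
    ((List.finRange n).map fun j => some (decide (G.Adj i j))) ++ [none]

/-- The output word of a set of vertices: its characteristic vector, of length `n`. -/
def encodeVertexSet {n : ℕ} (X : Finset (Fin n)) : List Bool :=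
  (List.finRange n).map fun v => decide (v ∈ X)

/-- The vertex deletion problem `𝒞₁ → 𝒞₂` ("given a graph `G` in `𝒞₁`, find a minimum set `X` of
vertices such that `G - X` is in `𝒞₂`") is solvable in polynomial time: one Turing machine, on the
input word of every graph in `𝒞₁`, halts with the characteristic vector of such a set, after a
number of steps bounded by a fixed polynomial in the length of the input word. -/
def VertexDeletionInP (𝒞₁ 𝒞₂ : GraphClass) : Prop :=
  ∃ sol : ∀ x : DeletionInstance 𝒞₁, Finset (Fin x.n),
    (∀ x, IsMinimumDeletionSet 𝒞₂ x.graph (sol x)) ∧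
    Nonempty (Turing.TM2ComputableInPolyTime
      (fun x : DeletionInstance 𝒞₁ => encodeGraph x.graph)
      (id : List Bool → List Bool)
      (fun x => encodeVertexSet (sol x)))

/-! Deleting few vertices means keeping many, so the task is to find a largest induced subgraph in
the target class. An interval model is fixed for the correctness proof only; the algorithms use
nothing but adjacencies. Both problems reduce to maximum weight independent sets in auxiliary graphs
of polynomial size in which every nonempty set of vertices of positive weight contains a vertex that
is simplicial within it.

In such graphs the local ratio method is exact (`LocalRatio.solution_spec`). Subtract the weight of
a simplicial vertex `p` from its closed neighbourhood, truncating at zero, solve the remaining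
problem, and add `p` if none of its neighbours was taken. An independent set has at most one vertex
of positive weight in `N[p]`, so the reduction costs it at most `w p`; the solution found regains at
least `w p`.

Cluster graphs. By the Helly property every clique lies in some `N[u] ∩ N[v]` which is itself a
clique (`exists_commonClique`). If `x` and `y` are the members of a clique `c` with the leftmost
left end and the rightmost right end, then `N[c] = N[x] ∪ N[y]`. The block of `(u, v, x, y)`
consists of those `w` in the clique `N[u] ∩ N[v]` with `N[w] ⊆ N[x] ∪ N[y]`. For suitable `u, v` it
contains `c`, it is again a clique, and it touches nothing that `c` does not touch. So the
components of a cluster subgraph can be enlarged to disjoint, pairwise nonadjacent blocks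
(`card_le_of_isCluster`), and an optimum is an independent family among `n ^ 4` blocks. The conflict
graph of the nonempty blocks is the interval graph of their spans (`blockAdj_eliminable`).

Complete split graphs. If the independent part has two vertices, let `a` be the one with the
leftmost right end and `b` the one with the rightmost left end. Then `N[a] ∩ N[b]` is a clique
containing the clique part, and the whole independent part is adjacent to all of it
(`exists_inCore_inRest`). Hence for each pair `(a, b)` it suffices to take this clique and a maximum
independent set among the outside vertices adjacent to all of it; one independent set problem on
triples `(a, b, x)` handles all pairs at once. If the independent part has at most one vertex, the
subgraph is a clique and lies in some `N[u] ∩ N[v]`. The best pair is an independent set of maximum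
weight in a complete graph.

Polynomial time. The algorithms are written as commands on bit arrays with bounded formulas and
loops whose bounds are polynomials in the variables. These compile to stack programs with unary
counters, and those to Turing machines. The nesting depth is fixed by the command, so all values,
array lengths and running times stay polynomial in the input length. -/

/-! ## Structured programs over a family of stacks -/

/-- Structured programs over stacks `k : K` with alphabets `Γ k`. -/
inductive StackProg {K : Type} (Γ : K → Type) : Type
  | skip : StackProg Γ
  | push (k : K) (g : Γ k) : StackProg Γ
  | pop (k : K) : StackProg Γ
  | seq (c d : StackProg Γ) : StackProg Γ
  | ite (k : K) (f : Option (Γ k) → Bool) (c d : StackProg Γ) : StackProg Γ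
  | loop (k : K) (f : Option (Γ k) → Bool) (c : StackProg Γ) : StackProg Γ

namespace StackProg

variable {K : Type} [DecidableEq K] {Γ : K → Type}

/-- `Runs c S S' t`: started on the stacks `S`, the program `c` ends with the stacks `S'` after at
most `t` steps. -/
inductive Runs : StackProg Γ → (∀ k, List (Γ k)) → (∀ k, List (Γ k)) → ℕ → Prop
  | skip (S) : Runs skip S S 1
  | push (k g S) : Runs (push k g) S (Function.update S k (g :: S k)) 1
  | pop (k S) : Runs (pop k) S (Function.update S k (S k).tail) 1
  | seq {c d S₁ S₂ S₃ s t} : Runs c S₁ S₂ s → Runs d S₂ S₃ t → Runs (seq c d) S₁ S₃ (s + t)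
  | ite_true {k f c d S S' t} : f (S k).head? = true → Runs c S S' t →
      Runs (ite k f c d) S S' (t + 1)
  | ite_false {k f c d S S' t} : f (S k).head? = false → Runs d S S' t →
      Runs (ite k f c d) S S' (t + 1)
  | loop_true {k f c S₁ S₂ S₃ s t} : f (S₁ k).head? = true → Runs c S₁ S₂ s →
      Runs (loop k f c) S₂ S₃ t → Runs (loop k f c) S₁ S₃ (s + t + 1)
  | loop_false {k f c S} : f (S k).head? = false → Runs (loop k f c) S S 1
  | mono {c S S' s t} : Runs c S S' s → s ≤ t → Runs c S S' t

/-- The control points of a program. -/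
def Label : StackProg Γ → Type
  | skip => Unit
  | push _ _ => Unit
  | pop _ => Unit
  | seq c d => Label c ⊕ Label d
  | ite _ _ c d => Option (Label c ⊕ Label d)
  | loop _ _ c => Option (Label c)

/-- The control point at which a program is entered. -/
def entry : ∀ c : StackProg Γ, Label c
  | skip => ()
  | push _ _ => ()
  | pop _ => ()
  | seq c _ => Sum.inl (entry c)
  | ite _ _ _ _ => none
  | loop _ _ _ => none

/-- A program has finitely many control points. -/
@[reducible] noncomputable def fintypeLabel : ∀ c : StackProg Γ, Fintype (Label c)
  | skip => inferInstanceAs (Fintype Unit)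
  | push _ _ => inferInstanceAs (Fintype Unit)
  | pop _ => inferInstanceAs (Fintype Unit)
  | seq c d =>
    letI := fintypeLabel c
    letI := fintypeLabel d
    inferInstanceAs (Fintype (Label c ⊕ Label d))
  | ite _ _ c d =>
    letI := fintypeLabel c
    letI := fintypeLabel d
    inferInstanceAs (Fintype (Option (Label c ⊕ Label d)))
  | loop _ _ c =>
    letI := fintypeLabel c
    inferInstanceAs (Fintype (Option (Label c)))

open Turing.TM2 in
/-- The machine code of a program whose control points are embedded by `e` into the labels of a
machine, and which continues at the label `x`. -/
def code : ∀ (c : StackProg Γ) {Λ : Type}, (Label c → Λ) → Λ → Label c → Stmt Γ Λ Bool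
  | skip, _, _, x, _ => Stmt.goto fun _ => x
  | push k g, _, _, x, _ => Stmt.push k (fun _ => g) (Stmt.goto fun _ => x)
  | pop k, _, _, x, _ => Stmt.pop k (fun v _ => v) (Stmt.goto fun _ => x)
  | seq c d, _, e, x, l => match l with
    | Sum.inl l => code c (fun l => e (Sum.inl l)) (e (Sum.inr (entry d))) l
    | Sum.inr l => code d (fun l => e (Sum.inr l)) x l
  | ite k f c d, _, e, x, l => match l with
    | none => Stmt.peek k (fun _ a => f a) (Stmt.goto fun v =>
        if v then e (some (Sum.inl (entry c))) else e (some (Sum.inr (entry d))))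
    | some (Sum.inl l) => code c (fun l => e (some (Sum.inl l))) x l
    | some (Sum.inr l) => code d (fun l => e (some (Sum.inr l))) x l
  | loop k f c, _, e, x, l => match l with
    | none => Stmt.peek k (fun _ a => f a) (Stmt.goto fun v =>
        if v then e (some (entry c)) else x)
    | some l => code c (fun l => e (some l)) (e none) l

/-- The embedding `e` and the continuation `x` are arbitrary so that the induction applies to
subprograms, whose labels sit inside those of the whole program. The register is scratch space
overwritten by every test, hence its final value is left open. The machine needs an exact number of
steps, whereas `Runs` only bounds it. -/
theorem iterate_step_of_runs {c : StackProg Γ} {S S' : ∀ k, List (Γ k)} {t : ℕ}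
    (h : Runs c S S' t) {Λ : Type} (M : Λ → Turing.TM2.Stmt Γ Λ Bool) (e : Label c → Λ) (x : Λ)
    (hM : ∀ l, M (e l) = code c e x l) (v : Bool) :
    ∃ v' : Bool, ∃ s ≤ t, (flip bind (Turing.TM2.step M))^[s]
      (some (⟨some (e (entry c)), v, S⟩ : Turing.TM2.Cfg Γ Λ Bool)) =
        some ⟨some x, v', S'⟩ := by
  induction h generalizing Λ v with
  | skip S =>
    refine ⟨v, 1, le_rfl, ?_⟩
    exact congrArg (fun q => some (Turing.TM2.stepAux q v S)) (hM ())
  | push k g S =>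
    refine ⟨v, 1, le_rfl, ?_⟩
    exact congrArg (fun q => some (Turing.TM2.stepAux q v S)) (hM ())
  | pop k S =>
    refine ⟨v, 1, le_rfl, ?_⟩
    exact congrArg (fun q => some (Turing.TM2.stepAux q v S)) (hM ())
  | @seq c d S₁ S₂ S₃ s t h₁ h₂ ih₁ ih₂ =>
    obtain ⟨v₁, s₁, hs₁, e₁⟩ := ih₁ M (fun l => e (Sum.inl l)) (e (Sum.inr (entry d)))
      (fun l => hM (Sum.inl l)) v
    obtain ⟨v₂, s₂, hs₂, e₂⟩ := ih₂ M (fun l => e (Sum.inr l)) x (fun l => hM (Sum.inr l)) v₁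
    refine ⟨v₂, s₂ + s₁, by omega, ?_⟩
    rw [Function.iterate_add_apply]
    exact (congrArg _ e₁).trans e₂
  | @ite_true k f c d S S' t hf h ih =>
    obtain ⟨v₁, s₁, hs₁, e₁⟩ := ih M (fun l => e (some (Sum.inl l))) x
      (fun l => hM (some (Sum.inl l))) true
    refine ⟨v₁, s₁ + 1, by omega, ?_⟩
    rw [Function.iterate_add_apply, ← e₁]
    congr 1
    refine (congrArg (fun q => some (Turing.TM2.stepAux q v S)) (hM none)).trans ?_
    simp [code, Turing.TM2.stepAux, hf]
  | @ite_false k f c d S S' t hf h ih =>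
    obtain ⟨v₁, s₁, hs₁, e₁⟩ := ih M (fun l => e (some (Sum.inr l))) x
      (fun l => hM (some (Sum.inr l))) false
    refine ⟨v₁, s₁ + 1, by omega, ?_⟩
    rw [Function.iterate_add_apply, ← e₁]
    congr 1
    refine (congrArg (fun q => some (Turing.TM2.stepAux q v S)) (hM none)).trans ?_
    simp [code, Turing.TM2.stepAux, hf]
  | @loop_true k f c S₁ S₂ S₃ s t hf h₁ h₂ ih₁ ih₂ =>
    obtain ⟨v₁, s₁, hs₁, e₁⟩ := ih₁ M (fun l => e (some l)) (e none)
      (fun l => hM (some l)) true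
    obtain ⟨v₂, s₂, hs₂, e₂⟩ := ih₂ M e x hM v₁
    refine ⟨v₂, s₂ + (s₁ + 1), by omega, ?_⟩
    rw [Function.iterate_add_apply, ← e₂, Function.iterate_add_apply]
    congr 1
    refine Eq.trans ?_ e₁
    congr 1
    refine (congrArg (fun q => some (Turing.TM2.stepAux q v S₁)) (hM none)).trans ?_
    simp [code, Turing.TM2.stepAux, hf]
  | @loop_false k f c S hf =>
    refine ⟨false, 1, le_rfl, ?_⟩
    refine (congrArg (fun q => some (Turing.TM2.stepAux q v S)) (hM none)).trans ?_
    simp [code, Turing.TM2.stepAux, hf]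
  | @mono c S S' s t h hst ih =>
    obtain ⟨v₁, s₁, hs₁, e₁⟩ := ih M e x hM v
    exact ⟨v₁, s₁, hs₁.trans hst, e₁⟩

open Turing.TM2 in
/-- The Turing machine which executes a structured program and halts. -/
noncomputable def machine [Fintype K] (c : StackProg Γ) (k₀ k₁ : K) [Fintype (Γ k₀)] :
    Turing.FinTM2 :=
  letI := fintypeLabel c
  { k₀ := k₀
    k₁ := k₁
    Γ := Γ
    Λ := Option (Label c)
    main := some (entry c)
    σ := Bool
    initialState := false
    m := fun l => match l with
      | none => Stmt.load (fun _ => false) Stmt.halt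
      | some l => code c some none l }

/-- The initial and halting configurations of `FinTM2` describe their stacks by a `dite` with a
transport; this brings them into the form used by `Runs`. -/
theorem dite_eq_update (k₀ : K) (a : List (Γ k₀)) (k : K) :
    @dite (List (Γ k)) (k = k₀) _ (fun h => by rw [h]; exact a) (fun _ => []) =
      Function.update (fun _ => []) k₀ a k := by
  rcases eq_or_ne k k₀ with rfl | hk
  · simp
  · simp [hk]

/-- The additional step is the one at the label `none`: it resets the register to its initial value,
as the halting configuration demands, and halts. -/
theorem machine_outputs [Fintype K] (c : StackProg Γ) (k₀ k₁ : K) [Fintype (Γ k₀)]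
    (a : List (Γ k₀)) (b : List (Γ k₁)) (t : ℕ)
    (h : Runs c (Function.update (fun _ => []) k₀ a) (Function.update (fun _ => []) k₁ b) t) :
    Nonempty (Turing.TM2OutputsInTime (machine c k₀ k₁) a (some b) (t + 1)) := by
  obtain ⟨v, s, hs, hstep⟩ := iterate_step_of_runs h (machine c k₀ k₁).m some none
    (fun l => rfl) false
  refine ⟨⟨⟨s + 1, ?_⟩, Nat.succ_le_succ hs⟩⟩
  have h₀ : Turing.initList (machine c k₀ k₁) a =
      (⟨some (some (entry c)), false, Function.update (fun _ => []) k₀ a⟩ :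
        Turing.TM2.Cfg Γ (Option (Label c)) Bool) :=
    congrArg (Turing.TM2.Cfg.mk _ _) (funext fun k => dite_eq_update k₀ a k)
  have h₁ : Turing.haltList (machine c k₀ k₁) b =
      (⟨none, false, Function.update (fun _ => []) k₁ b⟩ :
        Turing.TM2.Cfg Γ (Option (Label c)) Bool) :=
    congrArg (Turing.TM2.Cfg.mk _ _) (funext fun k => dite_eq_update k₁ b k)
  rw [Function.iterate_succ_apply', h₀]
  refine (congrArg (flip bind _) hstep).trans ?_
  refine Eq.trans ?_ (congrArg some h₁.symm)
  rfl

end StackProg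

/-! ## Stacks, and elementary program steps -/

/-- The stacks of the machines below: the input, an accumulator for the unary value of expressions,
a temporary stack, a stack of loop counters, a stack for the part of an array left of the head, a
stack of truth values (the final output), unary variables, and arrays of bits. -/
inductive Stk
  | inp | acc | tmp | cnt | lft | out
  | var (x : Fin 16)
  | mem (a : Fin 16)
  deriving DecidableEq, Fintype

/-- The alphabets of the stacks. -/
abbrev Stk.Alphabet : Stk → Type
  | .inp => Option Bool
  | _ => Bool

/-- The contents of the stacks, with the unary variables given by their values. -/
structure Store where
  inp : List (Option Bool)
  acc : List Bool
  tmp : List Bool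
  cnt : List Bool
  lft : List Bool
  out : List Bool
  var : Fin 16 → ℕ
  mem : Fin 16 → List Bool

/-- The word on each stack. -/
def Store.get (s : Store) : ∀ k : Stk, List k.Alphabet
  | .inp => s.inp
  | .acc => s.acc
  | .tmp => s.tmp
  | .cnt => s.cnt
  | .lft => s.lft
  | .out => s.out
  | .var x => List.replicate (s.var x) true
  | .mem a => s.mem a

/-- Programs over these stacks. -/
abbrev Prog := StackProg Stk.Alphabet

open StackProg

infixr:60 " ;; " => StackProg.seq

/-- `Exec c s s' t`: the program `c` takes the store `s` to `s'` in at most `t` steps. -/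
def Exec (c : Prog) (s s' : Store) (t : ℕ) : Prop :=
  Runs c s.get s'.get t

/-- The test whether the top symbol of a stack is `true`. -/
def topTrue (o : Option Bool) : Bool := o == some true

@[simp] theorem topTrue_some (b : Bool) : topTrue (some b) = b := by
  cases b <;> rfl

@[simp] theorem topTrue_none : topTrue none = false := rfl

namespace Exec

variable {c d : Prog} {s s' s'' : Store} {t t' m : ℕ}

theorem mono (h : Exec c s s' t) (ht : t ≤ t') : Exec c s s' t' := Runs.mono h ht

theorem seq (h : Exec c s s' t) (h' : Exec d s' s'' t') : Exec (c ;; d) s s'' (t + t') :=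
  Runs.seq h h'

theorem skip : Exec skip s s 1 := Runs.skip _

theorem ite {k : Stk} {f : Option k.Alphabet → Bool} (b : Bool) (h : f (s.get k).head? = b)
    (hc : b = true → Exec c s s' t) (hd : b = false → Exec d s s' t) :
    Exec (.ite k f c d) s s' (t + 1) := by
  cases b
  · exact Runs.ite_false h (hd rfl)
  · exact Runs.ite_true h (hc rfl)

/-- The intermediate stores are supplied as an explicit sequence `σ`, which turns the verification
of a loop into a computation for one round. Each round pays one step for its test, and the failing
test is the final `1`. -/
theorem loop {k : Stk} {f : Option k.Alphabet → Bool} (σ : ℕ → Store) (m t : ℕ)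
    (h₁ : ∀ i < m, f ((σ i).get k).head? = true)
    (h₂ : ∀ i < m, Exec c (σ i) (σ (i + 1)) t)
    (h₃ : f ((σ m).get k).head? = false) :
    Exec (.loop k f c) (σ 0) (σ m) (m * (t + 1) + 1) := by
  induction m generalizing σ with
  | zero => exact mono (Runs.loop_false h₃) (by simp)
  | succ m ih =>
    have := ih (fun i => σ (i + 1)) (fun i hi => h₁ _ (by omega)) (fun i hi => h₂ _ (by omega)) h₃
    exact mono (Runs.loop_true (h₁ 0 (by omega)) (h₂ 0 (by omega)) this) (by ring_nf; omega)

theorem push_of_get {k : Stk} (g : k.Alphabet)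
    (h : s'.get = Function.update s.get k (g :: s.get k)) : Exec (.push k g) s s' 1 := by
  unfold Exec
  rw [h]
  exact Runs.push _ _ _

theorem pop_of_get {k : Stk}
    (h : s'.get = Function.update s.get k (s.get k).tail) : Exec (.pop k) s s' 1 := by
  unfold Exec
  rw [h]
  exact Runs.pop _ _

/-! ### Effect of the elementary stack instructions on a store. -/

variable {inp : List (Option Bool)} {acc tmp cnt lft out : List Bool} {var : Fin 16 → ℕ}
  {mem : Fin 16 → List Bool} {b : Bool}

theorem pop_inp {o : Option Bool} : Exec (.pop .inp) ⟨o :: inp, acc, tmp, cnt, lft, out, var, mem⟩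
    ⟨inp, acc, tmp, cnt, lft, out, var, mem⟩ 1 :=
  pop_of_get (by ext1 k; cases k <;> simp [Store.get, Function.update])

theorem push_acc : Exec (.push .acc b) ⟨inp, acc, tmp, cnt, lft, out, var, mem⟩
    ⟨inp, b :: acc, tmp, cnt, lft, out, var, mem⟩ 1 :=
  push_of_get (k := .acc) b (by ext1 k; cases k <;> simp [Store.get, Function.update])

theorem pop_acc : Exec (.pop .acc) ⟨inp, b :: acc, tmp, cnt, lft, out, var, mem⟩
    ⟨inp, acc, tmp, cnt, lft, out, var, mem⟩ 1 :=
  pop_of_get (by ext1 k; cases k <;> simp [Store.get, Function.update])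

theorem push_tmp : Exec (.push .tmp b) ⟨inp, acc, tmp, cnt, lft, out, var, mem⟩
    ⟨inp, acc, b :: tmp, cnt, lft, out, var, mem⟩ 1 :=
  push_of_get (k := .tmp) b (by ext1 k; cases k <;> simp [Store.get, Function.update])

theorem pop_tmp : Exec (.pop .tmp) ⟨inp, acc, b :: tmp, cnt, lft, out, var, mem⟩
    ⟨inp, acc, tmp, cnt, lft, out, var, mem⟩ 1 :=
  pop_of_get (by ext1 k; cases k <;> simp [Store.get, Function.update])

theorem push_cnt : Exec (.push .cnt b) ⟨inp, acc, tmp, cnt, lft, out, var, mem⟩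
    ⟨inp, acc, tmp, b :: cnt, lft, out, var, mem⟩ 1 :=
  push_of_get (k := .cnt) b (by ext1 k; cases k <;> simp [Store.get, Function.update])

theorem pop_cnt : Exec (.pop .cnt) ⟨inp, acc, tmp, b :: cnt, lft, out, var, mem⟩
    ⟨inp, acc, tmp, cnt, lft, out, var, mem⟩ 1 :=
  pop_of_get (by ext1 k; cases k <;> simp [Store.get, Function.update])

theorem push_lft : Exec (.push .lft b) ⟨inp, acc, tmp, cnt, lft, out, var, mem⟩
    ⟨inp, acc, tmp, cnt, b :: lft, out, var, mem⟩ 1 :=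
  push_of_get (k := .lft) b (by ext1 k; cases k <;> simp [Store.get, Function.update])

theorem pop_lft : Exec (.pop .lft) ⟨inp, acc, tmp, cnt, b :: lft, out, var, mem⟩
    ⟨inp, acc, tmp, cnt, lft, out, var, mem⟩ 1 :=
  pop_of_get (by ext1 k; cases k <;> simp [Store.get, Function.update])

theorem push_out : Exec (.push .out b) ⟨inp, acc, tmp, cnt, lft, out, var, mem⟩
    ⟨inp, acc, tmp, cnt, lft, b :: out, var, mem⟩ 1 :=
  push_of_get (k := .out) b (by ext1 k; cases k <;> simp [Store.get, Function.update])

theorem pop_out : Exec (.pop .out) ⟨inp, acc, tmp, cnt, lft, b :: out, var, mem⟩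
    ⟨inp, acc, tmp, cnt, lft, out, var, mem⟩ 1 :=
  pop_of_get (by ext1 k; cases k <;> simp [Store.get, Function.update])

theorem push_var {x : Fin 16} : Exec (.push (.var x) true)
    ⟨inp, acc, tmp, cnt, lft, out, var, mem⟩
    ⟨inp, acc, tmp, cnt, lft, out, Function.update var x (var x + 1), mem⟩ 1 :=
  push_of_get (k := .var x) true (by
    ext1 k
    cases k with
    | var y =>
      by_cases h : y = x
      · subst h; simp [Store.get, List.replicate_succ]
      · simp [Store.get, Function.update, h]
    | _ => simp [Store.get, Function.update])

theorem pop_var {x : Fin 16} : Exec (.pop (.var x))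
    ⟨inp, acc, tmp, cnt, lft, out, var, mem⟩
    ⟨inp, acc, tmp, cnt, lft, out, Function.update var x (var x - 1), mem⟩ 1 :=
  pop_of_get (k := .var x) (by
    ext1 k
    cases k with
    | var y =>
      by_cases h : y = x
      · subst h; simp [Store.get]
      · simp [Store.get, Function.update, h]
    | _ => simp [Store.get, Function.update])

theorem push_mem {a : Fin 16} : Exec (.push (.mem a) b)
    ⟨inp, acc, tmp, cnt, lft, out, var, mem⟩
    ⟨inp, acc, tmp, cnt, lft, out, var, Function.update mem a (b :: mem a)⟩ 1 :=
  push_of_get (k := .mem a) b (by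
    ext1 k
    cases k with
    | mem y =>
      by_cases h : y = a
      · subst h; simp [Store.get]
      · simp [Store.get, Function.update, h]
    | _ => simp [Store.get, Function.update])

theorem pop_mem {a : Fin 16} : Exec (.pop (.mem a))
    ⟨inp, acc, tmp, cnt, lft, out, var, mem⟩
    ⟨inp, acc, tmp, cnt, lft, out, var, Function.update mem a (mem a).tail⟩ 1 :=
  pop_of_get (k := .mem a) (by
    ext1 k
    cases k with
    | mem y =>
      by_cases h : y = a
      · subst h; simp [Store.get]
      · simp [Store.get, Function.update, h]
    | _ => simp [Store.get, Function.update])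

end Exec

theorem replicate_sub_true {i m : ℕ} (h : i < m) :
    List.replicate (m - i) true = true :: List.replicate (m - (i + 1)) true := by
  rw [← List.replicate_succ]
  congr 1
  omega

/-- Empty the variable `x` onto the stack of counters. -/
def varToCnt (x : Fin 16) : Prog :=
  .loop (.var x) topTrue (.pop (.var x) ;; .push .cnt true)

/-- Move the ones on top of the accumulator to the stack of counters. -/
def accToCnt : Prog :=
  .loop .acc topTrue (.pop .acc ;; .push .cnt true)

/-- Move the ones on top of the stack of counters to the variable `x`. -/
def cntToVar (x : Fin 16) : Prog :=
  .loop .cnt topTrue (.pop .cnt ;; .push (.var x) true)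

/-- Set the variable `x` to `0`. -/
def clearVar (x : Fin 16) : Prog :=
  .loop (.var x) topTrue (.pop (.var x))

section

variable (inp : List (Option Bool)) (acc tmp cnt lft out : List Bool) (var : Fin 16 → ℕ)
  (mem : Fin 16 → List Bool)

theorem exec_varToCnt (x : Fin 16) : Exec (varToCnt x)
    ⟨inp, acc, tmp, cnt, lft, out, var, mem⟩
    ⟨inp, acc, tmp, List.replicate (var x) true ++ cnt, lft, out, Function.update var x 0, mem⟩
    (3 * var x + 1) := by
  have := Exec.loop (k := .var x) (f := topTrue) (c := .pop (.var x) ;; .push .cnt true)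
    (fun i => ⟨inp, acc, tmp, List.replicate i true ++ cnt, lft, out,
      Function.update var x (var x - i), mem⟩) (var x) 2
    (fun i hi => by simp [Store.get, replicate_sub_true hi])
    (fun i hi => by
      have := (Exec.pop_var (inp := inp) (acc := acc) (tmp := tmp)
        (cnt := List.replicate i true ++ cnt) (lft := lft) (out := out)
        (var := Function.update var x (var x - i)) (mem := mem) (x := x)).seq
        (Exec.push_cnt (b := true))
      simpa [List.replicate_succ, Nat.sub_sub] using this)
    (by simp [Store.get])
  simpa [varToCnt, mul_comm] using this

/-- A `false` on a stack acts as a separator: only the ones above it are moved. In this way one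
stack holds several unary numbers, one for each pending loop or product. -/
theorem exec_accToCnt (m : ℕ) (hacc : topTrue acc.head? = false) : Exec accToCnt
    ⟨inp, List.replicate m true ++ acc, tmp, cnt, lft, out, var, mem⟩
    ⟨inp, acc, tmp, List.replicate m true ++ cnt, lft, out, var, mem⟩ (3 * m + 1) := by
  have := Exec.loop (k := .acc) (f := topTrue) (c := .pop .acc ;; .push .cnt true)
    (fun i => ⟨inp, List.replicate (m - i) true ++ acc, tmp, List.replicate i true ++ cnt, lft,
      out, var, mem⟩) m 2
    (fun i hi => by simp [Store.get, replicate_sub_true hi])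
    (fun i hi => by
      simp only [replicate_sub_true hi, List.replicate_succ, List.cons_append]
      exact Exec.pop_acc.seq Exec.push_cnt)
    (by simpa [Store.get] using hacc)
  simpa [accToCnt, mul_comm] using this

theorem exec_cntToVar (x : Fin 16) (m : ℕ) (hcnt : topTrue cnt.head? = false) (h : var x = 0) :
    Exec (cntToVar x)
    ⟨inp, acc, tmp, List.replicate m true ++ cnt, lft, out, var, mem⟩
    ⟨inp, acc, tmp, cnt, lft, out, Function.update var x m, mem⟩ (3 * m + 1) := by
  have := Exec.loop (k := .cnt) (f := topTrue) (c := .pop .cnt ;; .push (.var x) true)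
    (fun i => ⟨inp, acc, tmp, List.replicate (m - i) true ++ cnt, lft,
      out, Function.update var x i, mem⟩) m 2
    (fun i hi => by simp [Store.get, replicate_sub_true hi])
    (fun i hi => by
      simp only [replicate_sub_true hi, List.cons_append]
      have := (Exec.pop_cnt (inp := inp) (acc := acc) (tmp := tmp) (b := true)
        (cnt := List.replicate (m - (i + 1)) true ++ cnt) (lft := lft) (out := out)
        (var := Function.update var x i) (mem := mem)).seq (Exec.push_var (x := x))
      simpa using this)
    (by simpa [Store.get] using hcnt)
  have hv : Function.update var x 0 = var := by simp [← h]
  simpa [cntToVar, mul_comm, hv] using this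

theorem exec_clearVar (x : Fin 16) : Exec (clearVar x)
    ⟨inp, acc, tmp, cnt, lft, out, var, mem⟩
    ⟨inp, acc, tmp, cnt, lft, out, Function.update var x 0, mem⟩ (2 * var x + 1) := by
  have := Exec.loop (k := .var x) (f := topTrue) (c := .pop (.var x))
    (fun i => ⟨inp, acc, tmp, cnt, lft, out,
      Function.update var x (var x - i), mem⟩) (var x) 1
    (fun i hi => by simp [Store.get, replicate_sub_true hi])
    (fun i hi => by
      have := Exec.pop_var (inp := inp) (acc := acc) (tmp := tmp) (cnt := cnt) (lft := lft)
        (out := out) (var := Function.update var x (var x - i)) (mem := mem) (x := x)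
      simpa [Nat.sub_sub] using this)
    (by simp [Store.get])
  simpa [clearVar, mul_comm] using this

end

/-! ## Expressions -/

/-- Polynomial expressions in the variables. -/
inductive Exp
  | var (x : Fin 16)
  | zero
  | one
  | add (e f : Exp)
  | mul (e f : Exp)

namespace Exp

instance : Zero Exp := ⟨zero⟩
instance : One Exp := ⟨one⟩
instance : Add Exp := ⟨add⟩
instance : Mul Exp := ⟨mul⟩

/-- The value of an expression. -/
def eval (ρ : Fin 16 → ℕ) : Exp → ℕ
  | var x => ρ x
  | zero => 0
  | one => 1
  | add e f => eval ρ e + eval ρ f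
  | mul e f => eval ρ e * eval ρ f

@[simp] theorem eval_var (ρ x) : (var x).eval ρ = ρ x := rfl
@[simp] theorem eval_zero (ρ) : (0 : Exp).eval ρ = 0 := rfl
@[simp] theorem eval_one (ρ) : (1 : Exp).eval ρ = 1 := rfl
@[simp] theorem eval_add (ρ) (e f : Exp) : (e + f).eval ρ = e.eval ρ + f.eval ρ := rfl
@[simp] theorem eval_mul (ρ) (e f : Exp) : (e * f).eval ρ = e.eval ρ * f.eval ρ := rfl

/-- The value of an expression when all variables have the value `B`. -/
def top (e : Exp) (B : ℕ) : ℕ := e.eval fun _ => B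

theorem eval_le_top {ρ : Fin 16 → ℕ} {B : ℕ} (h : ∀ x, ρ x ≤ B) (e : Exp) : e.eval ρ ≤ e.top B := by
  induction e with
  | var x => exact h x
  | zero => exact le_rfl
  | one => exact le_rfl
  | add e f he hf => exact Nat.add_le_add he hf
  | mul e f he hf => exact Nat.mul_le_mul he hf

/-- The program which adds the value of an expression, in unary, to the accumulator. -/
def prog : Exp → Prog
  | var x => .loop (.var x) topTrue (.pop (.var x) ;; .push .tmp true) ;;
      .loop .tmp topTrue (.pop .tmp ;; .push .acc true ;; .push (.var x) true)
  | zero => .skip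
  | one => .push .acc true
  | add e f => prog e ;; prog f
  | mul e f => .push .acc false ;; prog e ;; .push .cnt false ;; accToCnt ;; .pop .acc ;;
      .loop .cnt topTrue (.pop .cnt ;; prog f) ;; .pop .cnt

/-- A time bound for `Exp.prog`. -/
def cost : Exp → ℕ → ℕ
  | var _, B => 7 * B + 2
  | zero, _ => 1
  | one, _ => 1
  | add e f, B => cost e B + cost f B
  | mul e f, B => cost e B + e.top B * (cost f B + 5) + 6

/-- A variable is read destructively and restored from `tmp`. For a product, the value of `e` is
collected above a separator and moved to `cnt`, and then `f` is evaluated once for every one found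
there. Nesting requires arbitrary contents of `acc` and `cnt` below. -/
theorem exec_prog (e : Exp) (inp : List (Option Bool)) (acc cnt lft out : List Bool)
    (ρ : Fin 16 → ℕ) (mem : Fin 16 → List Bool) {B : ℕ} (hρ : ∀ x, ρ x ≤ B) :
    Exec e.prog ⟨inp, acc, [], cnt, lft, out, ρ, mem⟩
      ⟨inp, List.replicate (e.eval ρ) true ++ acc, [], cnt, lft, out, ρ, mem⟩ (e.cost B) := by
  induction e generalizing acc cnt with
  | var x =>
    have h₁ := Exec.loop (k := .var x) (f := topTrue) (c := .pop (.var x) ;; .push .tmp true)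
      (fun i => ⟨inp, acc, List.replicate i true, cnt, lft, out,
        Function.update ρ x (ρ x - i), mem⟩) (ρ x) 2
      (fun i hi => by simp [Store.get, replicate_sub_true hi])
      (fun i hi => by
        have := (Exec.pop_var (inp := inp) (acc := acc) (tmp := List.replicate i true)
          (cnt := cnt) (lft := lft) (out := out)
          (var := Function.update ρ x (ρ x - i)) (mem := mem) (x := x)).seq
          (Exec.push_tmp (b := true))
        simpa [List.replicate_succ, Nat.sub_sub] using this)
      (by simp [Store.get])
    have h₂ := Exec.loop (k := .tmp) (f := topTrue)
      (c := .pop .tmp ;; .push .acc true ;; .push (.var x) true)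
      (fun i => ⟨inp, List.replicate i true ++ acc, List.replicate (ρ x - i) true, cnt, lft, out,
        Function.update ρ x i, mem⟩) (ρ x) 3
      (fun i hi => by simp [Store.get, replicate_sub_true hi])
      (fun i hi => by
        have := (Exec.pop_tmp (inp := inp) (acc := List.replicate i true ++ acc)
          (tmp := List.replicate (ρ x - (i + 1)) true) (b := true)
          (cnt := cnt) (lft := lft) (out := out)
          (var := Function.update ρ x i) (mem := mem)).seq
          ((Exec.push_acc (b := true)).seq (Exec.push_var (x := x)))
        simpa [replicate_sub_true hi, List.replicate_succ] using this)
      (by simp [Store.get])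
    simp only [Nat.sub_self, Nat.sub_zero, List.replicate_zero, List.nil_append,
      Function.update_eq_self] at h₁ h₂
    refine (h₁.seq h₂).mono ?_
    have := hρ x
    simp only [cost]
    omega
  | zero => exact Exec.skip
  | one => exact Exec.push_acc
  | add e f he hf =>
    have := (he acc cnt).seq (hf (List.replicate (e.eval ρ) true ++ acc) cnt)
    rw [← List.append_assoc, ← List.replicate_add, Nat.add_comm] at this
    exact this.mono le_rfl
  | mul e f he hf =>
    have h := Exec.loop (k := .cnt) (f := topTrue) (c := .pop .cnt ;; prog f)
      (fun i => ⟨inp, List.replicate (i * f.eval ρ) true ++ acc, [],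
        List.replicate (e.eval ρ - i) true ++ false :: cnt, lft, out, ρ, mem⟩)
      (e.eval ρ) (1 + f.cost B)
      (fun i hi => by simp [Store.get, replicate_sub_true hi])
      (fun i hi => by
        have := (Exec.pop_cnt (inp := inp) (acc := List.replicate (i * f.eval ρ) true ++ acc)
          (tmp := []) (cnt := List.replicate (e.eval ρ - (i + 1)) true ++ false :: cnt)
          (b := true) (lft := lft) (out := out) (var := ρ) (mem := mem)).seq (hf _ _)
        rw [← List.append_assoc, ← List.replicate_add] at this
        simpa [replicate_sub_true hi, Nat.succ_mul, Nat.add_comm] using this)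
      (by simp [Store.get])
    simp only [Nat.sub_self, Nat.sub_zero, List.replicate_zero, List.nil_append,
      Nat.zero_mul] at h
    have := Exec.push_acc.seq <| (he (false :: acc) cnt).seq <| Exec.push_cnt.seq <|
      (exec_accToCnt inp (false :: acc) [] (false :: cnt) lft out ρ mem (e.eval ρ) rfl).seq <|
      Exec.pop_acc.seq <| h.seq Exec.pop_cnt
    refine this.mono ?_
    have hv := eval_le_top hρ e
    have := Nat.mul_le_mul_right (f.cost B + 5) hv
    simp only [cost]
    rw [show 1 + f.cost B + 1 = f.cost B + 2 by omega]
    nlinarith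

end Exp

/-! ## Counting loops -/

/-- Execute `c` with `x` ranging over the numbers below the value of `e`, and restore `x`. -/
def forProg (x : Fin 16) (e : Exp) (c : Prog) : Prog :=
  e.prog ;; .push .cnt false ;; varToCnt x ;; .push .cnt false ;; accToCnt ;;
    .loop .cnt topTrue (.pop .cnt ;; c ;; .push (.var x) true) ;;
    .pop .cnt ;; clearVar x ;; cntToVar x ;; .pop .cnt

/-- A time bound for `forProg` if the body takes at most `T` steps. -/
def forCost (e : Exp) (T B : ℕ) : ℕ := e.cost B + 6 * B + e.top B * (T + 8) + 10

/-- On `cnt` lie, each closed off by a separator, the old value of `x` and above it the number of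
remaining rounds; the body must therefore work over an arbitrary `cnt`. The invariant `P` concerns
only `out` and `mem`, because everything else is the same before and after the body. -/
theorem exec_forProg {c : Prog} {inp : List (Option Bool)} (cnt out : List Bool)
    (mem : Fin 16 → List Bool) (ρ : Fin 16 → ℕ) {B T : ℕ} (hρ : ∀ x, ρ x ≤ B) (x : Fin 16)
    (e : Exp) (P : ℕ → List Bool → (Fin 16 → List Bool) → Prop) (h₀ : P 0 out mem)
    (h : ∀ i < e.eval ρ, ∀ cnt out mem, P i out mem → ∃ out' mem',
      Exec c ⟨inp, [], [], cnt, [], out, Function.update ρ x i, mem⟩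
        ⟨inp, [], [], cnt, [], out', Function.update ρ x i, mem'⟩ T ∧ P (i + 1) out' mem') :
    ∃ out' mem', Exec (forProg x e c) ⟨inp, [], [], cnt, [], out, ρ, mem⟩
      ⟨inp, [], [], cnt, [], out', ρ, mem'⟩ (forCost e T B) ∧ P (e.eval ρ) out' mem' := by
  set k := e.eval ρ with hk
  set cnt' := false :: (List.replicate (ρ x) true ++ false :: cnt)
  -- Induction on the number `m` of rounds still to be done, while `x` has the value `k - m`. The
  -- `3` counts the pop, the increment of `x` and the test.
  have key : ∀ m ≤ k, ∀ out mem, P (k - m) out mem → ∃ out' mem',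
      Exec (.loop .cnt topTrue (.pop .cnt ;; c ;; .push (.var x) true))
        ⟨inp, [], [], List.replicate m true ++ cnt', [], out, Function.update ρ x (k - m), mem⟩
        ⟨inp, [], [], cnt', [], out', Function.update ρ x k, mem'⟩
        (m * (T + 3) + 1) ∧ P k out' mem' := by
    intro m
    induction m with
    | zero =>
      intro _ out mem hP
      refine ⟨out, mem, ?_, hP⟩
      exact Runs.mono (Runs.loop_false (by simp [Store.get, cnt'])) (by omega)
    | succ m ih =>
      intro hm out mem hP
      obtain ⟨out₁, mem₁, e₁, h₁⟩ := h (k - (m + 1)) (by omega)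
        (List.replicate m true ++ cnt') out mem hP
      rw [show k - (m + 1) + 1 = k - m by omega] at h₁
      obtain ⟨out₂, mem₂, e₂, h₂⟩ := ih (by omega) out₁ mem₁ h₁
      refine ⟨out₂, mem₂, ?_, h₂⟩
      have hb := (Exec.pop_cnt (b := true)).seq (e₁.seq (Exec.push_var (x := x)))
      simp only [Function.update_self, Function.update_idem,
        show k - (m + 1) + 1 = k - m by omega] at hb
      exact Runs.mono (Runs.loop_true (by simp [Store.get, List.replicate_succ]) hb e₂)
        (by rw [Nat.succ_mul]; omega)
  obtain ⟨out', mem', hl, hP⟩ := key k le_rfl out mem (by simpa using h₀)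
  refine ⟨out', mem', ?_, hP⟩
  have hacc := exec_accToCnt inp [] [] cnt' [] out (Function.update ρ x 0) mem k rfl
  have hx := exec_varToCnt inp (List.replicate k true) [] (false :: cnt) [] out ρ mem x
  have hclear := exec_clearVar inp [] [] (List.replicate (ρ x) true ++ false :: cnt) [] out'
    (Function.update ρ x k) mem' x
  have hrest := exec_cntToVar inp [] [] (false :: cnt) [] out' (Function.update ρ x 0) mem' x
    (ρ x) rfl (by simp)
  have he := e.exec_prog inp [] cnt [] out ρ mem hρ
  simp only [Nat.sub_self, List.append_nil, Function.update_idem, Function.update_self,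
    Function.update_eq_self] at hacc hl hclear hrest he
  refine (he.seq <| Exec.push_cnt.seq <| hx.seq <| Exec.push_cnt.seq <| hacc.seq <| hl.seq <|
    Exec.pop_cnt.seq <| hclear.seq <| hrest.seq Exec.pop_cnt).mono ?_
  have h₁ := e.eval_le_top hρ
  have h₂ := hρ x
  have h₃ := Nat.mul_le_mul_right (T + 8) h₁
  simp only [forCost]
  rw [← hk] at h₃
  nlinarith

/-! ## Arrays -/

/-- The contents `mem` of the array stacks, of length at most `L`, represent the sets `μ a`. -/
def Represents (mem : Fin 16 → List Bool) (μ : Fin 16 → ℕ → Prop) (L : ℕ) : Prop :=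
  ∀ a, (∀ i, (mem a).getD i false = true ↔ μ a i) ∧ (mem a).length ≤ L

/-- Move the head of the array `a` to the right as many times as the accumulator says. -/
def seekProg (a : Fin 16) : Prog :=
  .loop .acc topTrue (.pop .acc ;; .ite (.mem a) topTrue
    (.push .lft true ;; .pop (.mem a)) (.push .lft false ;; .pop (.mem a)))

/-- Move the head of the array `a` back to the left end. -/
def rewindProg (a : Fin 16) : Prog :=
  .loop .lft Option.isSome
    (.ite .lft topTrue (.push (.mem a) true) (.push (.mem a) false) ;; .pop .lft)

/-- A finite stack stands for an infinite array with default entry `false`. Running past its end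
pads with `false` on `lft`, and popping the empty stack is harmless. -/
theorem exec_seekProg (a : Fin 16) (m : ℕ) (inp : List (Option Bool)) (cnt out : List Bool)
    (ρ : Fin 16 → ℕ) (mem : Fin 16 → List Bool) :
    Exec (seekProg a) ⟨inp, List.replicate m true, [], cnt, [], out, ρ, mem⟩
      ⟨inp, [], [], cnt, ((List.range m).map fun i => (mem a).getD i false).reverse, out, ρ,
        Function.update mem a ((mem a).drop m)⟩ (m * 5 + 1) := by
  have := Exec.loop (k := .acc) (f := topTrue) (c := .pop .acc ;; .ite (.mem a) topTrue
    (.push .lft true ;; .pop (.mem a)) (.push .lft false ;; .pop (.mem a)))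
    (fun i => ⟨inp, List.replicate (m - i) true, [], cnt,
      ((List.range i).map fun i => (mem a).getD i false).reverse, out, ρ,
      Function.update mem a ((mem a).drop i)⟩) m 4
    (fun i hi => by simp [Store.get, replicate_sub_true hi])
    (fun i hi => by
      simp only [replicate_sub_true hi]
      refine (Exec.pop_acc.seq (Exec.ite (t := 2) ((mem a).getD i false) ?_ ?_ ?_)).mono le_rfl
      · simp only [Store.get, Function.update_self, List.head?_drop, List.getD_eq_getElem?_getD]
        cases (mem a)[i]? <;> simp
      all_goals
        intro hb
        rw [List.range_succ, List.map_append, List.reverse_append, List.map_singleton, hb]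
        have := (Exec.push_lft (inp := inp) (acc := List.replicate (m - (i + 1)) true) (tmp := [])
          (cnt := cnt) (lft := ((List.range i).map fun i => (mem a).getD i false).reverse)
          (out := out) (var := ρ) (mem := Function.update mem a ((mem a).drop i))
          (b := (mem a).getD i false)).seq (Exec.pop_mem (a := a))
        rw [hb] at this
        simpa using this)
    (by simp [Store.get])
  simpa [seekProg] using this

theorem exec_rewindProg (a : Fin 16) (l : List Bool) (inp : List (Option Bool))
    (cnt out : List Bool) (ρ : Fin 16 → ℕ) (mem : Fin 16 → List Bool) :
    Exec (rewindProg a) ⟨inp, [], [], cnt, l.reverse, out, ρ, mem⟩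
      ⟨inp, [], [], cnt, [], out, ρ, Function.update mem a (l ++ mem a)⟩ (l.length * 4 + 1) := by
  induction l using List.reverseRecOn generalizing mem with
  | nil => simpa [rewindProg] using Exec.mono (Runs.loop_false (by simp [Store.get])) le_rfl
  | append_singleton l b ih =>
    have h₁ : Exec (.ite .lft topTrue (.push (.mem a) true) (.push (.mem a) false) ;; .pop .lft)
        ⟨inp, [], [], cnt, b :: l.reverse, out, ρ, mem⟩
        ⟨inp, [], [], cnt, l.reverse, out, ρ, Function.update mem a (b :: mem a)⟩ (2 + 1) := by
      refine Exec.seq (Exec.ite (t := 1) b (by simp [Store.get]) ?_ ?_) (Exec.pop_lft (b := b))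
      all_goals
        rintro rfl
        exact Exec.push_mem
    have h₂ := ih (Function.update mem a (b :: mem a))
    simp only [Function.update_self, Function.update_idem] at h₂
    have h₃ : Exec (rewindProg a) _ _ _ := Runs.loop_true (by simp [Store.get]) h₁ h₂
    simp only [List.reverse_append, List.reverse_singleton, List.singleton_append,
      List.append_assoc]
    exact h₃.mono (by simp; omega)

theorem getD_map_range_append (l r : List Bool) (m j : ℕ) :
    (((List.range m).map fun i => l.getD i false) ++ r).getD j false =
      if j < m then l.getD j false else r.getD (j - m) false := by
  simp only [List.getD_eq_getElem?_getD, List.getElem?_append, List.length_map, List.length_range]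
  split_ifs with h
  · simp [h]
  · rfl

/-- Push the entry of the array `a` at the position given by `e` on the stack of truth values. -/
def readProg (a : Fin 16) (e : Exp) : Prog :=
  e.prog ;; seekProg a ;; .ite (.mem a) topTrue (.push .out true) (.push .out false) ;; rewindProg a

/-- Reading may lengthen the stack by padding, so only `Represents` is preserved, not `mem` itself.
The new length is at most the maximum of the old one and the position read, hence at most `L`. -/
theorem exec_readProg (a : Fin 16) (e : Exp) (inp : List (Option Bool)) (cnt out : List Bool)
    (ρ : Fin 16 → ℕ) (mem : Fin 16 → List Bool) {μ : Fin 16 → ℕ → Prop} {L B : ℕ}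
    (hmem : Represents mem μ L) (hρ : ∀ x, ρ x ≤ B) (hL : e.top B ≤ L)
    [Decidable (μ a (e.eval ρ))] :
    ∃ mem', Exec (readProg a e) ⟨inp, [], [], cnt, [], out, ρ, mem⟩
      ⟨inp, [], [], cnt, [], decide (μ a (e.eval ρ)) :: out, ρ, mem'⟩
      (e.cost B + 9 * e.top B + 4) ∧ Represents mem' μ L := by
  have hv := e.eval_le_top hρ
  have h₁ := e.exec_prog inp [] cnt [] out ρ mem hρ
  have h₂ := exec_seekProg a (e.eval ρ) inp cnt out ρ mem
  have h₃ : Exec (.ite (.mem a) topTrue (.push .out true) (.push .out false))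
      ⟨inp, [], [], cnt, ((List.range (e.eval ρ)).map fun i => (mem a).getD i false).reverse, out,
        ρ,
        Function.update mem a ((mem a).drop (e.eval ρ))⟩
      ⟨inp, [], [], cnt, ((List.range (e.eval ρ)).map fun i => (mem a).getD i false).reverse,
        decide (μ a (e.eval ρ)) :: out, ρ,
        Function.update mem a ((mem a).drop (e.eval ρ))⟩ 2 := by
    refine Exec.ite (t := 1) (decide (μ a (e.eval ρ))) ?_ ?_ ?_
    · rw [Bool.eq_iff_iff, decide_eq_true_iff, ← (hmem a).1]
      simp only [Store.get, Function.update_self, List.head?_drop, List.getD_eq_getElem?_getD]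
      cases (mem a)[e.eval ρ]? <;> simp
    all_goals
      intro h
      rw [h]
      exact Exec.push_out
  have h₄ := exec_rewindProg a ((List.range (e.eval ρ)).map fun i => (mem a).getD i false) inp cnt
    (decide (μ a (e.eval ρ)) :: out) ρ (Function.update mem a ((mem a).drop (e.eval ρ)))
  rw [List.append_nil] at h₁
  refine ⟨_, (h₁.seq <| h₂.seq <| h₃.seq h₄).mono ?_, ?_⟩
  · simp only [List.length_map, List.length_range]
    omega
  · intro a'
    by_cases ha : a' = a
    · subst ha
      simp only [Function.update_self]
      refine ⟨fun i => ?_, ?_⟩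
      · rw [getD_map_range_append, ← (hmem a').1]
        split_ifs with hi
        · rfl
        · rw [List.getD_eq_getElem?_getD, List.getElem?_drop, List.getD_eq_getElem?_getD]
          rw [show e.eval ρ + (i - e.eval ρ) = i by omega]
      · have := (hmem a').2
        simp only [List.length_append, List.length_map, List.length_range, List.length_drop]
        omega
    · simpa [ha] using hmem a'

/-- Pop a truth value and write it into the array `a` at the position given by `e`. -/
def storeProg (a : Fin 16) (e : Exp) : Prog :=
  e.prog ;; seekProg a ;; .pop (.mem a) ;;
    .ite .out topTrue (.push (.mem a) true) (.push (.mem a) false) ;; .pop .out ;; rewindProg a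

/-- The inequality `hL` is strict because the cell written to, and not just the cells before it,
must fit into length `L`. -/
theorem exec_storeProg (a : Fin 16) (e : Exp) (inp : List (Option Bool)) (cnt out : List Bool)
    (ρ : Fin 16 → ℕ) (mem : Fin 16 → List Bool) {μ : Fin 16 → ℕ → Prop} {L B : ℕ}
    (hmem : Represents mem μ L) (hρ : ∀ x, ρ x ≤ B) (hL : e.top B < L) (p : Prop) [Decidable p] :
    ∃ mem', Exec (storeProg a e) ⟨inp, [], [], cnt, [], decide p :: out, ρ, mem⟩
      ⟨inp, [], [], cnt, [], out, ρ, mem'⟩ (e.cost B + 9 * e.top B + 6) ∧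
      Represents mem' (Function.update μ a (Function.update (μ a) (e.eval ρ) p)) L := by
  have hv := e.eval_le_top hρ
  have h₁ := e.exec_prog inp [] cnt [] (decide p :: out) ρ mem hρ
  have h₂ := exec_seekProg a (e.eval ρ) inp cnt (decide p :: out) ρ mem
  have h₃ : ∀ lft mem, Exec (.ite .out topTrue (.push (.mem a) true) (.push (.mem a) false))
      ⟨inp, [], [], cnt, lft, decide p :: out, ρ, mem⟩
      ⟨inp, [], [], cnt, lft, decide p :: out, ρ, Function.update mem a (decide p :: mem a)⟩ 2 := by
    intro lft mem
    refine Exec.ite (t := 1) (decide p) (by simp [Store.get]) ?_ ?_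
    all_goals
      intro h
      rw [h]
      exact Exec.push_mem
  rw [List.append_nil] at h₁
  refine ⟨_, (h₁.seq <| h₂.seq <| Exec.pop_mem.seq <| (h₃ _ _).seq <| Exec.pop_out.seq <|
    exec_rewindProg a _ _ _ _ _ _).mono ?_, ?_⟩
  · simp only [List.length_map, List.length_range]
    omega
  · intro a'
    by_cases ha : a' = a
    · subst ha
      simp only [Function.update_self]
      refine ⟨fun i => ?_, ?_⟩
      · rw [getD_map_range_append]
        split_ifs with hi
        · rw [Function.update_of_ne hi.ne, (hmem a').1]
        · obtain rfl | hi' := eq_or_lt_of_le (not_lt.1 hi)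
          · simp
          · rw [Function.update_of_ne hi'.ne', ← (hmem a').1]
            obtain ⟨j, rfl⟩ : ∃ j, i = e.eval ρ + (j + 1) := ⟨i - e.eval ρ - 1, by omega⟩
            simp [List.getD_eq_getElem?_getD, Nat.add_assoc, Nat.add_comm 1]
      · have := (hmem a').2
        simp only [List.length_append, List.length_map, List.length_range, List.length_drop,
          List.length_cons, List.length_tail]
        omega
    · simpa [ha] using hmem a'

/-! ## Bounded formulas and commands -/

/-- Formulas with bounded quantifiers over the entries of the arrays. -/
inductive Fm
  | rd (a : Fin 16) (e : Exp)
  | eq (e f : Exp)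
  | not (φ : Fm)
  | and (φ ψ : Fm)
  | ex (x : Fin 16) (e : Exp) (φ : Fm)

namespace Fm

/-- The truth value of a formula. -/
def Holds (μ : Fin 16 → ℕ → Prop) : (Fin 16 → ℕ) → Fm → Prop
  | ρ, rd a e => μ a (e.eval ρ)
  | ρ, eq e f => e.eval ρ = f.eval ρ
  | ρ, not φ => ¬ Holds μ ρ φ
  | ρ, and φ ψ => Holds μ ρ φ ∧ Holds μ ρ ψ
  | ρ, ex x e φ => ∃ i < e.eval ρ, Holds μ (Function.update ρ x i) φ

/-- Replace the truth value on top by `false`. -/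
def setFalse : Prog := .pop .out ;; .push .out false

/-- The program which pushes the truth value of a formula. -/
def prog : Fm → Prog
  | rd a e => readProg a e
  | eq e f => .push .out true ;; .push .cnt false ;; e.prog ;; accToCnt ;; f.prog ;;
      .loop .acc topTrue (.pop .acc ;; .ite .cnt topTrue (.pop .cnt) setFalse) ;;
      .loop .cnt topTrue (.pop .cnt ;; setFalse) ;; .pop .cnt
  | not φ => prog φ ;; .ite .out topTrue setFalse (.pop .out ;; .push .out true)
  | and φ ψ => prog φ ;; prog ψ ;; .ite .out topTrue (.pop .out) (.pop .out ;; setFalse)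
  | ex x e φ => .push .out false ;; forProg x e (prog φ ;;
      .ite .out topTrue (.pop .out ;; .pop .out ;; .push .out true) (.pop .out))

/-- A time bound for `Fm.prog`. -/
def cost : Fm → ℕ → ℕ
  | rd _ e, B => e.cost B + 9 * e.top B + 4
  | eq e f, B => e.cost B + f.cost B + 7 * e.top B + 5 * f.top B + 6
  | not φ, B => cost φ B + 3
  | and φ ψ, B => cost φ B + cost ψ B + 4
  | ex _ e φ, B => forCost e (cost φ (B + e.top B) + 4) B + 1

/-- A bound for the positions in arrays which are read by `Fm.prog`. -/
def need : Fm → ℕ → ℕ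
  | rd _ e, B => e.top B
  | eq _ _, _ => 0
  | not φ, B => need φ B
  | and φ ψ, B => need φ B + need ψ B
  | ex _ e φ, B => need φ (B + e.top B)

theorem exec_setFalse {inp : List (Option Bool)} {acc tmp cnt lft out : List Bool}
    {var : Fin 16 → ℕ} {mem : Fin 16 → List Bool} {b : Bool} :
    Exec setFalse ⟨inp, acc, tmp, cnt, lft, b :: out, var, mem⟩
      ⟨inp, acc, tmp, cnt, lft, false :: out, var, mem⟩ 2 :=
  Exec.pop_out.seq Exec.push_out

/-- The variables inside a quantifier or a loop are bounded by a sum rather than a maximum, which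
keeps the bound visibly polynomial. -/
theorem update_le {ρ : Fin 16 → ℕ} {B T i : ℕ} (hρ : ∀ x, ρ x ≤ B) (x : Fin 16) (hi : i ≤ T) :
    ∀ y, Function.update ρ x i y ≤ B + T := by
  intro y
  by_cases h : y = x
  · subst h; simp only [Function.update_self]; omega
  · have := hρ y
    rw [Function.update_of_ne h]; omega

/-- The two unary numbers are cancelled against each other. The truth value, initially `true`, is
spoiled if the second number outlasts the first (first loop) or if something of the first remains
(second loop). -/
theorem exec_eq (e f : Exp) (inp : List (Option Bool)) (cnt out : List Bool)
    (ρ : Fin 16 → ℕ) (mem : Fin 16 → List Bool) {B : ℕ} (hρ : ∀ x, ρ x ≤ B) :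
    Exec (eq e f).prog ⟨inp, [], [], cnt, [], out, ρ, mem⟩
      ⟨inp, [], [], cnt, [], decide (e.eval ρ = f.eval ρ) :: out, ρ, mem⟩ ((eq e f).cost B) := by
  set k := e.eval ρ with hk
  set m := f.eval ρ with hm
  have h₁ := Exec.loop (k := .acc) (f := topTrue)
    (c := .pop .acc ;; .ite .cnt topTrue (.pop .cnt) setFalse)
    (fun i => ⟨inp, List.replicate (m - i) true, [], List.replicate (k - i) true ++ false :: cnt,
      [],
      decide (i ≤ k) :: out, ρ, mem⟩) m 4
    (fun i hi => by simp [Store.get, replicate_sub_true hi])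
    (fun i hi => by
      simp only [replicate_sub_true hi]
      refine (Exec.pop_acc.seq (Exec.ite (t := 2) (decide (i < k)) ?_ ?_ ?_)).mono le_rfl
      · by_cases h : i < k
        · simp [Store.get, replicate_sub_true h, h]
        · simp [Store.get, show k - i = 0 by omega, h]
      · intro h
        have h : i < k := by simpa using h
        rw [replicate_sub_true h, decide_eq_true (show i ≤ k by omega),
          decide_eq_true (show i + 1 ≤ k by omega)]
        exact Exec.pop_cnt.mono (by omega)
      · intro h
        have h : ¬ i < k := by simpa using h
        rw [show k - i = 0 by omega, show k - (i + 1) = 0 by omega,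
          decide_eq_false (show ¬ i + 1 ≤ k by omega)]
        exact exec_setFalse)
    (by simp [Store.get])
  have h₂ := Exec.loop (k := .cnt) (f := topTrue)
    (c := .pop .cnt ;; setFalse)
    (fun i => ⟨inp, [], [], List.replicate (k - m - i) true ++ false :: cnt, [],
      decide (m ≤ k ∧ i = 0) :: out, ρ, mem⟩) (k - m) 3
    (fun i hi => by simp [Store.get, replicate_sub_true hi])
    (fun i hi => by
      simp only [replicate_sub_true hi]
      rw [decide_eq_false (show ¬ (m ≤ k ∧ i + 1 = 0) by omega)]
      exact Exec.pop_cnt.seq exec_setFalse)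
    (by simp [Store.get])
  have h₃ := e.exec_prog inp [] (false :: cnt) [] (true :: out) ρ mem hρ
  have h₄ := f.exec_prog inp [] (List.replicate k true ++ false :: cnt) [] (true :: out) ρ mem hρ
  have h₅ := exec_accToCnt inp [] [] (false :: cnt) [] (true :: out) ρ mem k rfl
  simp only [Nat.sub_self, Nat.sub_zero, List.append_nil, List.replicate_zero, List.nil_append,
    Nat.zero_le, decide_true, and_true] at h₁ h₂ h₃ h₄ h₅
  rw [show decide (m ≤ k ∧ k - m = 0) = decide (k = m) from decide_eq_decide.2 (by omega)] at h₂
  refine (Exec.push_out.seq <| Exec.push_cnt.seq <| h₃.seq <| h₅.seq <| h₄.seq <| h₁.seq <|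
    h₂.seq Exec.pop_cnt).mono ?_
  have := e.eval_le_top hρ
  have := f.eval_le_top hρ
  simp only [cost]
  omega

open Classical in
-- A quantifier is evaluated by a full loop which keeps on top of `out` the disjunction of the
-- instances seen so far; there is no early exit, so the invariant depends only on the number of
-- rounds.
theorem exec_prog (φ : Fm) (inp : List (Option Bool)) (cnt out : List Bool)
    (ρ : Fin 16 → ℕ) (mem : Fin 16 → List Bool) {μ : Fin 16 → ℕ → Prop} {L B : ℕ}
    (hmem : Represents mem μ L) (hρ : ∀ x, ρ x ≤ B) (hL : φ.need B ≤ L) :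
    ∃ mem', Exec φ.prog ⟨inp, [], [], cnt, [], out, ρ, mem⟩
      ⟨inp, [], [], cnt, [], decide (φ.Holds μ ρ) :: out, ρ, mem'⟩ (φ.cost B) ∧
      Represents mem' μ L := by
  induction φ generalizing cnt out ρ mem B with
  | rd a e => exact exec_readProg a e inp cnt out ρ mem hmem hρ hL
  | eq e f =>
    refine ⟨mem, ?_, hmem⟩
    convert exec_eq e f inp cnt out ρ mem hρ
    rfl
  | not φ ih =>
    obtain ⟨mem', h, hmem'⟩ := ih cnt out ρ mem hmem hρ hL
    refine ⟨mem', (h.seq (Exec.ite (t := 2) (decide (φ.Holds μ ρ)) ?_ ?_ ?_)).mono le_rfl, hmem'⟩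
    · simp [Store.get]
    · intro hb
      have hb : φ.Holds μ ρ := by simpa using hb
      rw [decide_eq_false (p := (not φ).Holds μ ρ) (not_not.2 hb)]
      exact exec_setFalse
    · intro hb
      have hb : ¬ φ.Holds μ ρ := by simpa using hb
      rw [decide_eq_true (p := (not φ).Holds μ ρ) hb]
      exact Exec.pop_out.seq Exec.push_out
  | and φ ψ ih₁ ih₂ =>
    simp only [need] at hL
    obtain ⟨mem₁, h₁, hmem₁⟩ := ih₁ cnt out ρ mem hmem hρ (by omega)
    obtain ⟨mem₂, h₂, hmem₂⟩ := ih₂ cnt (decide (φ.Holds μ ρ) :: out) ρ mem₁ hmem₁ hρ (by omega)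
    refine ⟨mem₂, (h₁.seq <| h₂.seq <|
      (Exec.ite (t := 3) (decide (ψ.Holds μ ρ)) ?_ ?_ ?_)).mono (Nat.add_assoc _ _ _).ge, hmem₂⟩
    · simp [Store.get]
    · intro hb
      have hb : ψ.Holds μ ρ := by simpa using hb
      have : (and φ ψ).Holds μ ρ ↔ φ.Holds μ ρ := and_iff_left hb
      simp only [this]
      exact Exec.pop_out.mono (by omega)
    · intro hb
      have hb : ¬ ψ.Holds μ ρ := by simpa using hb
      rw [decide_eq_false (p := (and φ ψ).Holds μ ρ) (fun h => hb h.2)]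
      exact Exec.pop_out.seq exec_setFalse
  | ex x e φ ih =>
    simp only [need] at hL
    obtain ⟨out', mem', h, rfl, hmem'⟩ := exec_forProg (c := prog φ ;;
      .ite .out topTrue (.pop .out ;; .pop .out ;; .push .out true) (.pop .out)) (inp := inp)
      (T := φ.cost (B + e.top B) + 4) cnt (false :: out) mem ρ hρ x e
      (fun k out' mem' => out' = decide (∃ i < k, φ.Holds μ (Function.update ρ x i)) :: out ∧
        Represents mem' μ L) ⟨by simp, hmem⟩ (by
        rintro i hi cnt out' mem' ⟨rfl, hmem'⟩
        obtain ⟨mem'', h, hmem''⟩ := ih cnt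
          (decide (∃ j < i, φ.Holds μ (Function.update ρ x j)) :: out) (Function.update ρ x i) mem'
          hmem' (update_le hρ x (hi.le.trans (e.eval_le_top hρ))) hL
        refine ⟨_, mem'', (h.seq (Exec.ite (t := 3)
          (decide (φ.Holds μ (Function.update ρ x i))) ?_ ?_ ?_)).mono le_rfl, rfl, hmem''⟩
        · simp [Store.get]
        · intro hb
          have hb : φ.Holds μ (Function.update ρ x i) := by simpa using hb
          rw [decide_eq_true (p := ∃ j < i + 1, φ.Holds μ (Function.update ρ x j))
            ⟨i, by omega, hb⟩]
          exact Exec.pop_out.seq (Exec.pop_out.seq Exec.push_out)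
        · intro hb
          have hb : ¬ φ.Holds μ (Function.update ρ x i) := by simpa using hb
          have : (∃ j < i + 1, φ.Holds μ (Function.update ρ x j)) ↔
              ∃ j < i, φ.Holds μ (Function.update ρ x j) := by
            refine ⟨?_, fun ⟨j, hj, h⟩ => ⟨j, by omega, h⟩⟩
            rintro ⟨j, hj, hj'⟩
            refine ⟨j, lt_of_le_of_ne (by omega) ?_, hj'⟩
            rintro rfl
            exact hb hj'
          simp only [this]
          exact Exec.pop_out.mono (by omega))
    refine ⟨mem', ?_, hmem'⟩
    convert (Exec.push_out.seq h).mono (Nat.add_comm _ _).le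
    · rfl
    · rfl
    · rfl

end Fm

/-- Programs with arrays of bits whose loops are bounded by polynomials in the variables. -/
inductive Cmd
  | wr (a : Fin 16) (e : Exp) (φ : Fm)
  | seq (c d : Cmd)
  | loop (x : Fin 16) (e : Exp) (c : Cmd)

namespace Cmd

/-- The contents of the arrays after the execution of a command. -/
def run : (Fin 16 → ℕ) → Cmd → (Fin 16 → ℕ → Prop) → Fin 16 → ℕ → Prop
  | ρ, wr a e φ, μ => Function.update μ a (Function.update (μ a) (e.eval ρ) (φ.Holds μ ρ))
  | ρ, seq c d, μ => run ρ d (run ρ c μ)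
  | ρ, loop x e c, μ => Nat.rec μ (fun i μ => run (Function.update ρ x i) c μ) (e.eval ρ)

/-- The program which executes a command. -/
def prog : Cmd → Prog
  | wr a e φ => φ.prog ;; storeProg a e
  | seq c d => prog c ;; prog d
  | loop x e c => forProg x e (prog c)

/-- A time bound for `Cmd.prog`. -/
def cost : Cmd → ℕ → ℕ
  | wr _ e φ, B => φ.cost B + (e.cost B + 9 * e.top B + 6)
  | seq c d, B => cost c B + cost d B
  | loop _ e c, B => forCost e (cost c (B + e.top B)) B

/-- A bound for the lengths of the arrays used by `Cmd.prog`. -/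
def need : Cmd → ℕ → ℕ
  | wr _ e φ, B => φ.need B + e.top B + 1
  | seq c d, B => need c B + need d B
  | loop _ e c, B => need c (B + e.top B)

theorem exec_prog (c : Cmd) (inp : List (Option Bool)) (cnt out : List Bool)
    (ρ : Fin 16 → ℕ) (mem : Fin 16 → List Bool) {μ : Fin 16 → ℕ → Prop} {L B : ℕ}
    (hmem : Represents mem μ L) (hρ : ∀ x, ρ x ≤ B) (hL : c.need B ≤ L) :
    ∃ mem', Exec c.prog ⟨inp, [], [], cnt, [], out, ρ, mem⟩
      ⟨inp, [], [], cnt, [], out, ρ, mem'⟩ (c.cost B) ∧ Represents mem' (c.run ρ μ) L := by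
  classical
  induction c generalizing cnt out ρ mem B μ with
  | wr a e φ =>
    simp only [need] at hL
    obtain ⟨mem₁, h₁, hmem₁⟩ := φ.exec_prog inp cnt out ρ mem hmem hρ (by omega)
    obtain ⟨mem₂, h₂, hmem₂⟩ := exec_storeProg a e inp cnt out ρ mem₁ hmem₁ hρ (by omega)
      (φ.Holds μ ρ)
    exact ⟨mem₂, h₁.seq h₂, hmem₂⟩
  | seq c d ih₁ ih₂ =>
    simp only [need] at hL
    obtain ⟨mem₁, h₁, hmem₁⟩ := ih₁ cnt out ρ mem hmem hρ (by omega)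
    obtain ⟨mem₂, h₂, hmem₂⟩ := ih₂ cnt out ρ mem₁ hmem₁ hρ (by omega)
    exact ⟨mem₂, h₁.seq h₂, hmem₂⟩
  | loop x e c ih =>
    obtain ⟨out', mem', h, rfl, hmem'⟩ := exec_forProg (c := prog c) (inp := inp)
      (T := c.cost (B + e.top B)) cnt out mem ρ hρ x e
      (fun k out' mem' => out' = out ∧ Represents mem'
        (Nat.rec μ (fun i μ => run (Function.update ρ x i) c μ) k) L) ⟨rfl, hmem⟩ (by
        rintro i hi cnt out' mem' ⟨rfl, hmem'⟩
        obtain ⟨mem'', h, hmem''⟩ := ih cnt out' (Function.update ρ x i) mem' hmem'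
          (Fm.update_le hρ x (hi.le.trans (e.eval_le_top hρ))) hL
        exact ⟨_, mem'', h, rfl, hmem''⟩)
    exact ⟨mem', h, hmem'⟩

end Cmd

/-! ## Polynomial bounds -/

/-- Functions bounded by a polynomial. -/
def PolyBounded (f : ℕ → ℕ) : Prop := ∃ p : Polynomial ℕ, ∀ n, f n ≤ p.eval n

namespace PolyBounded

variable {f g : ℕ → ℕ}

theorem const (k : ℕ) : PolyBounded fun _ => k := ⟨Polynomial.C k, fun n => by simp⟩

theorem id : PolyBounded fun n => n := ⟨Polynomial.X, fun n => by simp⟩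

theorem add (hf : PolyBounded f) (hg : PolyBounded g) : PolyBounded fun n => f n + g n := by
  obtain ⟨p, hp⟩ := hf
  obtain ⟨q, hq⟩ := hg
  exact ⟨p + q, fun n => by simpa using Nat.add_le_add (hp n) (hq n)⟩

theorem mul (hf : PolyBounded f) (hg : PolyBounded g) : PolyBounded fun n => f n * g n := by
  obtain ⟨p, hp⟩ := hf
  obtain ⟨q, hq⟩ := hg
  exact ⟨p * q, fun n => by simpa using Nat.mul_le_mul (hp n) (hq n)⟩

theorem exp_top (hf : PolyBounded f) (e : Exp) : PolyBounded fun n => e.top (f n) := by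
  induction e with
  | var x => exact hf
  | zero => exact const 0
  | one => exact const 1
  | add e e' h h' => exact h.add h'
  | mul e e' h h' => exact h.mul h'

theorem exp_cost (hf : PolyBounded f) (e : Exp) : PolyBounded fun n => e.cost (f n) := by
  induction e with
  | var x => exact ((const 7).mul hf).add (const 2)
  | zero => exact const 1
  | one => exact const 1
  | add e e' h h' => exact h.add h'
  | mul e e' h h' => exact (h.add ((hf.exp_top e).mul (h'.add (const 5)))).add (const 6)

theorem forCost (hf : PolyBounded f) (hg : PolyBounded g) (e : Exp) :
    PolyBounded fun n => forCost e (g n) (f n) :=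
  (((hf.exp_cost e).add ((const 6).mul hf)).add
    ((hf.exp_top e).mul (hg.add (const 8)))).add (const 10)

/-- The bound `f` is generalized because a quantifier replaces it by `f + e.top f`. Since the depth
of `φ` is fixed, only finitely many such substitutions occur and the result remains polynomial. -/
theorem fm_cost (hf : PolyBounded f) (φ : Fm) : PolyBounded fun n => φ.cost (f n) := by
  induction φ generalizing f with
  | rd a e => exact ((hf.exp_cost e).add ((const 9).mul (hf.exp_top e))).add (const 4)
  | eq e e' =>
    exact ((((hf.exp_cost e).add (hf.exp_cost e')).add ((const 7).mul (hf.exp_top e))).add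
      ((const 5).mul (hf.exp_top e'))).add (const 6)
  | not φ h => exact (h hf).add (const 3)
  | and φ ψ h h' => exact ((h hf).add (h' hf)).add (const 4)
  | ex x e φ h =>
    exact (hf.forCost ((h (hf.add (hf.exp_top e))).add (const 4)) e).add (const 1)

theorem fm_need (hf : PolyBounded f) (φ : Fm) : PolyBounded fun n => φ.need (f n) := by
  induction φ generalizing f with
  | rd a e => exact hf.exp_top e
  | eq e e' => exact const 0
  | not φ h => exact h hf
  | and φ ψ h h' => exact (h hf).add (h' hf)
  | ex x e φ h => exact h (hf.add (hf.exp_top e))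

theorem cmd_cost (hf : PolyBounded f) (c : Cmd) : PolyBounded fun n => c.cost (f n) := by
  induction c generalizing f with
  | wr a e φ =>
    exact (hf.fm_cost φ).add
      (((hf.exp_cost e).add ((const 9).mul (hf.exp_top e))).add (const 6))
  | seq c d h h' => exact (h hf).add (h' hf)
  | loop x e c h => exact hf.forCost (h (hf.add (hf.exp_top e))) e

theorem cmd_need (hf : PolyBounded f) (c : Cmd) : PolyBounded fun n => c.need (f n) := by
  induction c generalizing f with
  | wr a e φ => exact ((hf.fm_need φ).add (hf.exp_top e)).add (const 1)
  | seq c d h h' => exact (h hf).add (h' hf)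
  | loop x e c h => exact h (hf.add (hf.exp_top e))

end PolyBounded

/-! ## Input and output -/

/-- An injective polynomial code of pairs. -/
def pair (i j : ℕ) : ℕ := (i + j) * (i + j) + i

/-- The expression for the code of a pair. -/
def Exp.pair (e f : Exp) : Exp := (e + f) * (e + f) + e

@[simp] theorem Exp.eval_pair (ρ) (e f : Exp) :
    (Exp.pair e f).eval ρ = _root_.pair (e.eval ρ) (f.eval ρ) := rfl

-- With `s = i + j` the code lies between `s ^ 2` and `s ^ 2 + s`, below the next square, so it
-- determines `s` and then `i`.
@[simp] theorem pair_inj {i j i' j' : ℕ} : pair i j = pair i' j' ↔ i = i' ∧ j = j' := by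
  refine ⟨fun h => ?_, by rintro ⟨rfl, rfl⟩; rfl⟩
  unfold pair at h
  have : i + j = i' + j' := by
    rcases lt_trichotomy (i + j) (i' + j') with h' | h' | h'
    · nlinarith
    · exact h'
    · nlinarith
  rw [this] at h
  omega

/-- The values of the variables when only the first two are used. -/
def vars (u v : ℕ) : Fin 16 → ℕ := Function.update (Function.update (fun _ => 0) 0 u) 1 v

theorem vars_zero (u v : ℕ) : vars u v 0 = u := rfl
theorem vars_one (u v : ℕ) : vars u v 1 = v := rfl

theorem update_vars_zero (u v w : ℕ) : Function.update (vars u v) 0 w = vars w v := by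
  unfold vars
  rw [Function.update_comm (by decide), Function.update_idem]

theorem update_vars_one (u v w : ℕ) : Function.update (vars u v) 1 w = vars u w := by
  unfold vars
  rw [Function.update_idem]

theorem vars_le {u v B : ℕ} (hu : u ≤ B) (hv : v ≤ B) (x : Fin 16) : vars u v x ≤ B := by
  unfold vars Function.update
  split_ifs <;> simp [hu, hv]

/-- The row and column numbers and the set of marked positions after reading a word which starts in
row `u` and column `v`. -/
def scan : List (Option Bool) → ℕ → ℕ → (ℕ → Prop) → ℕ × ℕ × (ℕ → Prop)
  | [], u, v, A => (u, v, A)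
  | none :: l, u, _, A => scan l (u + 1) 0 A
  | some b :: l, u, v, A => scan l u (v + 1) (Function.update A (pair u v) (b = true))

/-- Store the input matrix in the array `0`, and its number of rows in the variable `0`. -/
def scanProg : Prog :=
  .loop .inp Option.isSome (.ite .inp (fun o => o == some none)
    (.pop .inp ;; clearVar 1 ;; .push (.var 0) true)
    (.ite .inp (fun o => o == some (some true)) (.push .out true) (.push .out false) ;; .pop .inp ;;
      storeProg 0 (Exp.pair (.var 0) (.var 1)) ;; .push (.var 1) true))

/-- A time bound for reading one symbol of the input. -/
def scanCost (B : ℕ) : ℕ :=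
  (Exp.pair (.var 0) (.var 1)).cost B + 9 * (Exp.pair (.var 0) (.var 1)).top B + 2 * B + 11

/-- The number of vertices is not announced in the input; it is found in variable `0` by counting
end markers. Row and column numbers grow by at most one per symbol, which explains the bounds `hu`
and `hv`. -/
theorem exec_scanProg (l : List (Option Bool)) (u v : ℕ) (A : ℕ → Prop) (cnt out : List Bool)
    (mem : Fin 16 → List Bool) {μ : Fin 16 → ℕ → Prop} {L B : ℕ} (hmem : Represents mem μ L)
    (hA : μ 0 = A) (hu : u + l.length ≤ B) (hv : v + l.length ≤ B)
    (hL : (Exp.pair (.var 0) (.var 1)).top B < L) :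
    ∃ mem', Exec scanProg ⟨l, [], [], cnt, [], out, vars u v, mem⟩
      ⟨[], [], [], cnt, [], out, vars (scan l u v A).1 (scan l u v A).2.1, mem'⟩
      (l.length * (scanCost B + 1) + 1) ∧
      Represents mem' (Function.update μ 0 (scan l u v A).2.2) L := by
  induction l generalizing u v A mem μ with
  | nil =>
    refine ⟨mem, Exec.mono (Runs.loop_false (by simp [Store.get])) (by simp), ?_⟩
    rw [scan, ← hA, Function.update_eq_self]
    exact hmem
  | cons o l ih =>
    simp only [List.length_cons] at hu hv
    rcases o with _ | b
    · obtain ⟨mem', h, hmem'⟩ := ih (u + 1) 0 A mem hmem hA (by omega) (by omega)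
      refine ⟨mem', ?_, hmem'⟩
      have h₁ : Exec _ ⟨none :: l, [], [], cnt, [], out, vars u v, mem⟩ _ _ :=
        Exec.pop_inp.seq <| (exec_clearVar l [] [] cnt [] out (vars u v) mem 1).seq <|
          Exec.push_var (x := 0)
      rw [update_vars_one, update_vars_zero, vars_zero, vars_one] at h₁
      refine Exec.mono (Runs.loop_true (by simp [Store.get])
        (Runs.ite_true (by simp [Store.get]) h₁) h) ?_
      simp only [List.length_cons, scanCost]
      rw [Nat.add_one_mul l.length]
      omega
    · obtain ⟨mem₁, h₂, hmem₁⟩ := exec_storeProg 0 (Exp.pair (.var 0) (.var 1)) l cnt out (vars u v)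
        mem hmem (vars_le (B := B) (by omega) (by omega)) hL (b = true)
      obtain ⟨mem', h, hmem'⟩ := ih u (v + 1) _ mem₁ hmem₁ rfl (by omega) (by omega)
      simp only [Function.update_self, Exp.eval_pair, Exp.eval_var, vars_zero, vars_one,
        Function.update_idem, hA] at h hmem'
      refine ⟨mem', ?_, hmem'⟩
      have h₁ : Exec (.ite .inp (fun o => o == some (some true)) (.push .out true)
          (.push .out false)) ⟨some b :: l, [], [], cnt, [], out, vars u v, mem⟩
          ⟨some b :: l, [], [], cnt, [], decide (b = true) :: out, vars u v, mem⟩ 2 := by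
        refine Exec.ite (t := 1) b ?_ ?_ ?_
        · cases b <;> rfl
        all_goals
          rintro rfl
          exact Exec.push_out
      have h₃ := h₁.seq <| Exec.pop_inp.seq <| h₂.seq <| Exec.push_var (x := 1)
      rw [update_vars_one, vars_one] at h₃
      refine Exec.mono (Runs.loop_true (by simp [Store.get])
        (Runs.ite_false (by simp [Store.get]) h₃) h) ?_
      simp only [List.length_cons, scanCost]
      rw [Nat.add_one_mul l.length]
      omega

theorem scan_row (f : ℕ → Bool) (l : List (Option Bool)) (u v k : ℕ) (A : ℕ → Prop) :
    ∃ A', scan ((List.range' v k).map (fun j => some (f j)) ++ none :: l) u v A =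
      scan l (u + 1) 0 A' ∧ ∀ i j, A' (pair i j) ↔
        if i = u ∧ v ≤ j ∧ j < v + k then f j = true else A (pair i j) := by
  induction k generalizing v A with
  | zero => exact ⟨A, rfl, fun i j => by rw [if_neg (by omega)]⟩
  | succ k ih =>
    obtain ⟨A', h, hA'⟩ := ih (v + 1) (Function.update A (pair u v) (f v = true))
    refine ⟨A', h, fun i j => (hA' i j).trans ?_⟩
    by_cases h₁ : i = u ∧ v + 1 ≤ j ∧ j < v + 1 + k
    · rw [if_pos h₁, if_pos (by omega)]
    · rw [if_neg h₁]
      by_cases h₂ : i = u ∧ j = v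
      · obtain ⟨rfl, rfl⟩ := h₂
        simp
      · rw [Function.update_of_ne (by simpa using h₂), if_neg (by omega)]

theorem scan_matrix (f : ℕ → ℕ → Bool) (n u k : ℕ) (A : ℕ → Prop) :
    ∃ A', scan ((List.range' u k).flatMap fun i =>
      (List.range' 0 n).map (fun j => some (f i j)) ++ [none]) u 0 A = (u + k, 0, A') ∧
      ∀ i j, A' (pair i j) ↔
        if u ≤ i ∧ i < u + k ∧ j < n then f i j = true else A (pair i j) := by
  induction k generalizing u A with
  | zero => exact ⟨A, rfl, fun i j => by rw [if_neg (by omega)]⟩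
  | succ k ih =>
    obtain ⟨A₁, h₁, hA₁⟩ := scan_row (f u) ((List.range' (u + 1) k).flatMap fun i =>
      (List.range' 0 n).map (fun j => some (f i j)) ++ [none]) u 0 n A
    obtain ⟨A₂, h₂, hA₂⟩ := ih (u + 1) A₁
    refine ⟨A₂, ?_, fun i j => (hA₂ i j).trans ?_⟩
    · rw [List.range'_succ, List.flatMap_cons, List.append_assoc, List.singleton_append, h₁, h₂,
        show u + 1 + k = u + (k + 1) by omega]
    · by_cases h : u + 1 ≤ i ∧ i < u + 1 + k ∧ j < n
      · rw [if_pos h, if_pos (by omega)]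
      · rw [if_neg h, hA₁]
        by_cases h' : i = u ∧ j < n
        · obtain ⟨rfl, h'⟩ := h'
          rw [if_pos (by omega), if_pos (by omega)]
        · rw [if_neg (by omega), if_neg (by omega)]

open Classical in
theorem encodeGraph_eq {n : ℕ} (G : SimpleGraph (Fin n)) :
    encodeGraph G = (List.range' 0 n).flatMap fun i => (List.range' 0 n).map (fun j =>
      some (decide (∃ (hi : i < n) (hj : j < n), G.Adj ⟨i, hi⟩ ⟨j, hj⟩))) ++ [none] := by
  have h : ∀ i j : Fin n, (∃ (hi : i.1 < n) (hj : j.1 < n), G.Adj ⟨i, hi⟩ ⟨j, hj⟩) ↔ G.Adj i j :=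
    fun i j => ⟨fun ⟨_, _, h⟩ => h, fun h => ⟨i.2, j.2, h⟩⟩
  rw [← List.range_eq_range', ← List.map_coe_finRange_eq_range]
  simp only [List.flatMap_map, List.map_map, Function.comp_def, h]
  rfl

theorem length_encodeGraph {n : ℕ} (G : SimpleGraph (Fin n)) :
    (encodeGraph G).length = n * (n + 1) := by
  simp [encodeGraph, List.length_flatMap]

theorem scan_encodeGraph {n : ℕ} (G : SimpleGraph (Fin n)) (A : ℕ → Prop) :
    ∃ A', scan (encodeGraph G) 0 0 A = (n, 0, A') ∧
      ∀ i j : Fin n, A' (pair i j) ↔ G.Adj i j := by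
  classical
  obtain ⟨A', h, hA'⟩ := scan_matrix
    (fun i j => decide (∃ (hi : i < n) (hj : j < n), G.Adj ⟨i, hi⟩ ⟨j, hj⟩)) n 0 n A
  refine ⟨A', ?_, fun i j => ?_⟩
  · rw [encodeGraph_eq, h, Nat.zero_add]
  · rw [hA', if_pos (by omega)]
    simp

/-- Push the first row of the array `a`, its first entry last. -/
def outputProg (a : Fin 16) : Prog :=
  forProg 1 (.var 0) (Fm.ex 2 (.var 0) (.and (.eq (.var 2 + .var 1 + 1) (.var 0))
    (.rd a (Exp.pair 0 (.var 2))))).prog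

/-- A time bound for `outputProg`. -/
def outputCost (a : Fin 16) (B : ℕ) : ℕ :=
  forCost (.var 0) ((Fm.ex 2 (.var 0) (.and (.eq (.var 2 + .var 1 + 1) (.var 0))
    (.rd a (Exp.pair 0 (.var 2))))).cost (B + B)) B

/-- A bound for the positions read by `outputProg`. -/
def outputNeed (a : Fin 16) (B : ℕ) : ℕ :=
  (Fm.ex 2 (.var 0) (.and (.eq (.var 2 + .var 1 + 1) (.var 0))
    (.rd a (Exp.pair 0 (.var 2))))).need (B + B)

open Classical in
-- A stack is read from its last pushed symbol, so round `i` must push entry `n - (i + 1)`.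
-- Expressions have no subtraction; this index is instead found as the `r < n` with `r + i + 1 = n`.
theorem exec_outputProg (a : Fin 16) (n : ℕ) (inp : List (Option Bool)) (cnt : List Bool)
    (mem : Fin 16 → List Bool) {μ : Fin 16 → ℕ → Prop} {L B : ℕ} (hmem : Represents mem μ L)
    (hn : n ≤ B) (hL : outputNeed a B ≤ L) :
    ∃ mem', Exec (outputProg a) ⟨inp, [], [], cnt, [], [], vars n 0, mem⟩
      ⟨inp, [], [], cnt, [], (List.range n).map fun r => decide (μ a (pair 0 r)), vars n 0, mem'⟩
      (outputCost a B) ∧ Represents mem' μ L := by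
  have hρ := vars_le (u := n) (v := 0) hn (Nat.zero_le B)
  obtain ⟨out', mem', h, rfl, hmem'⟩ := exec_forProg
    (c := (Fm.ex 2 (.var 0) (.and (.eq (.var 2 + .var 1 + 1) (.var 0))
      (.rd a (Exp.pair 0 (.var 2))))).prog) (inp := inp)
    (T := (Fm.ex 2 (.var 0) (.and (.eq (.var 2 + .var 1 + 1) (.var 0))
      (.rd a (Exp.pair 0 (.var 2))))).cost (B + B)) cnt [] mem (vars n 0) hρ 1 (.var 0)
    (fun i out' mem' => out' = ((List.range i).map fun t => decide (μ a (pair 0 (n - i + t)))) ∧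
      Represents mem' μ L) ⟨rfl, hmem⟩ (by
      rintro i hi cnt out' mem' ⟨rfl, hmem'⟩
      rw [Exp.eval_var, vars_zero] at hi
      obtain ⟨mem'', h, hmem''⟩ := Fm.exec_prog (.ex 2 (.var 0) (.and
        (.eq (.var 2 + .var 1 + 1) (.var 0)) (.rd a (Exp.pair 0 (.var 2))))) inp cnt
        ((List.range i).map fun t => decide (μ a (pair 0 (n - i + t))))
        (Function.update (vars n 0) 1 i) mem' hmem' (Fm.update_le hρ 1 (hi.le.trans hn)) hL
      refine ⟨_, mem'', h, ?_, hmem''⟩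
      rw [List.range_succ_eq_map, List.map_cons, List.map_map]
      congr 1
      · rw [decide_eq_decide]
        have h₀ : ∀ r, Function.update (Function.update (vars n 0) 1 i) 2 r 0 = n := fun r => rfl
        have h₁ : ∀ r, Function.update (Function.update (vars n 0) 1 i) 2 r 1 = i := fun r => rfl
        have h₂ : ∀ r, Function.update (Function.update (vars n 0) 1 i) 2 r 2 = r := fun r => rfl
        have h₃ : Function.update (vars n 0) 1 i 0 = n := rfl
        simp only [Fm.Holds, Exp.eval_add, Exp.eval_var, Exp.eval_one, Exp.eval_pair,
          Exp.eval_zero, h₀, h₁, h₂, h₃]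
        constructor
        · rintro ⟨r, hr, hri, hr'⟩
          rwa [show n - (i + 1) + 0 = r by omega]
        · intro h
          exact ⟨n - (i + 1), by omega, by omega, h⟩
      · refine List.map_congr_left fun t ht => ?_
        simp only [Function.comp_apply]
        rw [show n - (i + 1) + t.succ = n - i + t by omega])
  refine ⟨mem', ?_, hmem'⟩
  rw [Exp.eval_var, vars_zero] at h
  simpa [outputProg, outputCost] using h

/-- Empty the given arrays. -/
def clearMems : List (Fin 16) → Prog
  | [] => .skip
  | a :: l => .loop (.mem a) Option.isSome (.pop (.mem a)) ;; clearMems l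

/-- A halting configuration must have every stack but the output stack empty. -/
theorem exec_clearMems (l : List (Fin 16)) (inp : List (Option Bool))
    (acc tmp cnt lft out : List Bool) (var : Fin 16 → ℕ) (mem : Fin 16 → List Bool) {L : ℕ}
    (hL : ∀ a, (mem a).length ≤ L) :
    Exec (clearMems l) ⟨inp, acc, tmp, cnt, lft, out, var, mem⟩
      ⟨inp, acc, tmp, cnt, lft, out, var, fun a => if a ∈ l then [] else mem a⟩
      (l.length * (2 * L + 1) + 1) := by
  induction l generalizing mem with
  | nil => simpa [clearMems] using Exec.skip
  | cons a l ih =>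
    have h₁ := Exec.loop (k := .mem a) (f := Option.isSome) (c := .pop (.mem a))
      (fun i => ⟨inp, acc, tmp, cnt, lft, out, var, Function.update mem a ((mem a).drop i)⟩)
      (mem a).length 1
      (fun i hi => by simp [Store.get, hi])
      (fun i hi => by
        have := Exec.pop_mem (inp := inp) (acc := acc) (tmp := tmp) (cnt := cnt) (lft := lft)
          (out := out) (var := var) (mem := Function.update mem a ((mem a).drop i)) (a := a)
        simpa using this)
      (by simp [Store.get])
    have h₂ := ih (Function.update mem a []) (fun b => by
      by_cases hb : b = a
      · subst hb; simp
      · simpa [hb] using hL b)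
    simp only [List.drop_zero, Function.update_eq_self, List.drop_length] at h₁
    have h₃ := h₁.seq h₂
    have : (fun b => if b ∈ l then [] else Function.update mem a [] b) =
        fun b => if b ∈ a :: l then [] else mem b := by
      funext b
      by_cases hb : b = a
      · subst hb; simp
      · simp [hb]
    rw [this] at h₃
    refine h₃.mono ?_
    have := hL a
    simp only [List.length_cons, Nat.succ_mul]
    omega

/-- The whole computation with the output array `a`. -/
def solveProg (c : Cmd) (a : Fin 16) : Prog :=
  scanProg ;; c.prog ;; outputProg a ;; clearVar 0 ;; clearMems (List.finRange 16)

/-- A bound for the lengths of all arrays. -/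
def solveNeed (c : Cmd) (a : Fin 16) (B : ℕ) : ℕ :=
  (Exp.pair (.var 0) (.var 1)).top B + 1 + c.need B + outputNeed a B

/-- A time bound for the whole computation. -/
def solveCost (c : Cmd) (a : Fin 16) (B : ℕ) : ℕ :=
  B * (scanCost B + 1) + c.cost B + outputCost a B + 2 * B + 16 * (2 * solveNeed c a B + 1) + 3

theorem polyBounded_solveCost (c : Cmd) (a : Fin 16) : PolyBounded (solveCost c a) := by
  have hid := PolyBounded.id
  have hBB := hid.add hid
  have h₁ : PolyBounded scanCost :=
    (((hid.exp_cost _).add ((PolyBounded.const 9).mul (hid.exp_top _))).add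
      ((PolyBounded.const 2).mul hid)).add (PolyBounded.const 11)
  have h₂ : PolyBounded (outputCost a) := hid.forCost (hBB.fm_cost _) _
  have h₃ : PolyBounded (outputNeed a) := hBB.fm_need _
  have h₄ : PolyBounded (solveNeed c a) :=
    (((hid.exp_top _).add (PolyBounded.const 1)).add (hid.cmd_need c)).add h₃
  exact (((((hid.mul (h₁.add (PolyBounded.const 1))).add (hid.cmd_cost c)).add h₂).add
    ((PolyBounded.const 2).mul hid)).add ((PolyBounded.const 16).mul
      (((PolyBounded.const 2).mul h₄).add (PolyBounded.const 1)))).add (PolyBounded.const 3)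

/-- The array contents after reading a graph. -/
def inputArrays {n : ℕ} (G : SimpleGraph (Fin n)) : Fin 16 → ℕ → Prop :=
  Function.update (fun _ _ => False) 0 (scan (encodeGraph G) 0 0 fun _ => False).2.2

open Classical in
theorem exec_solveProg (c : Cmd) (a : Fin 16) {n : ℕ} (G : SimpleGraph (Fin n)) :
    Exec (solveProg c a) ⟨encodeGraph G, [], [], [], [], [], fun _ => 0, fun _ => []⟩
      ⟨[], [], [], [], [], (List.range n).map fun r =>
        decide (c.run (vars n 0) (inputArrays G) a (pair 0 r)), fun _ => 0, fun _ => []⟩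
      (solveCost c a (encodeGraph G).length) := by
  set B := (encodeGraph G).length with hB
  have hn : n ≤ B := by rw [hB, length_encodeGraph]; nlinarith
  have hv : vars 0 0 = fun _ => 0 := by simp [vars]
  obtain ⟨A', hscan, -⟩ := scan_encodeGraph G fun _ => False
  obtain ⟨mem₁, h₁, hmem₁⟩ := exec_scanProg (encodeGraph G) 0 0 (fun _ => False) [] []
    (fun _ => []) (μ := fun _ _ => False) (L := solveNeed c a B) (B := B)
    (fun b => ⟨fun i => by simp, by simp⟩) rfl (by omega) (by omega) (by unfold solveNeed; omega)
  obtain ⟨mem₂, h₂, hmem₂⟩ := c.exec_prog [] [] [] (vars n 0) mem₁ (B := B) hmem₁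
    (vars_le hn (Nat.zero_le B)) (by unfold solveNeed; omega)
  obtain ⟨mem₃, h₃, hmem₃⟩ := exec_outputProg a n [] [] mem₂ (B := B) hmem₂ hn
    (by unfold solveNeed; omega)
  rw [hscan, ← hB] at h₁
  have h₄ := fun out => exec_clearVar [] [] [] [] [] out (vars n 0) mem₃ 0
  have h₅ := fun out => exec_clearMems (List.finRange 16) [] [] [] [] [] out (vars 0 0) mem₃
    fun a => (hmem₃ a).2
  simp only [update_vars_zero, vars_zero, List.mem_finRange, if_true, List.length_finRange] at h₄ h₅
  rw [← hv]
  refine (h₁.seq <| h₂.seq <| h₃.seq <| (h₄ _).seq <| h₅ _).mono ?_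
  unfold solveCost
  omega

theorem encodeVertexSet_eq {n : ℕ} (X : Finset (Fin n)) (P : ℕ → Prop) [DecidablePred P]
    (h : ∀ v : Fin n, v ∈ X ↔ P v) :
    encodeVertexSet X = (List.range n).map fun r => decide (P r) := by
  rw [← List.map_coe_finRange_eq_range, List.map_map]
  unfold encodeVertexSet
  refine List.map_congr_left fun v _ => ?_
  simp [h]

open Classical in
/-- A vertex deletion problem which is solved by a command is solvable in polynomial time. -/
theorem vertexDeletionInP_of_cmd {𝒞₁ 𝒞₂ : GraphClass} (c : Cmd) (a : Fin 16)
    (h : ∀ x : DeletionInstance 𝒞₁, ∀ μ : Fin 16 → ℕ → Prop,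
      (∀ i j : Fin x.n, μ 0 (pair i j) ↔ x.graph.Adj i j) →
      IsMinimumDeletionSet 𝒞₂ x.graph
        (Finset.univ.filter fun v : Fin x.n => c.run (vars x.n 0) μ a (pair 0 v))) :
    VertexDeletionInP 𝒞₁ 𝒞₂ := by
  refine ⟨fun x => Finset.univ.filter fun v : Fin x.n =>
    c.run (vars x.n 0) (inputArrays x.graph) a (pair 0 v), fun x => h x _ fun i j => ?_, ?_⟩
  · obtain ⟨A', hscan, hA'⟩ := scan_encodeGraph x.graph fun _ => False
    simp only [inputArrays, Function.update_self, hscan]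
    exact hA' i j
  · obtain ⟨p, hp⟩ := polyBounded_solveCost c a
    refine ⟨{ tm := machine (solveProg c a) .inp .out
              inputAlphabet := Equiv.refl _
              outputAlphabet := Equiv.refl _
              -- The extra `1` is the halting step from `machine_outputs`.
              time := p + 1
              outputsFun := fun x => ?_ }⟩
    have hrun := exec_solveProg c a x.graph
    have h₀ : Store.get ⟨encodeGraph x.graph, [], [], [], [], [], fun _ => 0, fun _ => []⟩ =
        @Function.update Stk (fun k => List k.Alphabet) _ (fun _ => []) .inp
          (encodeGraph x.graph) := by
      ext1 k
      cases k <;> simp [Store.get, Function.update]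
    have h₁ : ∀ l, Store.get ⟨[], [], [], [], [], l, fun _ => 0, fun _ => []⟩ =
        @Function.update Stk (fun k => List k.Alphabet) _ (fun _ => []) .out l := by
      intro l
      ext1 k
      cases k <;> simp [Store.get, Function.update]
    unfold Exec at hrun
    rw [h₀, h₁] at hrun
    have := Classical.choice (machine_outputs (solveProg c a) .inp .out _ _ _ hrun)
    rw [← encodeVertexSet_eq (Finset.univ.filter fun v : Fin x.n =>
      c.run (vars x.n 0) (inputArrays x.graph) a (pair 0 v)) _ (by simp)] at this
    refine ⟨⟨this.steps, ?_⟩, this.steps_le_m.trans ?_⟩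
    · have h₂ := this.evals_in_steps
      convert h₂ using 3
      · exact congrArg _ (List.map_id _)
      · exact congrArg _ (List.map_id _)
    · simpa using hp (encodeGraph x.graph).length

/-! ## Maximum weight independent sets by local ratio -/

namespace LocalRatio

variable (m : ℕ) (H : ℕ → ℕ → Prop)

/-- The vertex `p < m` of the graph `H` has positive weight, and its neighbours of positive weight
form a clique. -/
def Simplicial (w : ℕ → ℕ) (p : ℕ) : Prop :=
  0 < w p ∧ ∀ q < m, ∀ r < m, H p q → 0 < w q → H p r → 0 < w r → q = r ∨ H q r

/-- `p` is the first simplicial vertex. -/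
def Selected (w : ℕ → ℕ) (p : ℕ) : Prop :=
  Simplicial m H w p ∧ ∀ q < p, ¬ Simplicial m H w q

open Classical in
/-- Subtract the weight of the selected vertex from the weights in its closed neighbourhood. -/
noncomputable def reduce (w : ℕ → ℕ) (p : ℕ) : ℕ :=
  if h : ∃ q < m, Selected m H w q ∧ (q = p ∨ H q p) then w p - w h.choose else w p

/-- The independent set found from the weights `w` after `k` rounds. -/
def solution : ℕ → (ℕ → ℕ) → ℕ → Prop
  | 0, _, _ => False
  | k + 1, w, p => solution k (reduce m H w) p ∨
      Selected m H w p ∧ ¬ ∃ q < m, solution k (reduce m H w) q ∧ H p q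

/-- Every nonempty set of vertices of positive weight has a simplicial vertex. -/
def Eliminable (w : ℕ → ℕ) : Prop :=
  ∀ S : ℕ → Prop, (∀ p, S p → p < m ∧ 0 < w p) → (∃ p, S p) →
    ∃ p, S p ∧ ∀ q r, S q → S r → H p q → H p r → q = r ∨ H q r

/-! ### Correctness of the local ratio recursion. -/

variable {m H} {w : ℕ → ℕ} {p q : ℕ}

theorem Selected.unique (hp : Selected m H w p) (hq : Selected m H w q) : p = q := by
  rcases lt_trichotomy p q with h | h | h
  · exact (hq.2 _ h hp.1).elim
  · exact h
  · exact (hp.2 _ h hq.1).elim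

/-- The choice made in `reduce` is immaterial, as there is at most one selected vertex. -/
theorem reduce_of_selected (hq : q < m) (h : Selected m H w q) (hp : q = p ∨ H q p) :
    reduce m H w p = w p - w q := by
  have h' : ∃ q < m, Selected m H w q ∧ (q = p ∨ H q p) := ⟨q, hq, h, hp⟩
  rw [reduce, dif_pos h', h'.choose_spec.2.1.unique h]

theorem reduce_of_not (h : ¬ ∃ q < m, Selected m H w q ∧ (q = p ∨ H q p)) :
    reduce m H w p = w p := dif_neg h

theorem reduce_le (w : ℕ → ℕ) (p : ℕ) : reduce m H w p ≤ w p := by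
  unfold reduce
  split_ifs
  · exact Nat.sub_le _ _
  · exact le_rfl

/-- This removes both the choice and the subtraction from `reduce`, so that the new weights, stored
in unary, can be described by a bounded formula. -/
theorem lt_reduce_iff {s : ℕ} : s < reduce m H w p ↔
    s < w p ∧ ∀ q < m, Selected m H w q ∧ (q = p ∨ H q p) → s + w q < w p := by
  by_cases h : ∃ q < m, Selected m H w q ∧ (q = p ∨ H q p)
  · obtain ⟨q, hq, hs, hp⟩ := h
    rw [reduce_of_selected hq hs hp]
    constructor
    · intro h
      refine ⟨by omega, fun r _ hr => ?_⟩
      rw [hr.1.unique hs]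
      omega
    · rintro ⟨-, h⟩
      have := h q hq ⟨hs, hp⟩
      omega
  · rw [reduce_of_not h]
    exact ⟨fun h' => ⟨h', fun q hq hs => (h ⟨q, hq, hs⟩).elim⟩, fun h' => h'.1⟩

theorem Eliminable.mono {w' : ℕ → ℕ} (h : Eliminable m H w) (hw : ∀ p, w' p ≤ w p) :
    Eliminable m H w' :=
  fun S hS => h S fun p hp => ⟨(hS p hp).1, (hS p hp).2.trans_le (hw p)⟩

theorem Eliminable.exists_selected (h : Eliminable m H w) (hp : p < m) (hw : 0 < w p) :
    ∃ q < m, Selected m H w q := by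
  classical
  obtain ⟨q, ⟨hq, hq'⟩, hs⟩ := h (fun q => q < m ∧ 0 < w q) (fun q hq => hq) ⟨p, hp, hw⟩
  have hex : ∃ q, Simplicial m H w q :=
    ⟨q, hq', fun r hr r' hr' h₁ h₂ h₃ h₄ => hs r r' ⟨hr, h₂⟩ ⟨hr', h₄⟩ h₁ h₃⟩
  refine ⟨Nat.find hex, lt_of_le_of_lt (Nat.find_min' hex ?_) hq, Nat.find_spec hex,
    fun r hr => Nat.find_min hex hr⟩
  exact ⟨hq', fun r hr r' hr' h₁ h₂ h₃ h₄ => hs r r' ⟨hr, h₂⟩ ⟨hr', h₄⟩ h₁ h₃⟩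

open Classical in
-- Every effective round annihilates the weight of the selected vertex and increases no weight, so
-- the number of vertices of positive weight drops and `k` rounds suffice. Positivity of the weights
-- on the solution belongs to the induction: it shows that no truncation occurred at a solution
-- vertex adjacent to the selected one.
theorem solution_spec (hsymm : ∀ p q, H p q → H q p) (k : ℕ) (w : ℕ → ℕ)
    (hE : Eliminable m H w) (hk : ((Finset.range m).filter fun p => 0 < w p).card ≤ k) :
    (∀ p, p < m → solution m H k w p → 0 < w p) ∧
    (∀ p q, p < m → q < m → solution m H k w p → solution m H k w q → ¬ H p q ∨ p = q) ∧
    ∀ J ⊆ Finset.range m, (∀ p ∈ J, ∀ q ∈ J, p ≠ q → ¬ H p q) →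
      ∑ p ∈ J, w p ≤ ∑ p ∈ (Finset.range m).filter (solution m H k w), w p := by
  induction k generalizing w with
  | zero =>
    have h₀ : ∀ p < m, w p = 0 := by
      intro p hp
      have := Finset.card_eq_zero.1 (Nat.le_zero.1 hk)
      have hp' := Finset.filter_eq_empty_iff.1 this (Finset.mem_range.2 hp)
      omega
    refine ⟨fun _ _ h => h.elim, fun _ _ _ _ h => h.elim, fun J hJ _ => ?_⟩
    rw [Finset.sum_eq_zero fun p hp => h₀ p (Finset.mem_range.1 (hJ hp))]
    exact Nat.zero_le _
  | succ k ih =>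
    set w' := reduce m H w with hw'
    have hle : ∀ p, w' p ≤ w p := reduce_le w
    by_cases hsel : ∃ p < m, Selected m H w p
    · obtain ⟨p, hp, hs⟩ := hsel
      have hw'p : w' p = 0 := by
        rw [hw', reduce_of_selected hp hs (Or.inl rfl), Nat.sub_self]
      have hcard : ((Finset.range m).filter fun p => 0 < w' p).card ≤ k := by
        refine Nat.le_of_lt_succ (lt_of_lt_of_le (Finset.card_lt_card ?_) hk)
        refine Finset.ssubset_iff_of_subset (fun q hq => ?_) |>.2 ⟨p, ?_, ?_⟩
        · rw [Finset.mem_filter] at hq ⊢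
          exact ⟨hq.1, hq.2.trans_le (hle q)⟩
        · exact Finset.mem_filter.2 ⟨Finset.mem_range.2 hp, hs.1.1⟩
        · simp [hw'p]
      obtain ⟨ha, hb, hc⟩ := ih w' (hE.mono hle) hcard
      have hmem : ∀ q, solution m H (k + 1) w q ↔ solution m H k w' q ∨
          q = p ∧ ¬ ∃ r < m, solution m H k w' r ∧ H p r := by
        intro q
        refine or_congr Iff.rfl ⟨fun h => ?_, ?_⟩
        · obtain rfl := h.1.unique hs
          exact ⟨rfl, h.2⟩
        · rintro ⟨rfl, h⟩
          exact ⟨hs, h⟩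
      refine ⟨fun q hq h => ?_, fun q r hq hr h h' => ?_, fun J hJ hJ' => ?_⟩
      · rcases (hmem q).1 h with h | ⟨rfl, -⟩
        · exact (ha q hq h).trans_le (hle q)
        · exact hs.1.1
      · rcases (hmem q).1 h with h | ⟨rfl, h⟩ <;> rcases (hmem r).1 h' with h' | ⟨rfl, h'⟩
        · exact hb q r hq hr h h'
        · exact Or.inl fun hH => h' ⟨q, hq, h, hsymm _ _ hH⟩
        · exact Or.inl fun hH => h ⟨r, hr, h', hH⟩
        · exact Or.inr rfl
      -- The vertices of positive weight in the closed neighbourhood of `p` are pairwise equal or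
      -- adjacent, so at most one of them lies in the independent set `J`; the others lose nothing.
      · have h₁ : ∑ q ∈ J, w q ≤ ∑ q ∈ J, w' q + w p := by
          set N := J.filter fun q => (p = q ∨ H p q) ∧ 0 < w q
          have hN : N.card ≤ 1 := by
            refine Finset.card_le_one.2 fun q hq r hr => ?_
            obtain ⟨hqJ, hq, hq₀⟩ := Finset.mem_filter.1 hq
            obtain ⟨hrJ, hr, hr₀⟩ := Finset.mem_filter.1 hr
            by_contra hne
            have hqr : ¬ H q r := hJ' q hqJ r hrJ hne
            rcases hq with rfl | hq <;> rcases hr with rfl | hr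
            · exact hne rfl
            · exact hqr hr
            · exact hqr (hsymm _ _ hq)
            · rcases hs.1.2 q (Finset.mem_range.1 (hJ hqJ)) r (Finset.mem_range.1 (hJ hrJ))
                hq hq₀ hr hr₀ with h | h
              · exact hne h
              · exact hqr h
          calc ∑ q ∈ J, w q
              ≤ ∑ q ∈ J, (w' q + if (p = q ∨ H p q) ∧ 0 < w q then w p else 0) := by
                refine Finset.sum_le_sum fun q hq => ?_
                by_cases h : p = q ∨ H p q
                · have : w' q = w q - w p := reduce_of_selected hp hs h
                  split_ifs with h' <;> simp only [h, true_and] at h' <;> omega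
                · have : w' q = w q := reduce_of_not fun ⟨r, hr, hr', hr''⟩ =>
                    h (by rwa [hr'.unique hs] at hr'')
                  omega
            _ = ∑ q ∈ J, w' q + N.card * w p := by
                rw [Finset.sum_add_distrib, ← Finset.sum_filter, Finset.sum_const, smul_eq_mul]
            _ ≤ ∑ q ∈ J, w' q + w p :=
                Nat.add_le_add_left (by simpa using Nat.mul_le_mul_right (w p) hN) _
        have h₂ := hc J hJ hJ'
        -- Either a neighbour `r` of `p` was taken, and then `w r = w' r + w p` because `w' r > 0`,
        -- or `p` itself is added with its weight `w p`.
        have h₃ : ∑ q ∈ (Finset.range m).filter (solution m H k w'), w' q + w p ≤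
            ∑ q ∈ (Finset.range m).filter (solution m H (k + 1) w), w q := by
          by_cases hex : ∃ r < m, solution m H k w' r ∧ H p r
          · obtain ⟨r, hr, hr', hpr⟩ := hex
            have hI : (Finset.range m).filter (solution m H (k + 1) w) =
                (Finset.range m).filter (solution m H k w') := by
              refine Finset.filter_congr fun q _ => (hmem q).trans ?_
              exact or_iff_left fun h => h.2 ⟨r, hr, hr', hpr⟩
            have hrI : r ∈ (Finset.range m).filter (solution m H k w') :=
              Finset.mem_filter.2 ⟨Finset.mem_range.2 hr, hr'⟩
            rw [hI, ← Finset.add_sum_erase _ _ hrI, ← Finset.add_sum_erase _ w hrI]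
            have h₄ : w' r = w r - w p := reduce_of_selected hp hs (Or.inr hpr)
            have h₅ := ha r hr hr'
            have h₆ : ∑ q ∈ ((Finset.range m).filter (solution m H k w')).erase r, w' q ≤
                ∑ q ∈ ((Finset.range m).filter (solution m H k w')).erase r, w q :=
              Finset.sum_le_sum fun q _ => hle q
            omega
          · have hI : (Finset.range m).filter (solution m H (k + 1) w) =
                insert p ((Finset.range m).filter (solution m H k w')) := by
              ext q
              simp only [Finset.mem_filter, Finset.mem_range, Finset.mem_insert, hmem]
              constructor
              · rintro ⟨hq, h | ⟨rfl, -⟩⟩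
                · exact Or.inr ⟨hq, h⟩
                · exact Or.inl rfl
              · rintro (rfl | ⟨hq, h⟩)
                · exact ⟨hp, Or.inr ⟨rfl, hex⟩⟩
                · exact ⟨hq, Or.inl h⟩
            -- The recursive solution contains only vertices of positive reduced weight, and `w' p =
            -- 0`.
            have hpI : p ∉ (Finset.range m).filter (solution m H k w') := by
              intro h
              have := ha p hp (Finset.mem_filter.1 h).2
              omega
            rw [hI, Finset.sum_insert hpI, Nat.add_comm]
            exact Nat.add_le_add_left (Finset.sum_le_sum fun q _ => hle q) _
        omega
    -- Without a selected vertex no vertex has positive weight, by `Eliminable`, and optimality is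
    -- trivial.
    · have h₀ : ∀ p < m, w p = 0 := by
        intro p hp
        by_contra h
        exact hsel (hE.exists_selected hp (Nat.pos_of_ne_zero h))
      have hcard : ((Finset.range m).filter fun p => 0 < w' p).card ≤ k := by
        rw [Finset.filter_eq_empty_iff.2]
        · exact Nat.zero_le _
        · intro p hp
          have := h₀ p (Finset.mem_range.1 hp)
          have := hle p
          omega
      obtain ⟨ha, hb, hc⟩ := ih w' (hE.mono hle) hcard
      have hmem : ∀ q < m, (solution m H (k + 1) w q ↔ solution m H k w' q) := fun q hq =>
        or_iff_left fun h => hsel ⟨q, hq, h.1⟩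
      refine ⟨fun q hq h => (ha q hq ((hmem q hq).1 h)).trans_le (hle q),
        fun q r hq hr h h' => hb q r hq hr ((hmem q hq).1 h) ((hmem r hr).1 h'),
        fun J hJ _ => ?_⟩
      rw [Finset.sum_eq_zero fun p hp => h₀ p (Finset.mem_range.1 (hJ hp))]
      exact Nat.zero_le _

end LocalRatio

/-! ## Derived formulas and commands -/

namespace Fm

/-- The false formula. -/
def bot : Fm := eq 0 1

/-- Disjunction. -/
def or (φ ψ : Fm) : Fm := not (and (not φ) (not ψ))

/-- Implication. -/
def imp (φ ψ : Fm) : Fm := not (and φ (not ψ))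

/-- Bounded universal quantification. -/
def all (x : Fin 16) (e : Exp) (φ : Fm) : Fm := not (ex x e (not φ))

variable {μ : Fin 16 → ℕ → Prop} {ρ : Fin 16 → ℕ} {a x : Fin 16} {e f : Exp} {φ ψ : Fm}

@[simp] theorem holds_rd : (rd a e).Holds μ ρ ↔ μ a (e.eval ρ) := Iff.rfl
@[simp] theorem holds_eq : (eq e f).Holds μ ρ ↔ e.eval ρ = f.eval ρ := Iff.rfl
@[simp] theorem holds_not : (not φ).Holds μ ρ ↔ ¬ φ.Holds μ ρ := Iff.rfl
@[simp] theorem holds_and : (and φ ψ).Holds μ ρ ↔ φ.Holds μ ρ ∧ ψ.Holds μ ρ := Iff.rfl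
@[simp] theorem holds_ex : (ex x e φ).Holds μ ρ ↔
    ∃ i < e.eval ρ, φ.Holds μ (Function.update ρ x i) := Iff.rfl
@[simp] theorem holds_bot : bot.Holds μ ρ ↔ False := by simp [bot]
@[simp] theorem holds_or : (or φ ψ).Holds μ ρ ↔ φ.Holds μ ρ ∨ ψ.Holds μ ρ := by
  simp only [or, holds_not, holds_and]; tauto
@[simp] theorem holds_imp : (imp φ ψ).Holds μ ρ ↔ (φ.Holds μ ρ → ψ.Holds μ ρ) := by
  simp only [imp, holds_not, holds_and]; tauto
@[simp] theorem holds_all : (all x e φ).Holds μ ρ ↔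
    ∀ i < e.eval ρ, φ.Holds μ (Function.update ρ x i) := by
  simp [all]

/-- The formula does not read the array `a`. -/
def avoids (a : Fin 16) : Fm → Bool
  | rd b _ => decide (b ≠ a)
  | eq _ _ => true
  | not φ => avoids a φ
  | and φ ψ => avoids a φ && avoids a ψ
  | ex _ _ φ => avoids a φ

/-- This allows a formula to be evaluated while the array `a` is being overwritten: all rounds see
the values from before the loop. -/
theorem holds_congr {μ' : Fin 16 → ℕ → Prop} (h : ∀ b ≠ a, μ b = μ' b) (hφ : φ.avoids a = true) :
    φ.Holds μ ρ ↔ φ.Holds μ' ρ := by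
  induction φ generalizing ρ with
  | rd b e =>
    have : b ≠ a := by simpa [avoids] using hφ
    simp only [holds_rd, h b this]
  | eq e f => rfl
  | not φ ih => exact not_congr (ih hφ)
  | and φ ψ ih ih' =>
    simp only [avoids, Bool.and_eq_true] at hφ
    exact and_congr (ih hφ.1) (ih' hφ.2)
  | ex x e φ ih => exact exists_congr fun i => and_congr_right fun _ => ih hφ

end Fm

namespace Cmd

variable {μ : Fin 16 → ℕ → Prop} {ρ : Fin 16 → ℕ} {a x y : Fin 16} {e f : Exp} {φ : Fm}

@[simp] theorem run_seq {c d : Cmd} : (seq c d).run ρ μ = d.run ρ (c.run ρ μ) := rfl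

theorem run_loop {c : Cmd} (P : ℕ → (Fin 16 → ℕ → Prop) → Prop) {E : ℕ} (hE : e.eval ρ = E)
    (h₀ : P 0 μ) (h : ∀ i < E, ∀ μ, P i μ → P (i + 1) (c.run (Function.update ρ x i) μ)) :
    P E ((loop x e c).run ρ μ) := by
  subst hE
  have key : ∀ k ≤ e.eval ρ,
      P k (Nat.rec μ (fun i μ => run (Function.update ρ x i) c μ) k) := by
    intro k
    induction k with
    | zero => exact fun _ => h₀
    | succ k ih => exact fun hk => h k hk _ (ih (by omega))
  exact key _ le_rfl

/-- Fill the row `e` of the array `a` with the truth values of `φ` for the values of `y` below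
that of `f`. -/
def row (a : Fin 16) (e : Exp) (y : Fin 16) (f : Exp) (φ : Fm) : Cmd :=
  loop y f (wr a (Exp.pair e (.var y)) φ)

/-- The row index must not depend on the loop variable `y`, hence the hypothesis `hi` for all `j`.
Injectivity of `pair` protects the other rows and the entries already written. -/
theorem run_row {i F : ℕ} (hφ : φ.avoids a = true) (hi : ∀ j, e.eval (Function.update ρ y j) = i)
    (hF : f.eval ρ = F) :
    (∀ b ≠ a, (row a e y f φ).run ρ μ b = μ b) ∧
    (∀ j < F, (row a e y f φ).run ρ μ a (pair i j) ↔ φ.Holds μ (Function.update ρ y j)) ∧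
    ∀ i' j, i' ≠ i → ((row a e y f φ).run ρ μ a (pair i' j) ↔ μ a (pair i' j)) := by
  refine run_loop (fun k μ' => (∀ b ≠ a, μ' b = μ b) ∧
    (∀ j < k, μ' a (pair i j) ↔ φ.Holds μ (Function.update ρ y j)) ∧
    ∀ i' j, i' ≠ i → (μ' a (pair i' j) ↔ μ a (pair i' j))) hF ?_ ?_
  · exact ⟨fun _ _ => rfl, fun j hj => by omega, fun _ _ _ => Iff.rfl⟩
  · rintro k hk μ' ⟨h₁, h₂, h₃⟩
    refine ⟨fun b hb => ?_, fun j hj => ?_, fun i' j hi' => ?_⟩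
    · simp only [run, Function.update_of_ne hb, h₁ b hb]
    · simp only [run, Function.update_self, Exp.eval_pair, hi, Exp.eval_var]
      by_cases hjk : j = k
      · subst hjk
        rw [Function.update_self]
        exact Fm.holds_congr h₁ hφ
      · rw [Function.update_of_ne (by simpa using hjk)]
        exact h₂ j (by omega)
    · simp only [run, Function.update_self, Exp.eval_pair, hi, Exp.eval_var]
      rw [Function.update_of_ne (by simp [hi'])]
      exact h₃ i' j hi'

/-- Fill the array `a` with the truth values of `φ`. -/
def tab (a x : Fin 16) (e : Exp) (y : Fin 16) (f : Exp) (φ : Fm) : Cmd :=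
  loop x e (row a (.var x) y f φ)

theorem run_tab {E F : ℕ} (hxy : x ≠ y) (hφ : φ.avoids a = true) (hE : e.eval ρ = E)
    (hF : ∀ i, f.eval (Function.update ρ x i) = F) :
    (∀ b ≠ a, (tab a x e y f φ).run ρ μ b = μ b) ∧
    ∀ i < E, ∀ j < F, ((tab a x e y f φ).run ρ μ a (pair i j) ↔
      φ.Holds μ (Function.update (Function.update ρ x i) y j)) := by
  refine run_loop (fun k μ' => (∀ b ≠ a, μ' b = μ b) ∧ ∀ i < k, ∀ j < F, (μ' a (pair i j) ↔
      φ.Holds μ (Function.update (Function.update ρ x i) y j))) hE ?_ ?_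
  · exact ⟨fun _ _ => rfl, fun j hj => by omega⟩
  · rintro k hk μ' ⟨h₁, h₂⟩
    obtain ⟨r₁, r₂, r₃⟩ := run_row (μ := μ') (i := k) hφ
      (e := .var x) (y := y) (ρ := Function.update ρ x k)
      (fun j => by simp [Function.update_of_ne hxy]) (hF k)
    refine ⟨fun b hb => (r₁ b hb).trans (h₁ b hb), fun i hi j hj => ?_⟩
    by_cases hik : i = k
    · subst hik
      exact (r₂ j hj).trans (Fm.holds_congr h₁ hφ)
    · exact (r₃ i j hik).trans (h₂ i (by omega) j hj)

end Cmd

/-! ## The local ratio algorithm as a command -/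

/-- Reading the entry `(e, f)` of an array. -/
def Fm.rd₂ (a : Fin 16) (e f : Exp) : Fm := .rd a (Exp.pair e f)

@[simp] theorem Fm.holds_rd₂ {μ ρ a e f} :
    (Fm.rd₂ a e f).Holds μ ρ ↔ μ a (pair (e.eval ρ) (f.eval ρ)) := Iff.rfl

namespace LocalRatio

/-- Copy the array `5` to the array `4`. -/
def copyCmd (m : Exp) : Cmd := .tab 4 2 m 5 (.var 0 + 1) (.rd₂ 5 (.var 2) (.var 5))

/-- The number of elements of the row `2` up to `8` exceeds the value of the variable `5`. -/
def countFm : Fm :=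
  .or (.rd₂ 4 (.var 2) (.var 5)) (.and (.rd₂ 2 (.var 2) (.var 8)) (.or (.eq (.var 5) 0)
    (.ex 6 (.var 5) (.and (.eq (.var 6 + 1) (.var 5)) (.rd₂ 4 (.var 2) (.var 6))))))

/-- Compute in the array `4` the numbers, in unary, of the elements of the sets which are the rows
of the array `2`. -/
def countCmd (m : Exp) : Cmd :=
  .seq (.tab 4 2 m 5 (.var 0 + 1) .bot) (.loop 8 (.var 0) (.seq
    (.tab 5 2 m 5 (.var 0 + 1) countFm) (copyCmd m)))

/-- The vertex `x` is simplicial in the graph of the array `3` with the weights of the array `4`. -/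
def simplicialFm (m : Exp) (x : Fin 16) : Fm :=
  .and (.rd₂ 4 (.var x) 0) (.all 3 m (.all 4 m (.imp (.rd₂ 3 (.var x) (.var 3))
    (.imp (.rd₂ 4 (.var 3) 0) (.imp (.rd₂ 3 (.var x) (.var 4)) (.imp (.rd₂ 4 (.var 4) 0)
      (.or (.eq (.var 3) (.var 4)) (.rd₂ 3 (.var 3) (.var 4)))))))))

/-- The vertex `2` is the first simplicial vertex. -/
def selectedFm (m : Exp) : Fm :=
  .and (simplicialFm m 2) (.all 6 (.var 2) (.not (simplicialFm m 6)))

/-- The weight of the vertex `2` after the reduction at the selected vertex exceeds the value of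
the variable `5`. -/
def reduceFm (m : Exp) : Fm :=
  .and (.rd₂ 4 (.var 2) (.var 5)) (.all 3 m (.imp (.and (.rd₂ 6 (.var 1) (.var 3))
    (.or (.eq (.var 3) (.var 2)) (.rd₂ 3 (.var 3) (.var 2))))
    (.ex 7 (.var 0 + 1) (.and (.not (.rd₂ 4 (.var 3) (.var 7)))
      (.ex 6 (.var 0 + 1) (.and (.eq (.var 6) (.var 5 + .var 7)) (.rd₂ 4 (.var 2) (.var 6))))))))

/-- The rounds of the local ratio algorithm; the selected vertices are stored in the array `6`. -/
def reduceCmd (m : Exp) : Cmd :=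
  .loop 1 m (.seq (.row 6 (.var 1) 2 m (selectedFm m))
    (.seq (.tab 5 2 m 5 (.var 0 + 1) (reduceFm m)) (copyCmd m)))

/-- The vertex `2` belongs to the independent set after one more round. -/
def solutionFm (m : Exp) : Fm :=
  .or (.rd₂ 7 0 (.var 2)) (.ex 4 m (.and (.eq (.var 4 + .var 1 + 1) m)
    (.and (.rd₂ 6 (.var 4) (.var 2))
      (.not (.ex 3 m (.and (.rd₂ 7 0 (.var 3)) (.rd₂ 3 (.var 2) (.var 3))))))))

/-- The construction of the independent set in the array `7` from the selected vertices. -/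
def solutionCmd (m : Exp) : Cmd :=
  .seq (.row 7 0 2 m .bot) (.loop 1 m (.seq
    (.row 8 0 2 m (solutionFm m))
    (.row 7 0 2 m (.rd₂ 8 0 (.var 2)))))

/-- Compute in the array `7` an independent set of maximum weight of the graph in the array `3`,
where the weights are the cardinalities of the rows of the array `2`. -/
def independentCmd (m : Exp) : Cmd := .seq (countCmd m) (.seq (reduceCmd m) (solutionCmd m))

/-! ### Correctness of the local ratio commands. -/

variable {n M : ℕ} {m : Exp} {ρ : Fin 16 → ℕ} {μ : Fin 16 → ℕ → Prop}

theorem ne_of_val_lt {a b : Fin 16} (h : b.val < 4) (ha : 4 ≤ a.val) : b ≠ a := by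
  rintro rfl
  omega

/-- The array `4` holds the weights `w` in unary. -/
def HoldsWeights (n M : ℕ) (μ : Fin 16 → ℕ → Prop) (w : ℕ → ℕ) : Prop :=
  ∀ p < M, ∀ s < n + 1, (μ 4 (pair p s) ↔ s < w p)

/-- New weights depend on old ones, and `run_tab` forbids reading the array being filled. They are
therefore computed in the array `5` and copied back. -/
theorem run_copyCmd (hρ : ρ 0 = n) (hm : ∀ ρ : Fin 16 → ℕ, ρ 0 = n → m.eval ρ = M) :
    (∀ b ≠ 4, (copyCmd m).run ρ μ b = μ b) ∧
    ∀ p < M, ∀ s < n + 1, ((copyCmd m).run ρ μ 4 (pair p s) ↔ μ 5 (pair p s)) := by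
  obtain ⟨h₁, h₂⟩ := Cmd.run_tab (μ := μ) (ρ := ρ) (a := 4) (x := 2) (y := 5) (e := m)
    (f := .var 0 + 1) (φ := .rd₂ 5 (.var 2) (.var 5)) (E := M) (F := n + 1) (by decide) rfl
    (hm ρ hρ) (by simp [hρ])
  refine ⟨h₁, fun p hp s hs => (h₂ p hp s hs).trans ?_⟩
  simp

open Classical in
-- Unary counting, one potential element per round: if element `k` is present, then `s < c + 1`
-- holds iff `s = 0` or `s - 1 < c`; otherwise the row is unchanged.
theorem run_countCmd (hρ : ρ 0 = n) (hm : ∀ ρ : Fin 16 → ℕ, ρ 0 = n → m.eval ρ = M) :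
    (∀ b : Fin 16, b.val < 4 → (countCmd m).run ρ μ b = μ b) ∧
    HoldsWeights n M ((countCmd m).run ρ μ)
      fun p => ((Finset.range n).filter fun v => μ 2 (pair p v)).card := by
  rw [countCmd, Cmd.run_seq]
  refine Cmd.run_loop (fun k μ' => (∀ b : Fin 16, b.val < 4 → μ' b = μ b) ∧
    HoldsWeights n M μ' fun p => ((Finset.range k).filter fun v => μ 2 (pair p v)).card)
    (by simpa using hρ) ?_ ?_
  · obtain ⟨h₁, h₂⟩ := Cmd.run_tab (μ := μ) (ρ := ρ) (a := 4) (x := 2) (y := 5) (e := m)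
      (f := .var 0 + 1) (φ := .bot) (E := M) (F := n + 1) (by decide) rfl
      (hm ρ hρ) (by simp [hρ])
    refine ⟨fun b hb => h₁ b (ne_of_val_lt hb (by decide)), fun p hp s hs => ?_⟩
    simpa using h₂ p hp s hs
  · rintro k hk μ' ⟨h₁, h₂⟩
    have hρ' : Function.update ρ 8 k 0 = n := by simpa [Function.update_apply] using hρ
    rw [Cmd.run_seq]
    obtain ⟨h₃, h₄⟩ := Cmd.run_tab (μ := μ') (ρ := Function.update ρ 8 k) (a := 5) (x := 2) (y := 5)
      (e := m) (f := .var 0 + 1) (φ := countFm) (E := M) (F := n + 1)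
      (by decide) rfl (hm _ hρ') (by simp [hρ])
    obtain ⟨h₅, h₆⟩ := run_copyCmd
      (μ := (Cmd.tab 5 2 m 5 (.var 0 + 1) countFm).run (Function.update ρ 8 k) μ')
      hρ' hm
    refine ⟨fun b hb => (h₅ b (ne_of_val_lt hb (by decide))).trans
      ((h₃ b (ne_of_val_lt hb (by decide))).trans (h₁ b hb)), fun p hp s hs => ?_⟩
    rw [h₆ p hp s hs, h₄ p hp s hs]
    simp only [countFm, Fm.holds_or, Fm.holds_and, Fm.holds_rd₂, Fm.holds_eq, Fm.holds_ex,
      Exp.eval_var,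
      Exp.eval_add, Exp.eval_one, Exp.eval_zero, Function.update_apply]
    simp only [Fin.reduceEq, if_true, if_false]
    rw [h₂ p hp s hs, h₁ 2 (by decide), Finset.range_add_one, Finset.filter_insert]
    by_cases hC : μ 2 (pair p k)
    · rw [if_pos hC, Finset.card_insert_of_notMem (by simp)]
      simp only [hC, true_and]
      constructor
      · rintro (h | rfl | ⟨i, hi, rfl, h⟩)
        · omega
        · omega
        · have h := (h₂ p hp i (by omega)).1 h
          dsimp only at h
          omega
      · intro h
        rcases s with _ | s
        · exact Or.inr (Or.inl rfl)
        · exact Or.inr (Or.inr ⟨s, by omega, rfl,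
            (h₂ p hp s (by omega)).2 (Nat.lt_of_succ_lt_succ h)⟩)
    · rw [if_neg hC]
      simp [hC]

theorem holds_simplicialFm {w : ℕ → ℕ} {H : ℕ → ℕ → Prop} {x : Fin 16} (hx₃ : x ≠ 3)
    (hx₄ : x ≠ 4) (hρ : ρ 0 = n)
    (hm : ∀ ρ : Fin 16 → ℕ, ρ 0 = n → m.eval ρ = M) (hw : HoldsWeights n M μ w)
    (hH : ∀ p < M, ∀ q < M, (μ 3 (pair p q) ↔ H p q)) (hx : ρ x < M) :
    (simplicialFm m x).Holds μ ρ ↔ Simplicial M H w (ρ x) := by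
  have h₀ : ∀ p < M, (μ 4 (pair p 0) ↔ 0 < w p) := fun p hp => hw p hp 0 (by omega)
  have hm₁ : ∀ i, m.eval (Function.update ρ 3 i) = M := fun i =>
    hm _ (by simpa [Function.update_apply] using hρ)
  simp only [simplicialFm, Fm.holds_and, Fm.holds_rd₂, Fm.holds_all, Fm.holds_imp, Fm.holds_or,
    Fm.holds_eq, Exp.eval_var, Exp.eval_zero, Function.update_apply, hx₃, hx₄, if_false,
    Fin.reduceEq, if_true, h₀ _ hx, hm ρ hρ, hm₁]
  refine and_congr_right fun _ => forall₂_congr fun q hq => forall₂_congr fun r hr => ?_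
  rw [h₀ q hq, h₀ r hr, hH _ hx q hq, hH _ hx r hr, hH q hq r hr]

theorem holds_selectedFm {w : ℕ → ℕ} {H : ℕ → ℕ → Prop} (hρ : ρ 0 = n)
    (hm : ∀ ρ : Fin 16 → ℕ, ρ 0 = n → m.eval ρ = M) (hw : HoldsWeights n M μ w)
    (hH : ∀ p < M, ∀ q < M, (μ 3 (pair p q) ↔ H p q)) (hx : ρ 2 < M) :
    (selectedFm m).Holds μ ρ ↔ Selected M H w (ρ 2) := by
  simp only [selectedFm, Fm.holds_and, Fm.holds_all, Fm.holds_not, Exp.eval_var]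
  rw [holds_simplicialFm (by decide) (by decide) hρ hm hw hH hx]
  refine and_congr_right fun _ => forall₂_congr fun q hq => not_congr ?_
  rw [holds_simplicialFm (n := n) (by decide) (by decide)
    (by simpa [Function.update_apply] using hρ) hm hw hH (by simpa using hq.trans hx)]
  simp

/-- The condition `s + w q < w p` of `lt_reduce_iff` is rephrased as the existence of `d ≥ w q` with
`s + d < w p`, where `d ≥ w q` says that bit `d` of the row of `q` is unset. The witness is `d = w
q`; quantifiers up to `n` suffice because all weights are at most `n`. -/
theorem holds_reduceFm {w : ℕ → ℕ} {H : ℕ → ℕ → Prop} (hρ : ρ 0 = n)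
    (hm : ∀ ρ : Fin 16 → ℕ, ρ 0 = n → m.eval ρ = M) (hw : HoldsWeights n M μ w)
    (hH : ∀ p < M, ∀ q < M, (μ 3 (pair p q) ↔ H p q))
    (hwn : ∀ p, w p ≤ n)
    (hsel : ∀ q < M, (μ 6 (pair (ρ 1) q) ↔ Selected M H w q))
    (hp : ρ 2 < M) (hs : ρ 5 < n + 1) :
    (reduceFm m).Holds μ ρ ↔ ρ 5 < reduce M H w (ρ 2) := by
  rw [lt_reduce_iff]
  simp only [reduceFm, Fm.holds_and, Fm.holds_rd₂, Fm.holds_all, Fm.holds_imp, Fm.holds_or,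
    Fm.holds_eq, Fm.holds_ex, Fm.holds_not, Exp.eval_var, Exp.eval_add, Exp.eval_one,
    Function.update_apply]
  simp only [Fin.reduceEq, if_true, if_false, hm ρ hρ, hρ]
  rw [hw _ hp _ hs]
  refine and_congr_right fun _ => forall₂_congr fun q hq => ?_
  rw [hsel q hq, hH q hq _ hp]
  refine imp_congr_right fun _ => ?_
  constructor
  · rintro ⟨d, hd, hqd, s, hs', rfl, h⟩
    rw [hw q hq d hd] at hqd
    rw [hw _ hp _ hs'] at h
    omega
  · intro h
    have := hwn q
    have := hwn (ρ 2)
    refine ⟨w q, by omega, ?_, ρ 5 + w q, by omega, rfl, ?_⟩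
    · rw [hw q hq _ (by omega)]
      omega
    · rwa [hw _ hp _ (by omega)]

theorem iterate_reduce_le {H : ℕ → ℕ → Prop} (w : ℕ → ℕ) (t p : ℕ) :
    ((reduce M H)^[t] w) p ≤ w p := by
  induction t with
  | zero => exact le_rfl
  | succ t ih =>
    rw [Function.iterate_succ_apply']
    exact (reduce_le _ p).trans ih

/-- The recursion of `solution` is unrolled: this forward pass records the selection of every stage,
because the backward pass needs them in reverse order. -/
theorem run_reduceCmd {w : ℕ → ℕ} {H : ℕ → ℕ → Prop} (hρ : ρ 0 = n)
    (hm : ∀ ρ : Fin 16 → ℕ, ρ 0 = n → m.eval ρ = M) (hw : HoldsWeights n M μ w)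
    (hH : ∀ p < M, ∀ q < M, (μ 3 (pair p q) ↔ H p q))
    (hwn : ∀ p, w p ≤ n) :
    (∀ b : Fin 16, b.val < 4 → (reduceCmd m).run ρ μ b = μ b) ∧
    ∀ t < M, ∀ p < M, ((reduceCmd m).run ρ μ 6 (pair t p) ↔
      Selected M H ((reduce M H)^[t] w) p) := by
  have := Cmd.run_loop (μ := μ) (ρ := ρ) (x := 1) (e := m) (c := .seq
    (.row 6 (.var 1) 2 m (selectedFm m))
    (.seq (.tab 5 2 m 5 (.var 0 + 1) (reduceFm m)) (copyCmd m)))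
    (fun k μ' => (∀ b : Fin 16, b.val < 4 → μ' b = μ b) ∧
      HoldsWeights n M μ' ((reduce M H)^[k] w) ∧
      ∀ t < k, ∀ p < M, (μ' 6 (pair t p) ↔ Selected M H ((reduce M H)^[t] w) p)) (hm ρ hρ)
    ⟨fun _ _ => rfl, hw, fun t ht => by omega⟩ (by
    rintro k hk μ' ⟨h₁, h₂, h₃⟩
    have hρ' : ∀ i, Function.update (Function.update ρ 1 k) 2 i 0 = n := by
      simpa [Function.update_apply] using hρ
    have hρ'' : Function.update ρ 1 k 0 = n := by simpa [Function.update_apply] using hρ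
    obtain ⟨r₁, r₂, r₃⟩ := Cmd.run_row (μ := μ') (ρ := Function.update ρ 1 k) (a := 6)
      (e := .var 1) (y := 2) (f := m) (φ := selectedFm m) (i := k) (F := M) rfl
      (by simp) (hm _ hρ'')
    set μ₁ := (Cmd.row 6 (.var 1) 2 m (selectedFm m)).run (Function.update ρ 1 k) μ'
    have hμ₁ : ∀ b : Fin 16, b.val < 4 → μ₁ b = μ b := fun b hb =>
      (r₁ b (ne_of_val_lt hb (by decide))).trans (h₁ b hb)
    have hH' : ∀ p < M, ∀ q < M, (μ' 3 (pair p q) ↔ H p q) := by rwa [h₁ 3 (by decide)]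
    have hH₁ : ∀ p < M, ∀ q < M, (μ₁ 3 (pair p q) ↔ H p q) := by rwa [hμ₁ 3 (by decide)]
    have hsel : ∀ p < M, (μ₁ 6 (pair k p) ↔ Selected M H ((reduce M H)^[k] w) p) := by
      intro p hp
      rw [r₂ p hp, holds_selectedFm (hρ' p) hm h₂ hH' (by simpa using hp)]
      simp
    have hw₁ : HoldsWeights n M μ₁ ((reduce M H)^[k] w) := by
      unfold HoldsWeights
      rwa [r₁ 4 (by decide)]
    obtain ⟨t₁, t₂⟩ := Cmd.run_tab (μ := μ₁) (ρ := Function.update ρ 1 k) (a := 5) (x := 2)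
      (y := 5) (e := m) (f := .var 0 + 1) (φ := reduceFm m) (E := M) (F := n + 1) (by decide) rfl
      (hm _ hρ'') (by simp [hρ])
    set μ₂ := (Cmd.tab 5 2 m 5 (.var 0 + 1) (reduceFm m)).run (Function.update ρ 1 k) μ₁
    obtain ⟨c₁, c₂⟩ := run_copyCmd (μ := μ₂) hρ'' hm
    refine ⟨fun b hb => (c₁ b (ne_of_val_lt hb (by decide))).trans
      ((t₁ b (ne_of_val_lt hb (by decide))).trans (hμ₁ b hb)), fun p hp s hs => ?_,
      fun t ht p hp => ?_⟩
    · refine (c₂ p hp s hs).trans ?_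
      rw [t₂ p hp s hs, Function.iterate_succ_apply', holds_reduceFm (n := n) (M := M)
        (w := (reduce M H)^[k] w) (by simpa [Function.update_apply] using hρ) hm hw₁ hH₁
        (fun p => (iterate_reduce_le w k p).trans (hwn p)) ?_ ?_ ?_]
      · simp
      · simpa [Function.update_apply] using hsel
      · simpa [Function.update_apply] using hp
      · simpa [Function.update_apply] using hs
    · have : (copyCmd m).run (Function.update ρ 1 k) μ₂ 6 = μ₁ 6 :=
        (c₁ 6 (by decide)).trans (t₁ 6 (by decide))
      refine (iff_of_eq (congrFun this _)).trans ?_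
      by_cases htk : t = k
      · subst htk
        exact hsel p hp
      · exact (r₃ t p htk).trans (h₃ t (by omega) p hp))
  exact ⟨this.1, this.2.2⟩

/-- The backward pass. After `k` rounds the array `7` holds the solution for the weights of stage `M
- k`, so round `k` consults row `M - (k + 1)` of the array `6`; that row is located by an equation
since expressions lack subtraction. The array `8` is a buffer. -/
theorem run_solutionCmd {w : ℕ → ℕ} {H : ℕ → ℕ → Prop} (hρ : ρ 0 = n)
    (hm : ∀ ρ : Fin 16 → ℕ, ρ 0 = n → m.eval ρ = M)
    (hH : ∀ p < M, ∀ q < M, (μ 3 (pair p q) ↔ H p q))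
    (hsel : ∀ t < M, ∀ p < M, (μ 6 (pair t p) ↔ Selected M H ((reduce M H)^[t] w) p)) :
    (∀ b : Fin 16, b.val < 4 → (solutionCmd m).run ρ μ b = μ b) ∧
    ∀ p < M, ((solutionCmd m).run ρ μ 7 (pair 0 p) ↔ solution M H M w p) := by
  rw [solutionCmd, Cmd.run_seq]
  have := Cmd.run_loop (μ := (Cmd.row 7 0 2 m .bot).run ρ μ) (ρ := ρ) (x := 1) (e := m) (c := .seq
    (.row 8 0 2 m (solutionFm m))
    (.row 7 0 2 m (.rd₂ 8 0 (.var 2))))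
    (fun k μ' => (∀ b : Fin 16, b.val < 4 → μ' b = μ b) ∧ μ' 6 = μ 6 ∧
      ∀ p < M, (μ' 7 (pair 0 p) ↔ solution M H k ((reduce M H)^[M - k] w) p)) (hm ρ hρ)
    (by
      obtain ⟨r₁, r₂, -⟩ := Cmd.run_row (μ := μ) (ρ := ρ) (a := 7)
        (e := 0) (y := 2) (f := m) (φ := .bot) (i := 0) (F := M) rfl (by simp) (hm _ hρ)
      exact ⟨fun b hb => r₁ b (ne_of_val_lt hb (by decide)), r₁ 6 (by decide), fun p hp =>
        (r₂ p hp).trans (by simp [solution])⟩)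
    (by
      rintro k hk μ' ⟨h₁, h₂, h₃⟩
      have hρ' : Function.update ρ 1 k 0 = n := by simpa [Function.update_apply] using hρ
      obtain ⟨r₁, r₂, -⟩ := Cmd.run_row (μ := μ') (ρ := Function.update ρ 1 k) (a := 8)
        (e := 0) (y := 2) (f := m) (φ := solutionFm m)
        (i := 0) (F := M) rfl (by simp) (hm _ hρ')
      rw [Cmd.run_seq]
      set μ₁ := (Cmd.row 8 0 2 m (solutionFm m)).run (Function.update ρ 1 k) μ'
      obtain ⟨s₁, s₂, -⟩ := Cmd.run_row (μ := μ₁) (ρ := Function.update ρ 1 k) (a := 7)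
        (e := 0) (y := 2) (f := m) (φ := .rd₂ 8 0 (.var 2)) (i := 0) (F := M) rfl (by simp)
        (hm _ hρ')
      refine ⟨fun b hb => (s₁ b (ne_of_val_lt hb (by decide))).trans
        ((r₁ b (ne_of_val_lt hb (by decide))).trans (h₁ b hb)),
        (s₁ 6 (by decide)).trans ((r₁ 6 (by decide)).trans h₂), fun p hp => ?_⟩
      rw [s₂ p hp]
      simp only [Fm.holds_rd₂, Exp.eval_zero, Exp.eval_var, Function.update_self]
      rw [r₂ p hp]
      have hm' : ∀ i,
          m.eval (Function.update (Function.update (Function.update ρ 1 k) 2 p) 4 i) = M :=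
        fun i => hm _ (by simpa [Function.update_apply] using hρ)
      have hm'' : m.eval (Function.update (Function.update ρ 1 k) 2 p) = M :=
        hm _ (by simpa [Function.update_apply] using hρ)
      simp only [solutionFm, Fm.holds_or, Fm.holds_rd₂, Fm.holds_ex, Fm.holds_and, Fm.holds_eq,
        Fm.holds_not, hm', hm'']
      simp only [Exp.eval_var, Exp.eval_add, Exp.eval_one, Exp.eval_zero, Function.update_apply,
        Fin.reduceEq, if_true, if_false]
      -- Stage `M - k` is one reduction after stage `M - (k + 1)`, as the recursive clause of
      -- `solution` requires.
      have hsucc : (reduce M H)^[M - k] w = reduce M H ((reduce M H)^[M - (k + 1)] w) := by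
        rw [← Function.iterate_succ_apply' (reduce M H), show (M - (k + 1)).succ = M - k by omega]
      rw [h₃ p hp, solution, ← hsucc]
      refine or_congr Iff.rfl ?_
      have hno : (∃ q < M, μ' 7 (pair 0 q) ∧ μ' 3 (pair p q)) ↔
          ∃ q < M, solution M H k ((reduce M H)^[M - k] w) q ∧ H p q :=
        exists_congr fun q => and_congr_right fun hq => and_congr (h₃ q hq)
          (by rw [h₁ 3 (by decide)]; exact hH p hp q hq)
      rw [hno, h₂]
      constructor
      · rintro ⟨r, hr, hrk, hs, h⟩
        obtain rfl : r = M - (k + 1) := by omega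
        exact ⟨(hsel _ hr p hp).1 hs, h⟩
      · rintro ⟨hs, h⟩
        exact ⟨M - (k + 1), by omega, by omega, (hsel _ (by omega) p hp).2 hs, h⟩)
  refine ⟨this.1, fun p hp => ?_⟩
  simpa using this.2.2 p hp

open Classical in
/-- The command computes an independent set of maximum weight. -/
theorem run_independentCmd (hρ : ρ 0 = n) (hm : ∀ ρ : Fin 16 → ℕ, ρ 0 = n → m.eval ρ = M)
    (C : ℕ → Finset ℕ) (H : ℕ → ℕ → Prop)
    (hC : ∀ p < M, ∀ v, v ∈ C p ↔ v < n ∧ μ 2 (pair p v))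
    (hH : ∀ p < M, ∀ q < M, (μ 3 (pair p q) ↔ H p q)) (hsymm : ∀ p q, H p q → H q p)
    (hE : ∀ S : ℕ → Prop, (∀ p, S p → p < M ∧ (C p).Nonempty) → (∃ p, S p) →
      ∃ p, S p ∧ ∀ q r, S q → S r → H p q → H p r → q = r ∨ H q r) :
    ∃ I ⊆ Finset.range M,
      (∀ b : Fin 16, b.val < 4 → (independentCmd m).run ρ μ b = μ b) ∧
      (∀ p < M, ((independentCmd m).run ρ μ 7 (pair 0 p) ↔ p ∈ I)) ∧
      (∀ p ∈ I, (C p).Nonempty) ∧ (∀ p ∈ I, ∀ q ∈ I, p ≠ q → ¬ H p q) ∧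
      ∀ J ⊆ Finset.range M, (∀ p ∈ J, ∀ q ∈ J, p ≠ q → ¬ H p q) →
        ∑ p ∈ J, (C p).card ≤ ∑ p ∈ I, (C p).card := by
  set w : ℕ → ℕ := fun p => ((Finset.range n).filter fun v => μ 2 (pair p v)).card with hw
  have hCw : ∀ p < M, w p = (C p).card := by
    intro p hp
    refine congrArg Finset.card (Finset.ext fun v => ?_)
    simp [hC p hp]
  have hwn : ∀ p, w p ≤ n := fun p => (Finset.card_filter_le _ _).trans (by simp)
  have hpos : ∀ p < M, 0 < w p → (C p).Nonempty := fun p hp h =>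
    Finset.card_pos.1 (by rwa [← hCw p hp])
  obtain ⟨h₁, h₂⟩ := run_countCmd (μ := μ) hρ hm
  rw [← hw] at h₂
  set μ₁ := (countCmd m).run ρ μ
  obtain ⟨h₃, h₄⟩ := run_reduceCmd (H := H) hρ hm h₂ (by rwa [h₁ 3 (by decide)]) hwn
  set μ₂ := (reduceCmd m).run ρ μ₁
  obtain ⟨h₅, h₆⟩ := run_solutionCmd (μ := μ₂) hρ hm
    (by rwa [h₃ 3 (by decide), h₁ 3 (by decide)]) h₄
  -- At most `M` vertices have positive weight, so `M` rounds are enough.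
  obtain ⟨ha, hb, hc⟩ := solution_spec (m := M) (H := H) hsymm M w
    (fun S hS => hE S fun p hp => ⟨(hS p hp).1, hpos p (hS p hp).1 (hS p hp).2⟩)
    ((Finset.card_filter_le _ _).trans (by simp))
  refine ⟨(Finset.range M).filter (solution M H M w), Finset.filter_subset _ _,
    fun b hb => (h₅ b hb).trans ((h₃ b hb).trans (h₁ b hb)), fun p hp => ?_, fun p hp => ?_,
    fun p hp q hq hpq => ?_, fun J hJ hJ' => ?_⟩
  · rw [Finset.mem_filter, Finset.mem_range, and_iff_right hp]
    exact h₆ p hp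
  · obtain ⟨hp, hp'⟩ := Finset.mem_filter.1 hp
    exact hpos p (Finset.mem_range.1 hp) (ha p (Finset.mem_range.1 hp) hp')
  · obtain ⟨hp, hp'⟩ := Finset.mem_filter.1 hp
    obtain ⟨hq, hq'⟩ := Finset.mem_filter.1 hq
    exact (hb p q (Finset.mem_range.1 hp) (Finset.mem_range.1 hq) hp' hq').resolve_right hpq
  · have h := hc J hJ hJ'
    rw [Finset.sum_congr rfl fun p hp => hCw p (Finset.mem_range.1 (hJ hp)),
      Finset.sum_congr rfl fun p hp => hCw p (Finset.mem_range.1 (Finset.mem_filter.1 hp).1)] at h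
    exact h

end LocalRatio

/-! ## Families of intervals -/

/-- A family of closed intervals. -/
structure Intervals where
  l : ℕ → ℝ
  r : ℕ → ℝ
  l_le_r : ∀ i, l i ≤ r i

namespace Intervals

variable (F : Intervals) {n : ℕ}

/-- The intervals with the indices `i` and `j` intersect. -/
def Near (i j : ℕ) : Prop := F.l i ≤ F.r j ∧ F.l j ≤ F.r i

/-- The common closed neighbourhood of `u` and `v` is a clique. -/
def CommonClique (n u v : ℕ) : Prop :=
  ∀ w < n, ∀ w' < n, F.Near w u → F.Near w v → F.Near w' u → F.Near w' v → F.Near w w'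

/-- `w` belongs to the common closed neighbourhood of `u` and `v`, which is a clique, and all its
neighbours are neighbours of `x` or of `y`. -/
def InBlock (n u v x y w : ℕ) : Prop :=
  F.CommonClique n u v ∧ F.Near w u ∧ F.Near w v ∧ ∀ z < n, F.Near z w → F.Near z x ∨ F.Near z y

/-- `w` belongs to the common closed neighbourhood of `u` and `v`, which is a clique. -/
def InCore (n u v w : ℕ) : Prop := F.CommonClique n u v ∧ F.Near w u ∧ F.Near w v

/-- `x` lies outside the common neighbourhood of `a` and `b`, but is adjacent to all of it. -/
def InRest (n a b x : ℕ) : Prop :=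
  ¬ F.InCore n a b x ∧ ∀ s < n, F.InCore n a b s → F.Near s x

/-! ### Cliques and complete split subgraphs in families of intervals. -/

variable {F}

theorem Near.symm {i j : ℕ} (h : F.Near i j) : F.Near j i := ⟨h.2, h.1⟩

theorem near_self (i : ℕ) : F.Near i i := ⟨F.l_le_r i, F.l_le_r i⟩

/-- Enlarge `c` to a maximal clique `K`, and let `u` have the smallest right end and `v` the largest
left end in `K`. An interval meeting both `u` and `v` meets every member of `K`, so it belongs to
`K` by maximality; thus `N[u] ∩ N[v] = K`. -/
theorem exists_commonClique {c : Finset ℕ} (hc : c ⊆ Finset.range n) (hne : c.Nonempty)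
    (h : ∀ a ∈ c, ∀ b ∈ c, F.Near a b) :
    ∃ u < n, ∃ v < n, F.CommonClique n u v ∧ ∀ w ∈ c, F.Near w u ∧ F.Near w v := by
  have hfin : {K : Finset ℕ | K ⊆ Finset.range n ∧ ∀ a ∈ K, ∀ b ∈ K, F.Near a b}.Finite :=
    ((Finset.range n).powerset.finite_toSet).subset fun K hK => Finset.mem_powerset.2 hK.1
  obtain ⟨K, hcK, hK⟩ := hfin.exists_le_maximal ⟨hc, h⟩
  obtain ⟨hKn, hK'⟩ := hK.prop
  have hKne : K.Nonempty := hne.mono hcK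
  obtain ⟨u, hu, hu'⟩ := K.exists_min_image F.r hKne
  obtain ⟨v, hv, hv'⟩ := K.exists_max_image F.l hKne
  have hmem : ∀ w < n, F.Near w u → F.Near w v → w ∈ K := by
    intro w hw hwu hwv
    have hw' : ∀ k ∈ K, F.Near w k := fun k hk =>
      ⟨hwu.1.trans (hu' k hk), (hv' k hk).trans hwv.2⟩
    refine hK.le_of_ge (y := insert w K) ⟨?_, ?_⟩ (Finset.subset_insert _ _)
      (Finset.mem_insert_self _ _)
    · exact Finset.insert_subset (Finset.mem_range.2 hw) hKn
    · intro a ha b hb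
      rcases Finset.mem_insert.1 ha with h₁ | h₁ <;> rcases Finset.mem_insert.1 hb with h₂ | h₂
      · rw [h₁, h₂]
        exact near_self _
      · exact h₁ ▸ hw' b h₂
      · exact h₂ ▸ (hw' a h₁).symm
      · exact hK' a h₁ b h₂
  refine ⟨u, Finset.mem_range.1 (hKn hu), v, Finset.mem_range.1 (hKn hv), ?_, ?_⟩
  · intro w hw w' hw' h₁ h₂ h₃ h₄
    exact hK' w (hmem w hw h₁ h₂) w' (hmem w' hw' h₃ h₄)
  · intro w hw
    exact ⟨hK' w (hcK hw) u hu, hK' w (hcK hw) v hv⟩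

/-- Take `x` with the leftmost left end and `y` with the rightmost right end in `c`. An interval
meeting some member of `c` and missing `x` must start to the right of `x`, and then it meets `y`,
because `x` and `y` intersect. -/
theorem exists_inBlock {c : Finset ℕ} (hc : c ⊆ Finset.range n) (hne : c.Nonempty)
    (h : ∀ a ∈ c, ∀ b ∈ c, F.Near a b) :
    ∃ u < n, ∃ v < n, ∃ x ∈ c, ∃ y ∈ c, ∀ w ∈ c, F.InBlock n u v x y w := by
  obtain ⟨u, hu, v, hv, huv, hc'⟩ := exists_commonClique hc hne h
  obtain ⟨x, hx, hx'⟩ := c.exists_min_image F.l hne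
  obtain ⟨y, hy, hy'⟩ := c.exists_max_image F.r hne
  refine ⟨u, hu, v, hv, x, hx, y, hy, fun w hw => ⟨huv, (hc' w hw).1, (hc' w hw).2, ?_⟩⟩
  intro z _ hz
  by_cases hzx : F.l z ≤ F.r x
  · exact Or.inl ⟨hzx, (hx' w hw).trans hz.2⟩
  · refine Or.inr ⟨hz.1.trans (hy' w hw), ?_⟩
    exact ((h x hx y hy).2.trans (not_le.1 hzx).le).trans (F.l_le_r z)

theorem inCore_near {a b s s' : ℕ} (hs : s < n) (hs' : s' < n) (h : F.InCore n a b s)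
    (h' : F.InCore n a b s') : F.Near s s' :=
  h.1 s hs s' hs' h.2.1 h.2.2 h'.2.1 h'.2.2

/-- In `I` let `a` have the smallest right end and `b` the largest left end. The other members of
`I` lie in the gap between `a` and `b`, and every interval meeting both `a` and `b` covers this gap.
-/
theorem exists_inCore_inRest {C I : Finset ℕ} (hI : I ⊆ Finset.range n)
    (hI' : ∀ a ∈ I, ∀ b ∈ I, a ≠ b → ¬ F.Near a b) (hCI : ∀ a ∈ C, ∀ b ∈ I, F.Near a b)
    (hne : 1 < I.card) :
    ∃ a < n, ∃ b < n, (∀ s ∈ C, F.InCore n a b s) ∧ ∀ x ∈ I, F.InRest n a b x := by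
  have hI₀ : I.Nonempty := Finset.card_pos.1 (by omega)
  obtain ⟨a, ha, ha'⟩ := I.exists_min_image F.r hI₀
  obtain ⟨b, hb, hb'⟩ := I.exists_max_image F.l hI₀
  have hleft : ∀ x ∈ I, x ≠ a → F.r a < F.l x := by
    intro x hx hxa
    by_contra hlt
    exact hI' x hx a ha hxa ⟨not_lt.1 hlt, (F.l_le_r a).trans (ha' x hx)⟩
  have hright : ∀ x ∈ I, x ≠ b → F.r x < F.l b := by
    intro x hx hxb
    by_contra hlt
    exact hI' x hx b hb hxb ⟨(hb' x hx).trans (F.l_le_r b), not_lt.1 hlt⟩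
  have hab : F.r a < F.l b := by
    obtain ⟨c, hc, hca⟩ := Finset.exists_mem_ne hne a
    exact (hleft c hc hca).trans_le (hb' c hc)
  -- Every interval meeting both `a` and `b` contains `[F.r a, F.l b]`.
  have hQ : F.CommonClique n a b := fun w _ w' _ h₁ h₂ h₃ h₄ =>
    ⟨(h₁.1.trans hab.le).trans h₄.2, (h₃.1.trans hab.le).trans h₂.2⟩
  refine ⟨a, Finset.mem_range.1 (hI ha), b, Finset.mem_range.1 (hI hb),
    fun s hs => ⟨hQ, hCI s hs a ha, hCI s hs b hb⟩, fun x hx => ⟨fun h => ?_, fun s _ hs => ?_⟩⟩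
  -- A member of `I` in the core would be near `a` and near `b`, hence equal to both by
  -- independence, although `a` and `b` are disjoint.
  · have h₁ : x = a := by
      by_contra hne
      exact hI' x hx a ha hne h.2.1
    have h₂ : x = b := by
      by_contra hne
      exact hI' x hx b hb hne h.2.2
    have := F.l_le_r a
    rw [← h₁, h₂] at hab
    exact absurd (F.l_le_r b) (not_le.2 hab)
  · by_cases hxa : x = a
    · exact hxa ▸ hs.2.1
    by_cases hxb : x = b
    · exact hxb ▸ hs.2.2
    have h₁ := hleft x hx hxa
    have h₂ := hright x hx hxb
    exact ⟨(hs.2.1.1.trans h₁.le).trans (F.l_le_r x),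
      ((F.l_le_r x).trans h₂.le).trans hs.2.2.2⟩

/-! ### Codes of tuples -/

theorem digit_inj {k a b a' b' : ℕ} (hb : b < k) (hb' : b' < k) (h : a * k + b = a' * k + b') :
    a = a' ∧ b = b' := by
  have h₁ := congrArg (· % k) h
  simp only [Nat.mul_add_mod_self_right, Nat.mod_eq_of_lt hb, Nat.mod_eq_of_lt hb'] at h₁
  subst h₁
  exact ⟨Nat.eq_of_mul_eq_mul_right (by omega) (Nat.add_right_cancel h), rfl⟩

theorem digit_lt {k m a b : ℕ} (ha : a < m) (hb : b < k) : a * k + b < m * k := by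
  have := Nat.mul_le_mul_right k (Nat.succ_le_of_lt ha)
  rw [Nat.succ_mul] at this
  omega

/-! ### Blocks of cluster subgraphs -/

open Classical in
/-- The block with the code `p`. -/
noncomputable def block (F : Intervals) (n p : ℕ) : Finset ℕ :=
  (Finset.range n).filter fun w => ∃ u < n, ∃ v < n, ∃ x < n, ∃ y < n,
    p = ((u * n + v) * n + x) * n + y ∧ F.InBlock n u v x y w

theorem mem_block {p w : ℕ} : w ∈ F.block n p ↔ w < n ∧ ∃ u < n, ∃ v < n, ∃ x < n, ∃ y < n,
    p = ((u * n + v) * n + x) * n + y ∧ F.InBlock n u v x y w := by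
  simp [block]

theorem block_code {u v x y w : ℕ} (hu : u < n) (hv : v < n) (hx : x < n) (hy : y < n) :
    w ∈ F.block n (((u * n + v) * n + x) * n + y) ↔ w < n ∧ F.InBlock n u v x y w := by
  rw [mem_block]
  refine and_congr_right fun _ => ⟨?_, fun h => ⟨u, hu, v, hv, x, hx, y, hy, rfl, h⟩⟩
  rintro ⟨u', hu', v', hv', x', hx', y', hy', h, hb⟩
  obtain ⟨h₁, rfl⟩ := digit_inj hy hy' h
  obtain ⟨h₂, rfl⟩ := digit_inj hx hx' h₁
  obtain ⟨rfl, rfl⟩ := digit_inj hv hv' h₂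
  exact hb

theorem near_of_mem_block {p w w' : ℕ} (hw : w ∈ F.block n p) (hw' : w' ∈ F.block n p) :
    F.Near w w' := by
  obtain ⟨hwn, u, hu, v, hv, x, hx, y, hy, rfl, h⟩ := mem_block.1 hw
  obtain ⟨hwn', h'⟩ := (block_code hu hv hx hy).1 hw'
  exact h.1 w hwn w' hwn' h.2.1 h.2.2.1 h'.2.1 h'.2.2.1

/-- Distinct blocks with a vertex in common or an edge between them. -/
def BlockAdj (F : Intervals) (n p q : ℕ) : Prop :=
  p ≠ q ∧ ∃ w ∈ F.block n p, ∃ w' ∈ F.block n q, F.Near w w'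

theorem blockAdj_symm (p q : ℕ) (h : F.BlockAdj n p q) : F.BlockAdj n q p := by
  obtain ⟨hne, w, hw, w', hw', h⟩ := h
  exact ⟨hne.symm, w', hw', w, hw, h.symm⟩

open Classical in
-- Let `f` be the largest right end in a block and choose `p` with `f p` minimal. Every block in
-- conflict with `p` has an interval containing the point `f p`: a member meeting `p` starts at or
-- before `f p`, and if it ends too early, then the member with the largest right end serves, since
-- the two intersect. Distinct blocks sharing this point are in conflict.
theorem blockAdj_eliminable {M : ℕ} (S : ℕ → Prop)
    (hS : ∀ p, S p → p < M ∧ (F.block n p).Nonempty) (hne : ∃ p, S p) :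
    ∃ p, S p ∧ ∀ q r, S q → S r → F.BlockAdj n p q → F.BlockAdj n p r →
      q = r ∨ F.BlockAdj n q r := by
  -- The value `0` is never used: the blocks in `S` are nonempty.
  set f : ℕ → ℝ := fun p => if h : (F.block n p).Nonempty then (F.block n p).sup' h F.r else 0
  have hf : ∀ p, S p → (∀ w ∈ F.block n p, F.r w ≤ f p) ∧ ∃ w ∈ F.block n p, f p = F.r w := by
    intro p hp
    have h := (hS p hp).2
    have hfp : f p = (F.block n p).sup' h F.r := dif_pos h
    rw [hfp]
    exact ⟨fun w hw => Finset.le_sup' F.r hw, Finset.exists_mem_eq_sup' h F.r⟩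
  obtain ⟨p₀, hp₀⟩ := hne
  obtain ⟨p, hp, hmin⟩ := ((Finset.range M).filter S).exists_min_image f
    ⟨p₀, Finset.mem_filter.2 ⟨Finset.mem_range.2 (hS p₀ hp₀).1, hp₀⟩⟩
  have hp := (Finset.mem_filter.1 hp).2
  have key : ∀ q, S q → F.BlockAdj n p q → ∃ a ∈ F.block n q, F.l a ≤ f p ∧ f p ≤ F.r a := by
    rintro q hq ⟨-, b, hb, a, ha, hab⟩
    have hle : f p ≤ f q := hmin q (Finset.mem_filter.2 ⟨Finset.mem_range.2 (hS q hq).1, hq⟩)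
    have hla : F.l a ≤ f p := hab.2.trans ((hf p hp).1 b hb)
    obtain ⟨z, hz, hfz⟩ := (hf q hq).2
    by_cases hra : f p ≤ F.r a
    · exact ⟨a, ha, hla, hra⟩
    · exact ⟨z, hz, (near_of_mem_block ha hz).2.trans (not_le.1 hra).le, hfz ▸ hle⟩
  refine ⟨p, hp, fun q r hq hr hpq hpr => ?_⟩
  obtain ⟨a, ha, ha₁, ha₂⟩ := key q hq hpq
  obtain ⟨b, hb, hb₁, hb₂⟩ := key r hr hpr
  by_cases hqr : q = r
  · exact Or.inl hqr
  · exact Or.inr ⟨hqr, a, ha, b, hb, ha₁.trans hb₂, hb₁.trans ha₂⟩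

/-- The set `K` induces a cluster graph. -/
def IsCluster (F : Intervals) (K : Finset ℕ) : Prop :=
  ∀ a ∈ K, ∀ b ∈ K, ∀ c ∈ K, F.Near a b → F.Near b c → F.Near a c

theorem isCluster_biUnion {I : Finset ℕ}
    (hI : ∀ p ∈ I, ∀ q ∈ I, p ≠ q → ¬ F.BlockAdj n p q) : F.IsCluster (I.biUnion (F.block n)) := by
  have key : ∀ p ∈ I, ∀ q ∈ I, ∀ a ∈ F.block n p, ∀ b ∈ F.block n q, F.Near a b → p = q := by
    intro p hp q hq a ha b hb hab
    by_contra hpq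
    exact hI p hp q hq hpq ⟨hpq, a, ha, b, hb, hab⟩
  intro a ha b hb c hc hab hbc
  obtain ⟨p, hp, ha⟩ := Finset.mem_biUnion.1 ha
  obtain ⟨q, hq, hb⟩ := Finset.mem_biUnion.1 hb
  obtain ⟨r, hr, hc⟩ := Finset.mem_biUnion.1 hc
  obtain rfl := key p hp q hq a ha b hb hab
  obtain rfl := key p hp r hr b hb c hc hbc
  exact near_of_mem_block ha hc

open Classical in
-- Each class of the cluster subgraph `K` is replaced by a block containing it. An edge between two
-- of these blocks would, by the fourth condition of `InBlock` applied on both sides, give an edge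
-- between the two classes. The blocks so obtained are an admissible family `J` covering `K`.
theorem card_le_of_isCluster {I K : Finset ℕ}
    (hI : ∀ p ∈ I, ∀ q ∈ I, p ≠ q → ¬ F.BlockAdj n p q)
    (hmax : ∀ J ⊆ Finset.range (n * n * n * n), (∀ p ∈ J, ∀ q ∈ J, p ≠ q → ¬ F.BlockAdj n p q) →
      ∑ p ∈ J, (F.block n p).card ≤ ∑ p ∈ I, (F.block n p).card)
    (hK : K ⊆ Finset.range n) (hcl : F.IsCluster K) :
    K.card ≤ (I.biUnion (F.block n)).card := by
  have hP : ∀ c : Finset ℕ, ∃ p, c ⊆ Finset.range n → c.Nonempty →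
      (∀ a ∈ c, ∀ b ∈ c, F.Near a b) → p < n * n * n * n ∧ c ⊆ F.block n p ∧ ∃ x ∈ c, ∃ y ∈ c,
        ∀ w ∈ F.block n p, ∀ z < n, F.Near z w → F.Near z x ∨ F.Near z y := by
    intro c
    by_cases hc : c ⊆ Finset.range n ∧ c.Nonempty ∧ ∀ a ∈ c, ∀ b ∈ c, F.Near a b
    · obtain ⟨hc, hne, hnear⟩ := hc
      obtain ⟨u, hu, v, hv, x, hx, y, hy, h⟩ := exists_inBlock hc hne hnear
      have hxn := Finset.mem_range.1 (hc hx)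
      have hyn := Finset.mem_range.1 (hc hy)
      refine ⟨((u * n + v) * n + x) * n + y, fun _ _ _ =>
        ⟨digit_lt (digit_lt (digit_lt hu hv) hxn) hyn, fun w hw => ?_, x, hx, y, hy,
        fun w hw => ?_⟩⟩
      · exact (block_code hu hv hxn hyn).2 ⟨Finset.mem_range.1 (hc hw), h w hw⟩
      · exact ((block_code hu hv hxn hyn).1 hw).2.2.2.2
    · exact ⟨0, fun h₁ h₂ h₃ => (hc ⟨h₁, h₂, h₃⟩).elim⟩
  -- The code is a function of the class as a set, so all members of a class receive the same block.
  choose P hP using hP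
  set cls : ℕ → Finset ℕ := fun a => K.filter fun b => F.Near a b with hcls
  have hcls' : ∀ a ∈ K, P (cls a) < n * n * n * n ∧ cls a ⊆ F.block n (P (cls a)) ∧
      ∃ x ∈ cls a, ∃ y ∈ cls a, ∀ w ∈ F.block n (P (cls a)), ∀ z < n, F.Near z w →
        F.Near z x ∨ F.Near z y := by
    intro a ha
    refine hP (cls a) ((Finset.filter_subset _ _).trans hK)
      ⟨a, Finset.mem_filter.2 ⟨ha, near_self a⟩⟩ fun b hb c hc => ?_
    obtain ⟨hb, hab⟩ := Finset.mem_filter.1 hb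
    obtain ⟨hc, hac⟩ := Finset.mem_filter.1 hc
    exact hcl b hb a ha c hc hab.symm hac
  set J := K.image fun a => P (cls a)
  have hJ : ∀ p ∈ J, ∀ q ∈ J, p ≠ q → ¬ F.BlockAdj n p q := by
    rintro p hp q hq hpq ⟨-, w, hw, w', hw', hww'⟩
    obtain ⟨a, ha, rfl⟩ := Finset.mem_image.1 hp
    obtain ⟨b, hb, rfl⟩ := Finset.mem_image.1 hq
    obtain ⟨-, -, x, hx, y, hy, hxy⟩ := hcls' a ha
    obtain ⟨-, -, x', hx', y', hy', hxy'⟩ := hcls' b hb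
    -- The vertex `w'` is adjacent to the block of `a`, hence near the class of `a` itself; the same
    -- argument then moves from `w'` to the class of `b`.
    have h₁ : ∃ c ∈ cls a, F.Near w' c := by
      rcases hxy w hw w' (mem_block.1 hw').1 hww'.symm with h | h
      · exact ⟨x, hx, h⟩
      · exact ⟨y, hy, h⟩
    obtain ⟨c, hc, hwc⟩ := h₁
    obtain ⟨hcK, hac⟩ := Finset.mem_filter.1 hc
    have h₂ : ∃ d ∈ cls b, F.Near c d := by
      rcases hxy' w' hw' c (Finset.mem_range.1 (hK hcK)) hwc.symm with h | h
      · exact ⟨x', hx', h⟩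
      · exact ⟨y', hy', h⟩
    obtain ⟨d, hd, hcd⟩ := h₂
    obtain ⟨hdK, hbd⟩ := Finset.mem_filter.1 hd
    have hab : F.Near a b := hcl a ha d hdK b hb (hcl a ha c hcK d hdK hac hcd) hbd.symm
    refine hpq (congrArg P (Finset.filter_congr fun e he => ⟨fun h => ?_, fun h => ?_⟩))
    · exact hcl b hb a ha e he hab.symm h
    · exact hcl a ha b hb e he hab h
  have hJM : J ⊆ Finset.range (n * n * n * n) := by
    intro p hp
    obtain ⟨a, ha, rfl⟩ := Finset.mem_image.1 hp
    exact Finset.mem_range.2 (hcls' a ha).1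
  calc K.card ≤ (J.biUnion (F.block n)).card := by
        refine Finset.card_le_card fun a ha => Finset.mem_biUnion.2
          ⟨P (cls a), Finset.mem_image_of_mem _ ha, (hcls' a ha).2.1 ?_⟩
        exact Finset.mem_filter.2 ⟨ha, near_self a⟩
    _ ≤ ∑ p ∈ J, (F.block n p).card := Finset.card_biUnion_le
    _ ≤ ∑ p ∈ I, (F.block n p).card := hmax J hJM hJ
    -- A common vertex is near itself and would put two blocks in conflict, so the chosen blocks are
    -- disjoint.
    _ = (I.biUnion (F.block n)).card := by
        refine (Finset.card_biUnion fun p hp q hq hpq => ?_).symm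
        refine Finset.disjoint_left.2 fun w hw hw' => hI p hp q hq hpq ?_
        exact ⟨hpq, w, hw, w, hw', near_self w⟩

/-! ### Complete split subgraphs -/

open Classical in
/-- The singleton `{x}` if `p` is the code of a triple `(a, b, x)` such that `x` may belong to the
independent part for the clique given by `a` and `b`. -/
noncomputable def singletonOf (F : Intervals) (n p : ℕ) : Finset ℕ :=
  (Finset.range n).filter fun w => ∃ a < n, ∃ b < n, ∃ x < n, p = (a * n + b) * n + x ∧ w = x ∧
    F.InRest n a b x

theorem mem_singletonOf {p w : ℕ} : w ∈ F.singletonOf n p ↔ w < n ∧ ∃ a < n, ∃ b < n, ∃ x < n,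
    p = (a * n + b) * n + x ∧ w = x ∧ F.InRest n a b x := by
  simp [singletonOf]

theorem singletonOf_code {a b x w : ℕ} (ha : a < n) (hb : b < n) (hx : x < n) :
    w ∈ F.singletonOf n ((a * n + b) * n + x) ↔ w = x ∧ F.InRest n a b x := by
  rw [mem_singletonOf]
  refine ⟨?_, ?_⟩
  · rintro ⟨-, a', ha', b', hb', x', hx', h, rfl, h'⟩
    obtain ⟨h₀, rfl⟩ := digit_inj hx hx' h
    obtain ⟨rfl, rfl⟩ := digit_inj hb hb' h₀
    exact ⟨rfl, h'⟩
  · rintro ⟨rfl, h⟩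
    exact ⟨hx, a, ha, b, hb, w, hx, rfl, rfl, h⟩

theorem card_singletonOf {p : ℕ} (h : (F.singletonOf n p).Nonempty) :
    (F.singletonOf n p).card = 1 := by
  obtain ⟨w, hw⟩ := h
  refine Finset.card_eq_one.2 ⟨w, Finset.eq_singleton_iff_unique_mem.2 ⟨hw, fun w' hw' => ?_⟩⟩
  obtain ⟨hwn, a, ha, b, hb, x, hx, rfl, rfl, h⟩ := mem_singletonOf.1 hw
  exact ((singletonOf_code ha hb hx).1 hw').1

/-- Adjacency of triples with the same pair and adjacent third components. -/
def TripleAdj (F : Intervals) (n p q : ℕ) : Prop :=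
  ∃ a < n, ∃ b < n, ∃ x < n, ∃ x' < n, p = (a * n + b) * n + x ∧ q = (a * n + b) * n + x' ∧
    F.Near x x' ∧ x ≠ x'

theorem tripleAdj_symm (p q : ℕ) (h : F.TripleAdj n p q) : F.TripleAdj n q p := by
  obtain ⟨a, ha, b, hb, x, hx, x', hx', hp, hq, h, hne⟩ := h
  exact ⟨a, ha, b, hb, x', hx', x, hx, hq, hp, h.symm, hne.symm⟩

open Classical in
-- The residue `p % n` is the third component. Among intervals, the one with the smallest right end
-- is simplicial: all its neighbours contain that end. Adjacent triples share their pair, so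
-- minimality over all triples does no harm.
theorem tripleAdj_eliminable {M : ℕ} (S : ℕ → Prop)
    (hS : ∀ p, S p → p < M ∧ (F.singletonOf n p).Nonempty) (hne : ∃ p, S p) :
    ∃ p, S p ∧ ∀ q r, S q → S r → F.TripleAdj n p q → F.TripleAdj n p r →
      q = r ∨ F.TripleAdj n q r := by
  obtain ⟨p₀, hp₀⟩ := hne
  obtain ⟨p, hp, hmin⟩ := ((Finset.range M).filter S).exists_min_image (fun p => F.r (p % n))
    ⟨p₀, Finset.mem_filter.2 ⟨Finset.mem_range.2 (hS p₀ hp₀).1, hp₀⟩⟩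
  refine ⟨p, (Finset.mem_filter.1 hp).2, ?_⟩
  rintro q r hq hr ⟨a, ha, b, hb, x, hx, y, hy, rfl, rfl, hxy, -⟩
    ⟨a', ha', b', hb', x', hx', z, hz, h, rfl, hxz, -⟩
  obtain ⟨h₀, rfl⟩ := digit_inj hx hx' h
  obtain ⟨rfl, rfl⟩ := digit_inj hb hb' h₀
  have h₁ := hmin _ (Finset.mem_filter.2 ⟨Finset.mem_range.2 (hS _ hq).1, hq⟩)
  have h₂ := hmin _ (Finset.mem_filter.2 ⟨Finset.mem_range.2 (hS _ hr).1, hr⟩)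
  simp only [Nat.mul_add_mod_self_right, Nat.mod_eq_of_lt hx, Nat.mod_eq_of_lt hy,
    Nat.mod_eq_of_lt hz] at h₁ h₂
  by_cases hyz : y = z
  · exact Or.inl (by rw [hyz])
  · exact Or.inr ⟨a, ha, b, hb, y, hy, z, hz, rfl, rfl,
      ⟨hxy.2.trans h₂, hxz.2.trans h₁⟩, hyz⟩

open Classical in
/-- The vertices which the set `I` of triples provides for the pair `(a, b)`. -/
noncomputable def part (n : ℕ) (I : Finset ℕ) (a b : ℕ) : Finset ℕ :=
  (Finset.range n).filter fun x => (a * n + b) * n + x ∈ I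

theorem mem_part {I : Finset ℕ} {a b x : ℕ} :
    x ∈ part n I a b ↔ x < n ∧ (a * n + b) * n + x ∈ I := by
  simp [part]

open Classical in
-- Exchange argument: triples with different pairs are never adjacent, so in an optimal `I` the
-- triples of the pair `(a, b)` can be replaced by those coming from `T`. All weights involved are
-- `1`. Hence a global optimum is optimal for each pair separately.
theorem card_le_card_part {I T : Finset ℕ} {a b : ℕ} (ha : a < n) (hb : b < n)
    (hIM : I ⊆ Finset.range (n * n * n))
    (hI₀ : ∀ p ∈ I, (F.singletonOf n p).Nonempty)
    (hI : ∀ p ∈ I, ∀ q ∈ I, p ≠ q → ¬ F.TripleAdj n p q)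
    (hmax : ∀ J ⊆ Finset.range (n * n * n), (∀ p ∈ J, ∀ q ∈ J, p ≠ q → ¬ F.TripleAdj n p q) →
      ∑ p ∈ J, (F.singletonOf n p).card ≤ ∑ p ∈ I, (F.singletonOf n p).card)
    (hT : T ⊆ Finset.range n) (hT' : ∀ x ∈ T, F.InRest n a b x)
    (hT'' : ∀ x ∈ T, ∀ y ∈ T, x ≠ y → ¬ F.Near x y) :
    T.card ≤ (part n I a b).card := by
  have hinj : Function.Injective fun x => (a * n + b) * n + x := fun x y h => Nat.add_left_cancel h
  -- Dividing by `n` strips the third component, so `I'` consists of the triples of `I` with another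
  -- pair.
  set I' := I.filter fun p => p / n ≠ a * n + b with hI'
  set T' := T.image fun x => (a * n + b) * n + x with hT'def
  have hdiv : ∀ c d x, x < n → ((c * n + d) * n + x) / n = c * n + d := by
    intro c d x hx
    rw [Nat.add_comm, Nat.add_mul_div_right _ _ (by omega), Nat.div_eq_of_lt hx, Nat.zero_add]
  have hdis : Disjoint I' T' := by
    refine Finset.disjoint_left.2 fun p hp hp' => (Finset.mem_filter.1 hp).2 ?_
    obtain ⟨x, hx, rfl⟩ := Finset.mem_image.1 hp'
    exact hdiv a b x (Finset.mem_range.1 (hT hx))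
  have hJM : I' ∪ T' ⊆ Finset.range (n * n * n) := by
    refine Finset.union_subset ((Finset.filter_subset _ _).trans hIM) fun p hp => ?_
    obtain ⟨x, hx, rfl⟩ := Finset.mem_image.1 hp
    exact Finset.mem_range.2 (digit_lt (digit_lt ha hb) (Finset.mem_range.1 (hT hx)))
  have hcross : ∀ p ∈ I', ∀ q ∈ T', ¬ F.TripleAdj n p q := by
    rintro p hp q hq ⟨c, hc, d, hd, x, hx, y, hy, rfl, rfl, -, -⟩
    obtain ⟨z, hz, hz'⟩ := Finset.mem_image.1 hq
    refine (Finset.mem_filter.1 hp).2 ?_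
    rw [hdiv c d x hx]
    exact ((digit_inj (Finset.mem_range.1 (hT hz)) hy hz').1).symm
  have hJ : ∀ p ∈ I' ∪ T', ∀ q ∈ I' ∪ T', p ≠ q → ¬ F.TripleAdj n p q := by
    intro p hp q hq hpq
    rcases Finset.mem_union.1 hp with hp | hp <;> rcases Finset.mem_union.1 hq with hq | hq
    · exact hI p (Finset.mem_filter.1 hp).1 q (Finset.mem_filter.1 hq).1 hpq
    · exact hcross p hp q hq
    · exact fun h => hcross q hq p hp (tripleAdj_symm _ _ h)
    · rintro ⟨c, hc, d, hd, x, hx, y, hy, rfl, rfl, h, hne⟩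
      obtain ⟨z, hz, hz'⟩ := Finset.mem_image.1 hp
      obtain ⟨z', hz'', hz'''⟩ := Finset.mem_image.1 hq
      obtain ⟨-, rfl⟩ := digit_inj (Finset.mem_range.1 (hT hz)) hx hz'
      obtain ⟨-, rfl⟩ := digit_inj (Finset.mem_range.1 (hT hz'')) hy hz'''
      exact hT'' z hz z' hz'' hne h
  have hsum : ∀ J : Finset ℕ, (∀ p ∈ J, (F.singletonOf n p).Nonempty) →
      ∑ p ∈ J, (F.singletonOf n p).card = J.card := by
    intro J hJ
    rw [Finset.sum_congr rfl fun p hp => card_singletonOf (hJ p hp), Finset.sum_const, smul_eq_mul,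
      mul_one]
  have hmain := hmax _ hJM hJ
  rw [hsum I hI₀, hsum (I' ∪ T') ?_, Finset.card_union_of_disjoint hdis,
    Finset.card_image_of_injective _ hinj] at hmain
  · have hsplit : I'.card + (I.filter fun p => ¬ p / n ≠ a * n + b).card = I.card :=
      Finset.card_filter_add_card_filter_not (s := I) (fun p => p / n ≠ a * n + b)
    have hpart : (I.filter fun p => ¬ p / n ≠ a * n + b).card ≤ (part n I a b).card := by
      rw [← Finset.card_image_of_injective (part n I a b) hinj]
      refine Finset.card_le_card fun p hp => ?_
      obtain ⟨hpI, hp'⟩ := Finset.mem_filter.1 hp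
      obtain ⟨w, hw⟩ := hI₀ p hpI
      obtain ⟨-, c, hc, d, hd, x, hx, rfl, rfl, -⟩ := mem_singletonOf.1 hw
      rw [not_not, hdiv c d w hx] at hp'
      obtain ⟨rfl, rfl⟩ := digit_inj hd hb hp'
      exact Finset.mem_image.2 ⟨w, mem_part.2 ⟨hx, hpI⟩, rfl⟩
    omega
  · intro p hp
    rcases Finset.mem_union.1 hp with hp | hp
    · exact hI₀ p (Finset.mem_filter.1 hp).1
    · obtain ⟨x, hx, rfl⟩ := Finset.mem_image.1 hp
      exact ⟨x, (singletonOf_code ha hb (Finset.mem_range.1 (hT hx))).2 ⟨rfl, hT' x hx⟩⟩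

open Classical in
/-- The complete split subgraph which the set `I` of triples provides for the pair with the
code `p`. -/
noncomputable def splitOf (F : Intervals) (n : ℕ) (I : Finset ℕ) (p : ℕ) : Finset ℕ :=
  (Finset.range n).filter fun w => ∃ a < n, ∃ b < n, p = a * n + b ∧
    (F.InCore n a b w ∨ (a * n + b) * n + w ∈ I)

theorem mem_splitOf {I : Finset ℕ} {p w : ℕ} : w ∈ F.splitOf n I p ↔ w < n ∧ ∃ a < n, ∃ b < n,
    p = a * n + b ∧ (F.InCore n a b w ∨ (a * n + b) * n + w ∈ I) := by
  simp [splitOf]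

/-- The set `K` induces a complete split graph. -/
def IsCompleteSplit (F : Intervals) (K : Finset ℕ) : Prop :=
  ∃ C I : Finset ℕ, C ∪ I = K ∧ Disjoint C I ∧ (∀ a ∈ C, ∀ b ∈ C, F.Near a b) ∧
    (∀ a ∈ I, ∀ b ∈ I, a ≠ b → ¬ F.Near a b) ∧ ∀ a ∈ C, ∀ b ∈ I, F.Near a b

open Classical in
-- Independence in the complete graph means that `I₂` has at most one element. Its set is nonempty,
-- which makes the element the code of a genuine pair.
theorem isCompleteSplit_biUnion {I₁ I₂ : Finset ℕ}
    (hI₀ : ∀ p ∈ I₁, (F.singletonOf n p).Nonempty)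
    (hI : ∀ p ∈ I₁, ∀ q ∈ I₁, p ≠ q → ¬ F.TripleAdj n p q)
    (hI₂ : ∀ p ∈ I₂, ∀ q ∈ I₂, p ≠ q → ¬ p ≠ q) (hI₂' : ∀ p ∈ I₂, (F.splitOf n I₁ p).Nonempty) :
    F.IsCompleteSplit (I₂.biUnion (F.splitOf n I₁)) := by
  rcases I₂.eq_empty_or_nonempty with rfl | ⟨p, hp⟩
  · exact ⟨∅, ∅, by simp, by simp, by simp, by simp, by simp⟩
  · have hI₂'' : I₂ = {p} := by
      refine Finset.eq_singleton_iff_unique_mem.2 ⟨hp, fun q hq => ?_⟩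
      by_contra hne
      exact hI₂ q hq p hp hne hne
    rw [hI₂'', Finset.singleton_biUnion]
    obtain ⟨w, hw⟩ := hI₂' p hp
    obtain ⟨-, a, ha, b, hb, rfl, -⟩ := mem_splitOf.1 hw
    have hrest : ∀ x ∈ part n I₁ a b, F.InRest n a b x := by
      intro x hx
      obtain ⟨hxn, hx⟩ := mem_part.1 hx
      obtain ⟨w, hw⟩ := hI₀ _ hx
      exact ((singletonOf_code ha hb hxn).1 hw).2
    refine ⟨(Finset.range n).filter (F.InCore n a b), part n I₁ a b, ?_, ?_, ?_, ?_, ?_⟩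
    · ext x
      simp only [Finset.mem_union, Finset.mem_filter, Finset.mem_range, mem_part, mem_splitOf]
      constructor
      · rintro (⟨hx, h⟩ | ⟨hx, h⟩)
        · exact ⟨hx, a, ha, b, hb, rfl, Or.inl h⟩
        · exact ⟨hx, a, ha, b, hb, rfl, Or.inr h⟩
      · rintro ⟨hx, a', ha', b', hb', h, h'⟩
        obtain ⟨rfl, rfl⟩ := digit_inj hb hb' h
        exact h'.imp (fun h => ⟨hx, h⟩) fun h => ⟨hx, h⟩
    · exact Finset.disjoint_left.2 fun x hx hx' => (hrest x hx').1 (Finset.mem_filter.1 hx).2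
    · intro s hs s' hs'
      obtain ⟨hs, hs₁⟩ := Finset.mem_filter.1 hs
      obtain ⟨hs', hs₂⟩ := Finset.mem_filter.1 hs'
      exact inCore_near (Finset.mem_range.1 hs) (Finset.mem_range.1 hs') hs₁ hs₂
    · intro x hx y hy hxy hnear
      obtain ⟨hxn, hx⟩ := mem_part.1 hx
      obtain ⟨hyn, hy⟩ := mem_part.1 hy
      exact hI _ hx _ hy (fun h => hxy (Nat.add_left_cancel h))
        ⟨a, ha, b, hb, x, hxn, y, hyn, rfl, rfl, hnear, hxy⟩
    · intro s hs x hx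
      obtain ⟨hs, hs₁⟩ := Finset.mem_filter.1 hs
      exact (hrest x hx).2 s (Finset.mem_range.1 hs) hs₁

open Classical in
-- With at least two independent vertices, the clique part lies in the core of some pair and the
-- independent part competes in `card_le_card_part`. Otherwise `K` is a clique and lies in a core by
-- `exists_commonClique`.
theorem card_le_of_isCompleteSplit {I₁ I₂ K : Finset ℕ}
    (hIM : I₁ ⊆ Finset.range (n * n * n))
    (hI₀ : ∀ p ∈ I₁, (F.singletonOf n p).Nonempty)
    (hI : ∀ p ∈ I₁, ∀ q ∈ I₁, p ≠ q → ¬ F.TripleAdj n p q)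
    (hmax : ∀ J ⊆ Finset.range (n * n * n), (∀ p ∈ J, ∀ q ∈ J, p ≠ q → ¬ F.TripleAdj n p q) →
      ∑ p ∈ J, (F.singletonOf n p).card ≤ ∑ p ∈ I₁, (F.singletonOf n p).card)
    (hI₂ : ∀ p ∈ I₂, ∀ q ∈ I₂, p ≠ q → ¬ p ≠ q)
    (hmax₂ : ∀ J ⊆ Finset.range (n * n), (∀ p ∈ J, ∀ q ∈ J, p ≠ q → ¬ p ≠ q) →
      ∑ p ∈ J, (F.splitOf n I₁ p).card ≤ ∑ p ∈ I₂, (F.splitOf n I₁ p).card)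
    (hK : K ⊆ Finset.range n) (hs : F.IsCompleteSplit K) :
    K.card ≤ (I₂.biUnion (F.splitOf n I₁)).card := by
  rcases K.eq_empty_or_nonempty with rfl | hne
  · exact Nat.zero_le _
  -- A singleton is admissible in `hmax₂`, so it suffices to beat `K` with one pair.
  suffices h : ∃ a < n, ∃ b < n, K.card ≤ (F.splitOf n I₁ (a * n + b)).card by
    obtain ⟨a, ha, b, hb, h⟩ := h
    have h₁ := hmax₂ {a * n + b} (Finset.singleton_subset_iff.2
      (Finset.mem_range.2 (digit_lt ha hb))) (by
        intro p hp q hq hpq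
        rw [Finset.mem_singleton] at hp hq
        exact (hpq (hp.trans hq.symm)).elim)
    rw [Finset.sum_singleton] at h₁
    refine (h.trans h₁).trans (Finset.card_biUnion fun p hp q hq hpq => ?_).ge
    exact (hI₂ p hp q hq hpq hpq).elim
  obtain ⟨C, I, rfl, hdis, hC, hI', hCI⟩ := hs
  have hCn := Finset.union_subset_left hK
  have hIn := Finset.union_subset_right hK
  by_cases hcard : 1 < I.card
  · obtain ⟨a, ha, b, hb, hCore, hRest⟩ := exists_inCore_inRest hIn hI' hCI hcard
    refine ⟨a, ha, b, hb, ?_⟩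
    have hT := card_le_card_part ha hb hIM hI₀ hI hmax hIn hRest hI'
    have hdis' : Disjoint C (part n I₁ a b) := by
      refine Finset.disjoint_left.2 fun x hx hx' => ?_
      obtain ⟨hxn, hx'⟩ := mem_part.1 hx'
      obtain ⟨w, hw⟩ := hI₀ _ hx'
      exact ((singletonOf_code ha hb hxn).1 hw).2.1 (hCore x hx)
    calc (C ∪ I).card ≤ C.card + I.card := Finset.card_union_le _ _
      _ ≤ C.card + (part n I₁ a b).card := Nat.add_le_add_left hT _
      _ = (C ∪ part n I₁ a b).card := (Finset.card_union_of_disjoint hdis').symm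
      _ ≤ _ := by
        refine Finset.card_le_card fun x hx => mem_splitOf.2 ?_
        rcases Finset.mem_union.1 hx with hx | hx
        · exact ⟨Finset.mem_range.1 (hCn hx), a, ha, b, hb, rfl, Or.inl (hCore x hx)⟩
        · exact ⟨(mem_part.1 hx).1, a, ha, b, hb, rfl, Or.inr (mem_part.1 hx).2⟩
  · have hclique : ∀ x ∈ C ∪ I, ∀ y ∈ C ∪ I, F.Near x y := by
      intro x hx y hy
      rcases Finset.mem_union.1 hx with hx | hx <;> rcases Finset.mem_union.1 hy with hy | hy
      · exact hC x hx y hy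
      · exact hCI x hx y hy
      · exact (hCI y hy x hx).symm
      · rw [Finset.card_le_one.1 (not_lt.1 hcard) x hx y hy]
        exact near_self y
    obtain ⟨a, ha, b, hb, hQ, h⟩ := exists_commonClique hK hne hclique
    refine ⟨a, ha, b, hb, Finset.card_le_card fun x hx => mem_splitOf.2 ?_⟩
    exact ⟨Finset.mem_range.1 (hK hx), a, ha, b, hb, rfl, Or.inl ⟨hQ, h x hx⟩⟩

end Intervals

/-! ## Deletion sets of interval graphs -/

/-- If "equal or adjacent" is transitive, a walk of any length collapses to at most one edge, so
reachable vertices are equal or adjacent. -/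
theorem clusterGraph_iff {V : Type} (G : SimpleGraph V) : ClusterGraph G ↔
    ∀ a b c, (a = b ∨ G.Adj a b) → (b = c ∨ G.Adj b c) → (a = c ∨ G.Adj a c) := by
  constructor
  · intro h a b c hab hbc
    have hreach : ∀ {u v}, (u = v ∨ G.Adj u v) → G.Reachable u v := by
      rintro u v (rfl | h)
      · exact SimpleGraph.Reachable.refl _
      · exact h.reachable
    by_cases hac : a = c
    · exact Or.inl hac
    refine Or.inr (h (G.connectedComponentMk c) ?_ ?_ hac)
    · exact SimpleGraph.ConnectedComponent.eq.2 ((hreach hab).trans (hreach hbc))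
    · exact SimpleGraph.ConnectedComponent.eq.2 (SimpleGraph.Reachable.refl _)
  · intro h c a ha b hb hab
    have key : ∀ {u v} (p : G.Walk u v), u = v ∨ G.Adj u v := by
      intro u v p
      induction p with
      | nil => exact Or.inl rfl
      | cons hadj _ ih => exact h _ _ _ (Or.inr hadj) ih
    obtain ⟨p⟩ := SimpleGraph.ConnectedComponent.exact (ha.trans hb.symm)
    exact (key p).resolve_left hab

namespace Intervals

variable {F : Intervals} {n : ℕ} {G : SimpleGraph (Fin n)}

open Classical in
/-- The vertices, as natural numbers, which remain after the deletion of `X`. -/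
noncomputable def kept {n : ℕ} (X : Finset (Fin n)) : Finset ℕ :=
  (Finset.univ.filter fun v => v ∉ X).image Fin.val

theorem val_mem_kept {X : Finset (Fin n)} {v : Fin n} : (v : ℕ) ∈ kept X ↔ v ∉ X := by
  simp [kept, Fin.val_inj]

theorem kept_subset (X : Finset (Fin n)) : kept X ⊆ Finset.range n := by
  intro v hv
  obtain ⟨w, -, rfl⟩ := Finset.mem_image.1 hv
  exact Finset.mem_range.2 w.2

theorem card_kept_add_card (X : Finset (Fin n)) : (kept X).card + X.card = n := by
  classical
  rw [kept, Finset.card_image_of_injective _ Fin.val_injective]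
  have h := Finset.card_filter_add_card_filter_not (s := (Finset.univ : Finset (Fin n))) (· ∈ X)
  simp only [Finset.card_univ, Fintype.card_fin, Finset.filter_univ_mem] at h
  omega

/-- Kept and deleted vertices add up to `n`, so minimizing one count maximizes the other. -/
theorem isMinimumDeletionSet_of {𝒞 : GraphClass} {P : Finset ℕ → Prop}
    (hP : ∀ X, IsDeletionSet 𝒞 G X ↔ P (kept X)) {K : Finset ℕ} (hK : K ⊆ Finset.range n)
    (hPK : P K) (hmax : ∀ L ⊆ Finset.range n, P L → L.card ≤ K.card) {X : Finset (Fin n)}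
    (hX : ∀ v : Fin n, v ∈ X ↔ (v : ℕ) ∉ K) : IsMinimumDeletionSet 𝒞 G X := by
  have hKX : kept X = K := by
    ext v
    by_cases hv : v < n
    · rw [show v = ((⟨v, hv⟩ : Fin n) : ℕ) from rfl, val_mem_kept, hX, not_not]
    · exact iff_of_false (fun h => hv (Finset.mem_range.1 (kept_subset X h)))
        fun h => hv (Finset.mem_range.1 (hK h))
  refine ⟨(hP X).2 (hKX ▸ hPK), fun Y hY => ?_⟩
  have h₁ := hmax _ (kept_subset Y) ((hP Y).1 hY)
  have h₂ := card_kept_add_card X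
  have h₃ := card_kept_add_card Y
  rw [hKX] at h₂
  omega

theorem isDeletionSet_cluster (hG : ∀ i j : Fin n, G.Adj i j ↔ F.Near i j ∧ i ≠ j)
    (X : Finset (Fin n)) : IsDeletionSet ClusterGraph G X ↔ F.IsCluster (kept X) := by
  have hadj : ∀ a b : {v : Fin n | v ∉ X}, (a = b ∨ (G.induce {v | v ∉ X}).Adj a b) ↔
      F.Near (a : Fin n) (b : Fin n) := by
    intro a b
    rw [SimpleGraph.comap_adj, Function.Embedding.subtype_apply, Function.Embedding.subtype_apply,
      hG]
    constructor
    · rintro (rfl | h)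
      · exact near_self _
      · exact h.1
    · intro h
      by_cases hab : a = b
      · exact Or.inl hab
      · exact Or.inr ⟨h, fun h => hab (Subtype.ext h)⟩
  rw [IsDeletionSet, clusterGraph_iff]
  simp only [hadj]
  constructor
  · intro h a ha b hb c hc
    obtain ⟨a, -, rfl⟩ := Finset.mem_image.1 ha
    obtain ⟨b, -, rfl⟩ := Finset.mem_image.1 hb
    obtain ⟨c, -, rfl⟩ := Finset.mem_image.1 hc
    exact h ⟨a, val_mem_kept.1 ha⟩ ⟨b, val_mem_kept.1 hb⟩ ⟨c, val_mem_kept.1 hc⟩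
  · intro h a b c
    exact h a (val_mem_kept.2 a.2) b (val_mem_kept.2 b.2) c (val_mem_kept.2 c.2)

theorem isDeletionSet_completeSplit (hG : ∀ i j : Fin n, G.Adj i j ↔ F.Near i j ∧ i ≠ j)
    (X : Finset (Fin n)) :
    IsDeletionSet CompleteSplitGraph G X ↔ F.IsCompleteSplit (kept X) := by
  classical
  have hadj : ∀ a b : {v : Fin n | v ∉ X}, (G.induce {v | v ∉ X}).Adj a b ↔
      F.Near (a : Fin n) (b : Fin n) ∧ a ≠ b := by
    intro a b
    rw [SimpleGraph.comap_adj, Function.Embedding.subtype_apply, Function.Embedding.subtype_apply,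
      hG, Ne, Ne, Subtype.ext_iff]
  constructor
  · rintro ⟨C, I, hCI, hdis, hC, hI, hCI'⟩
    have himg : ∀ S : Set {v : Fin n | v ∉ X}, ∀ k,
        k ∈ (kept X).filter (fun k => ∃ v ∈ S, ((v : Fin n) : ℕ) = k) ↔
          ∃ v ∈ S, ((v : Fin n) : ℕ) = k := by
      intro S k
      rw [Finset.mem_filter, and_iff_right_iff_imp]
      rintro ⟨v, -, rfl⟩
      exact val_mem_kept.2 v.2
    refine ⟨(kept X).filter fun k => ∃ v ∈ C, ((v : Fin n) : ℕ) = k,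
      (kept X).filter fun k => ∃ v ∈ I, ((v : Fin n) : ℕ) = k, ?_, ?_, ?_, ?_, ?_⟩
    · refine Finset.Subset.antisymm (Finset.union_subset (Finset.filter_subset _ _)
        (Finset.filter_subset _ _)) fun k hk => ?_
      obtain ⟨v, hv, rfl⟩ := Finset.mem_image.1 hk
      have hv : v ∉ X := (Finset.mem_filter.1 hv).2
      rw [Finset.mem_union, himg, himg]
      rcases (hCI ▸ Set.mem_univ _ : (⟨v, hv⟩ : {v : Fin n | v ∉ X}) ∈ C ∪ I) with h | h
      · exact Or.inl ⟨_, h, rfl⟩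
      · exact Or.inr ⟨_, h, rfl⟩
    · refine Finset.disjoint_left.2 fun k hk hk' => ?_
      obtain ⟨v, hv, rfl⟩ := (himg _ _).1 hk
      obtain ⟨w, hw, h⟩ := (himg _ _).1 hk'
      obtain rfl : w = v := Subtype.ext (Fin.ext h)
      exact Set.disjoint_left.1 hdis hv hw
    · intro a ha b hb
      obtain ⟨v, hv, rfl⟩ := (himg _ _).1 ha
      obtain ⟨w, hw, rfl⟩ := (himg _ _).1 hb
      by_cases hvw : v = w
      · rw [hvw]
        exact near_self _
      · exact ((hadj v w).1 (hC hv hw hvw)).1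
    · intro a ha b hb hab hnear
      obtain ⟨v, hv, rfl⟩ := (himg _ _).1 ha
      obtain ⟨w, hw, rfl⟩ := (himg _ _).1 hb
      have hvw : v ≠ w := by
        rintro rfl
        exact hab rfl
      exact hI hv hw hvw ((hadj v w).2 ⟨hnear, hvw⟩)
    · intro a ha b hb
      obtain ⟨v, hv, rfl⟩ := (himg _ _).1 ha
      obtain ⟨w, hw, rfl⟩ := (himg _ _).1 hb
      exact ((hadj v w).1 (hCI' v hv w hw)).1
  · rintro ⟨C, I, hCI, hdis, hC, hI, hCI'⟩
    have hne : ∀ {v w : {v : Fin n | v ∉ X}}, v ≠ w → ((v : Fin n) : ℕ) ≠ ((w : Fin n) : ℕ) :=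
      fun h h' => h (Subtype.ext (Fin.ext h'))
    refine ⟨{v | ((v : Fin n) : ℕ) ∈ C}, {v | ((v : Fin n) : ℕ) ∈ I}, ?_, ?_, ?_, ?_, ?_⟩
    · refine Set.eq_univ_of_forall fun v => ?_
      have h := val_mem_kept.2 v.2
      rw [← hCI] at h
      exact Finset.mem_union.1 h
    · exact Set.disjoint_left.2 fun v hv hv' => Finset.disjoint_left.1 hdis hv hv'
    · intro v hv w hw hvw
      exact (hadj v w).2 ⟨hC _ hv _ hw, hvw⟩
    · intro v hv w hw hvw h
      exact hI _ hv _ hw (hne hvw) ((hadj v w).1 h).1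
    · intro v hv w hw
      refine (hadj v w).2 ⟨hCI' _ hv _ hw, ?_⟩
      rintro rfl
      exact Finset.disjoint_left.1 hdis hv hw

open Classical in
/-- Every interval graph comes from a family of intervals. -/
theorem exists_of_intervalGraph (h : IntervalGraph G) :
    ∃ F : Intervals, ∀ i j : Fin n, G.Adj i j ↔ F.Near i j ∧ i ≠ j := by
  obtain ⟨lp, rp, hle, h⟩ := h
  -- Indices from `n` on receive the irrelevant interval `[0, 0]`.
  refine ⟨⟨fun i => if hi : i < n then lp ⟨i, hi⟩ else 0,
    fun i => if hi : i < n then rp ⟨i, hi⟩ else 0, fun i => ?_⟩, fun i j => ?_⟩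
  · by_cases hi : i < n
    · simp only [hi, dif_pos, hle]
    · simp only [hi, dif_neg, not_false_eq_true, le_refl]
  · by_cases hij : i = j
    · subst hij
      simp
    · rw [h i j hij, Set.Icc_inter_Icc, Set.nonempty_Icc, sup_le_iff, le_inf_iff, le_inf_iff]
      have h₁ := hle i
      have h₂ := hle j
      simp only [Near, Fin.is_lt, dif_pos, ne_eq, hij, not_false_eq_true, and_true, h₁, h₂,
        true_and]

end Intervals

/-! ## The algorithms -/

namespace Intervals

/-- The array `0` holds the adjacency matrix of the family `F`. -/
def HoldsMatrix (F : Intervals) (n : ℕ) (μ : Fin 16 → ℕ → Prop) : Prop :=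
  ∀ i < n, ∀ j < n, (μ 0 (pair i j) ↔ F.Near i j ∧ i ≠ j)

/-- The vertices `x` and `y` are equal or adjacent. -/
def nearFm (x y : Fin 16) : Fm := .or (.eq (.var x) (.var y)) (.rd₂ 0 (.var x) (.var y))

/-- The common closed neighbourhood of the vertices `9` and `10` is a clique. -/
def commonCliqueFm : Fm :=
  .all 13 (.var 0) (.all 14 (.var 0) (.imp (nearFm 13 9) (.imp (nearFm 13 10)
    (.imp (nearFm 14 9) (.imp (nearFm 14 10) (nearFm 13 14))))))

/-- The formula for `InBlock` at the vertices `9`, `10`, `11`, `12` and `8`. -/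
def inBlockFm : Fm :=
  .and commonCliqueFm (.and (nearFm 8 9) (.and (nearFm 8 10)
    (.all 13 (.var 0) (.imp (nearFm 13 8) (.or (nearFm 13 11) (nearFm 13 12))))))

/-- The formula for `InCore` at the vertices `9`, `10` and `x`. -/
def inCoreFm (x : Fin 16) : Fm := .and commonCliqueFm (.and (nearFm x 9) (nearFm x 10))

/-- The formula for `InRest` at the vertices `9`, `10` and `8`. -/
def inRestFm : Fm :=
  .and (.not (inCoreFm 8)) (.all 15 (.var 0) (.imp (inCoreFm 15) (nearFm 15 8)))

/-! ### Meaning of the formulas about adjacency. -/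

variable {F : Intervals} {n : ℕ} {ρ : Fin 16 → ℕ} {μ : Fin 16 → ℕ → Prop}

theorem holds_nearFm (hμ : F.HoldsMatrix n μ) {x y : Fin 16} (hx : ρ x < n) (hy : ρ y < n) :
    (nearFm x y).Holds μ ρ ↔ F.Near (ρ x) (ρ y) := by
  simp only [nearFm, Fm.holds_or, Fm.holds_eq, Fm.holds_rd₂, Exp.eval_var, hμ _ hx _ hy]
  constructor
  · rintro (h | h)
    · rw [h]
      exact near_self _
    · exact h.1
  · intro h
    by_cases hxy : ρ x = ρ y
    · exact Or.inl hxy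
    · exact Or.inr ⟨h, hxy⟩

theorem holds_commonCliqueFm (hμ : F.HoldsMatrix n μ) (h₀ : ρ 0 = n) (h₉ : ρ 9 < n)
    (h₁₀ : ρ 10 < n) : commonCliqueFm.Holds μ ρ ↔ F.CommonClique n (ρ 9) (ρ 10) := by
  simp only [commonCliqueFm, Fm.holds_all, Exp.eval_var, Function.update_apply, Fin.reduceEq,
    if_false, h₀]
  refine forall₂_congr fun w hw => forall₂_congr fun w' hw' => ?_
  simp only [Fm.holds_imp]
  rw [holds_nearFm hμ, holds_nearFm hμ, holds_nearFm hμ, holds_nearFm hμ, holds_nearFm hμ] <;>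
    simp only [Function.update_apply, Fin.reduceEq, if_true, if_false] <;> assumption

theorem holds_inBlockFm (hμ : F.HoldsMatrix n μ) (h₀ : ρ 0 = n) (h₈ : ρ 8 < n) (h₉ : ρ 9 < n)
    (h₁₀ : ρ 10 < n) (h₁₁ : ρ 11 < n) (h₁₂ : ρ 12 < n) :
    inBlockFm.Holds μ ρ ↔ F.InBlock n (ρ 9) (ρ 10) (ρ 11) (ρ 12) (ρ 8) := by
  simp only [inBlockFm, Fm.holds_and, Fm.holds_all, Exp.eval_var, h₀,
    holds_commonCliqueFm hμ h₀ h₉ h₁₀, holds_nearFm hμ h₈ h₉, holds_nearFm hμ h₈ h₁₀]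
  refine and_congr_right fun _ => and_congr_right fun _ => and_congr_right fun _ =>
    forall₂_congr fun z hz => ?_
  simp only [Fm.holds_imp, Fm.holds_or]
  rw [holds_nearFm hμ, holds_nearFm hμ, holds_nearFm hμ] <;>
    simp only [Function.update_apply, Fin.reduceEq, if_true, if_false] <;> assumption

theorem holds_inCoreFm (hμ : F.HoldsMatrix n μ) (h₀ : ρ 0 = n) {x : Fin 16} (hx : ρ x < n)
    (h₉ : ρ 9 < n) (h₁₀ : ρ 10 < n) :
    (inCoreFm x).Holds μ ρ ↔ F.InCore n (ρ 9) (ρ 10) (ρ x) := by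
  simp only [inCoreFm, Fm.holds_and, holds_commonCliqueFm hμ h₀ h₉ h₁₀, holds_nearFm hμ hx h₉,
    holds_nearFm hμ hx h₁₀]
  rfl

theorem holds_inRestFm (hμ : F.HoldsMatrix n μ) (h₀ : ρ 0 = n) (h₈ : ρ 8 < n) (h₉ : ρ 9 < n)
    (h₁₀ : ρ 10 < n) : inRestFm.Holds μ ρ ↔ F.InRest n (ρ 9) (ρ 10) (ρ 8) := by
  simp only [inRestFm, Fm.holds_and, Fm.holds_not, Fm.holds_all, Exp.eval_var, h₀,
    holds_inCoreFm hμ h₀ h₈ h₉ h₁₀]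
  refine and_congr_right fun _ => forall₂_congr fun s hs => ?_
  simp only [Fm.holds_imp]
  rw [holds_nearFm hμ, holds_inCoreFm hμ] <;>
    simp only [Function.update_apply, Fin.reduceEq, if_true, if_false] <;> assumption

/-! ### The output -/

/-- Store in the array `1` the set of the vertices which do not belong to a set, among the rows of
the array `2`, with an index in the array `7`. -/
def outputCmd (m : Exp) : Cmd :=
  .row 1 0 8 (.var 0) (.not (.ex 2 m (.and (.rd₂ 7 0 (.var 2)) (.rd₂ 2 (.var 2) (.var 8)))))

open Classical in
theorem run_outputCmd {m : Exp} {M : ℕ} (h₀ : ρ 0 = n)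
    (hm : ∀ ρ : Fin 16 → ℕ, ρ 0 = n → m.eval ρ = M) {C : ℕ → Finset ℕ} {I : Finset ℕ}
    (hC : ∀ p < M, ∀ v < n, μ 2 (pair p v) ↔ v ∈ C p) (hIM : I ⊆ Finset.range M)
    (hI : ∀ p < M, μ 7 (pair 0 p) ↔ p ∈ I) (v : Fin n) :
    (outputCmd m).run ρ μ 1 (pair 0 v) ↔ (v : ℕ) ∉ I.biUnion C := by
  obtain ⟨-, h, -⟩ := Cmd.run_row (μ := μ) (ρ := ρ) (a := 1) (e := 0) (y := 8) (f := .var 0)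
    (φ := .not (.ex 2 m (.and (.rd₂ 7 0 (.var 2)) (.rd₂ 2 (.var 2) (.var 8))))) (i := 0) (F := n)
    (by rfl) (fun _ => rfl) h₀
  refine (h v v.2).trans ?_
  simp only [Fm.holds_not, Fm.holds_ex, Fm.holds_and, Fm.holds_rd₂, Exp.eval_var, Exp.eval_zero,
    Function.update_apply, Fin.reduceEq, if_true, if_false, Finset.mem_biUnion,
    hm (Function.update ρ 8 (v : ℕ)) h₀]
  refine not_congr ⟨?_, ?_⟩
  · rintro ⟨p, hp, h₁, h₂⟩
    exact ⟨p, (hI p hp).1 h₁, (hC p hp v v.2).1 h₂⟩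
  · rintro ⟨p, hpI, h₂⟩
    have hp := Finset.mem_range.1 (hIM hpI)
    exact ⟨p, hp, (hI p hp).2 hpI, (hC p hp v v.2).2 h₂⟩

/-! ### Cluster graphs -/

/-- The fourth power of the number of vertices. -/
def fourthPower : Exp := .var 0 * .var 0 * .var 0 * .var 0

/-- The vertex `8` belongs to the block with the code `2`. -/
def blockFm : Fm :=
  .ex 9 (.var 0) (.ex 10 (.var 0) (.ex 11 (.var 0) (.ex 12 (.var 0) (.and
    (.eq (.var 2) (((.var 9 * .var 0 + .var 10) * .var 0 + .var 11) * .var 0 + .var 12))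
    inBlockFm))))

/-- The blocks with the codes `2` and `3` are adjacent. -/
def blockAdjFm : Fm :=
  .and (.not (.eq (.var 2) (.var 3))) (.ex 8 (.var 0) (.and (.rd₂ 2 (.var 2) (.var 8))
    (.ex 9 (.var 0) (.and (.rd₂ 2 (.var 3) (.var 9)) (nearFm 8 9)))))

/-- The algorithm for cluster graphs. -/
def clusterCmd : Cmd :=
  .seq (.tab 2 2 fourthPower 8 (.var 0) blockFm) (.seq
    (.tab 3 2 fourthPower 3 fourthPower blockAdjFm) (.seq
    (LocalRatio.independentCmd fourthPower) (outputCmd fourthPower)))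

theorem eval_fourthPower (h : ρ 0 = n) : fourthPower.eval ρ = n * n * n * n := by
  simp [fourthPower, h]

theorem holds_blockFm (hμ : F.HoldsMatrix n μ) (h₀ : ρ 0 = n) (h₈ : ρ 8 < n) :
    blockFm.Holds μ ρ ↔ ρ 8 ∈ F.block n (ρ 2) := by
  simp only [blockFm, Fm.holds_ex, Fm.holds_and, Fm.holds_eq, Exp.eval_var, Exp.eval_add,
    Exp.eval_mul, Function.update_apply, Fin.reduceEq, if_true, if_false, h₀, mem_block, h₈,
    true_and]
  refine exists_congr fun u => and_congr_right fun hu => exists_congr fun v =>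
    and_congr_right fun hv => exists_congr fun x => and_congr_right fun hx =>
    exists_congr fun y => and_congr_right fun hy => and_congr_right fun _ => ?_
  rw [holds_inBlockFm hμ] <;>
    simp only [Function.update_apply, Fin.reduceEq, if_true, if_false] <;> assumption

theorem holds_blockAdjFm (hμ : F.HoldsMatrix n μ) (h₀ : ρ 0 = n)
    (hC : ∀ p < n * n * n * n, ∀ v < n, μ 2 (pair p v) ↔ v ∈ F.block n p)
    (h₂ : ρ 2 < n * n * n * n) (h₃ : ρ 3 < n * n * n * n) :
    blockAdjFm.Holds μ ρ ↔ F.BlockAdj n (ρ 2) (ρ 3) := by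
  simp only [blockAdjFm, Fm.holds_ex, Fm.holds_and, Fm.holds_eq, Fm.holds_not, Fm.holds_rd₂,
    Exp.eval_var, Function.update_apply, Fin.reduceEq, if_true, if_false, h₀]
  refine and_congr_right fun _ => ⟨?_, ?_⟩
  · rintro ⟨w, hw, h, w', hw', h', hnear⟩
    rw [holds_nearFm hμ (by simpa [Function.update_apply] using hw)
      (by simpa [Function.update_apply] using hw')] at hnear
    exact ⟨w, (hC _ h₂ w hw).1 h, w', (hC _ h₃ w' hw').1 h', hnear⟩
  · rintro ⟨w, hw, w', hw', hnear⟩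
    have hwn := (mem_block.1 hw).1
    have hwn' := (mem_block.1 hw').1
    refine ⟨w, hwn, (hC _ h₂ w hwn).2 hw, w', hwn', (hC _ h₃ w' hwn').2 hw', ?_⟩
    rw [holds_nearFm hμ (by simpa [Function.update_apply] using hwn)
      (by simpa [Function.update_apply] using hwn')]
    exact hnear

theorem run_clusterCmd (hμ : F.HoldsMatrix n μ) (h₀ : ρ 0 = n) :
    ∃ K ⊆ Finset.range n, F.IsCluster K ∧
      (∀ L ⊆ Finset.range n, F.IsCluster L → L.card ≤ K.card) ∧
      ∀ v : Fin n, clusterCmd.run ρ μ 1 (pair 0 v) ↔ (v : ℕ) ∉ K := by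
  classical
  obtain ⟨a₁, a₂⟩ := Cmd.run_tab (μ := μ) (ρ := ρ) (a := 2) (x := 2) (y := 8) (e := fourthPower)
    (f := .var 0) (φ := blockFm) (E := n * n * n * n) (F := n) (by decide) (by rfl)
    (eval_fourthPower h₀) (fun i => by simpa [Function.update_apply] using h₀)
  set μ₁ := (Cmd.tab 2 2 fourthPower 8 (.var 0) blockFm).run ρ μ
  have hμ₁ : F.HoldsMatrix n μ₁ := by
    intro i hi j hj
    rw [a₁ 0 (by decide)]
    exact hμ i hi j hj
  have hC : ∀ p < n * n * n * n, ∀ v < n, μ₁ 2 (pair p v) ↔ v ∈ F.block n p := by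
    intro p hp v hv
    exact (a₂ p hp v hv).trans (holds_blockFm hμ h₀ hv)
  obtain ⟨b₁, b₂⟩ := Cmd.run_tab (μ := μ₁) (ρ := ρ) (a := 3) (x := 2) (y := 3) (e := fourthPower)
    (f := fourthPower) (φ := blockAdjFm) (E := n * n * n * n) (F := n * n * n * n) (by decide)
    (by rfl) (eval_fourthPower h₀) (fun i => eval_fourthPower h₀)
  set μ₂ := (Cmd.tab 3 2 fourthPower 3 fourthPower blockAdjFm).run ρ μ₁
  have hC₂ : ∀ p < n * n * n * n, ∀ v < n, μ₂ 2 (pair p v) ↔ v ∈ F.block n p := by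
    intro p hp v hv
    rw [b₁ 2 (by decide)]
    exact hC p hp v hv
  obtain ⟨I, hIM, c₁, c₂, -, hI, hmax⟩ := LocalRatio.run_independentCmd (μ := μ₂)
    (M := n * n * n * n)
    h₀ (fun ρ => eval_fourthPower) (F.block n) (F.BlockAdj n)
    (fun p hp v => ⟨fun h => ⟨(mem_block.1 h).1, (hC₂ p hp v (mem_block.1 h).1).2 h⟩,
      fun h => (hC₂ p hp v h.1).1 h.2⟩)
    (fun p hp q hq => (b₂ p hp q hq).trans (holds_blockAdjFm hμ₁ h₀ hC hp hq))
    blockAdj_symm blockAdj_eliminable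
  refine ⟨I.biUnion (F.block n), Finset.biUnion_subset.2 fun p _ => Finset.filter_subset _ _,
    isCluster_biUnion hI, fun L hL => card_le_of_isCluster hI hmax hL, fun v => ?_⟩
  refine run_outputCmd (M := n * n * n * n) h₀ (fun ρ => eval_fourthPower) (fun p hp v hv => ?_)
    hIM c₂ v
  rw [c₁ 2 (by decide)]
  exact hC₂ p hp v hv

/-! ### Complete split graphs -/

/-- The second power of the number of vertices. -/
def secondPower : Exp := .var 0 * .var 0

/-- The third power of the number of vertices. -/
def thirdPower : Exp := .var 0 * .var 0 * .var 0

/-- The vertex `8` belongs to the set of the triple with the code `2`. -/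
def singletonFm : Fm :=
  .ex 9 (.var 0) (.ex 10 (.var 0) (.ex 11 (.var 0) (.and
    (.eq (.var 2) ((.var 9 * .var 0 + .var 10) * .var 0 + .var 11))
    (.and (.eq (.var 8) (.var 11)) inRestFm))))

/-- The triples with the codes `2` and `3` are adjacent. -/
def tripleAdjFm : Fm :=
  .ex 9 (.var 0) (.ex 10 (.var 0) (.ex 11 (.var 0) (.ex 12 (.var 0) (.and
    (.eq (.var 2) ((.var 9 * .var 0 + .var 10) * .var 0 + .var 11)) (.and
    (.eq (.var 3) ((.var 9 * .var 0 + .var 10) * .var 0 + .var 12))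
    (.rd₂ 0 (.var 11) (.var 12)))))))

/-- The vertex `8` belongs to the complete split subgraph of the pair with the code `2`. -/
def splitFm : Fm :=
  .ex 9 (.var 0) (.ex 10 (.var 0) (.and (.eq (.var 2) (.var 9 * .var 0 + .var 10))
    (.or (inCoreFm 8) (.rd₂ 7 0 ((.var 9 * .var 0 + .var 10) * .var 0 + .var 8)))))

/-- Compute in the array `2` the best complete split subgraphs for all pairs. -/
def candidatesCmd : Cmd :=
  .seq (.tab 2 2 thirdPower 8 (.var 0) singletonFm) (.seq
    (.tab 3 2 thirdPower 3 thirdPower tripleAdjFm) (.seq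
    (LocalRatio.independentCmd thirdPower) (.tab 2 2 secondPower 8 (.var 0) splitFm)))

/-- The algorithm for complete split graphs. -/
def completeSplitCmd : Cmd :=
  .seq candidatesCmd (.seq
    (.tab 3 2 secondPower 3 secondPower (.not (.eq (.var 2) (.var 3)))) (.seq
    (LocalRatio.independentCmd secondPower) (outputCmd secondPower)))

theorem eval_secondPower (h : ρ 0 = n) : secondPower.eval ρ = n * n := by
  simp [secondPower, h]

theorem eval_thirdPower (h : ρ 0 = n) : thirdPower.eval ρ = n * n * n := by
  simp [thirdPower, h]

theorem holds_singletonFm (hμ : F.HoldsMatrix n μ) (h₀ : ρ 0 = n) (h₈ : ρ 8 < n) :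
    singletonFm.Holds μ ρ ↔ ρ 8 ∈ F.singletonOf n (ρ 2) := by
  simp only [singletonFm, Fm.holds_ex, Fm.holds_and, Fm.holds_eq, Exp.eval_var, Exp.eval_add,
    Exp.eval_mul, Function.update_apply, Fin.reduceEq, if_true, if_false, h₀, mem_singletonOf, h₈,
    true_and]
  refine exists_congr fun a => and_congr_right fun ha => exists_congr fun b =>
    and_congr_right fun hb => exists_congr fun x => and_congr_right fun hx =>
    and_congr_right fun _ => and_congr_right fun h => ?_
  rw [holds_inRestFm hμ] <;>
    simp only [Function.update_apply, Fin.reduceEq, if_true, if_false, h] <;> assumption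

theorem holds_tripleAdjFm (hμ : F.HoldsMatrix n μ) (h₀ : ρ 0 = n) :
    tripleAdjFm.Holds μ ρ ↔ F.TripleAdj n (ρ 2) (ρ 3) := by
  simp only [tripleAdjFm, Fm.holds_ex, Fm.holds_and, Fm.holds_eq, Fm.holds_rd₂, Exp.eval_var,
    Exp.eval_add, Exp.eval_mul, Function.update_apply, Fin.reduceEq, if_true, if_false, h₀]
  refine exists_congr fun a => and_congr_right fun ha => exists_congr fun b =>
    and_congr_right fun hb => exists_congr fun x => and_congr_right fun hx =>
    exists_congr fun y => and_congr_right fun hy => and_congr_right fun _ =>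
    and_congr_right fun _ => hμ x hx y hy

theorem holds_splitFm (hμ : F.HoldsMatrix n μ) (h₀ : ρ 0 = n) (h₈ : ρ 8 < n) {I : Finset ℕ}
    (hI : ∀ p < n * n * n, μ 7 (pair 0 p) ↔ p ∈ I) :
    splitFm.Holds μ ρ ↔ ρ 8 ∈ F.splitOf n I (ρ 2) := by
  simp only [splitFm, Fm.holds_ex, Fm.holds_and, Fm.holds_or, Fm.holds_eq, Fm.holds_rd₂,
    Exp.eval_zero, Exp.eval_var, Exp.eval_add, Exp.eval_mul, Function.update_apply, Fin.reduceEq,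
    if_true, if_false, h₀, mem_splitOf, h₈, true_and]
  refine exists_congr fun a => and_congr_right fun ha => exists_congr fun b =>
    and_congr_right fun hb => and_congr_right fun _ => or_congr ?_
      (hI _ (digit_lt (digit_lt ha hb) h₈))
  rw [holds_inCoreFm hμ] <;>
    simp only [Function.update_apply, Fin.reduceEq, if_true, if_false] <;> assumption

/-- One independent set computation on all triples serves every pair simultaneously. Only then is
the array `2` overwritten, with the resulting complete split subgraphs as weighted sets. -/
theorem run_candidatesCmd (hμ : F.HoldsMatrix n μ) (h₀ : ρ 0 = n) :
    ∃ I ⊆ Finset.range (n * n * n), (∀ p ∈ I, (F.singletonOf n p).Nonempty) ∧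
      (∀ p ∈ I, ∀ q ∈ I, p ≠ q → ¬ F.TripleAdj n p q) ∧
      (∀ J ⊆ Finset.range (n * n * n), (∀ p ∈ J, ∀ q ∈ J, p ≠ q → ¬ F.TripleAdj n p q) →
        ∑ p ∈ J, (F.singletonOf n p).card ≤ ∑ p ∈ I, (F.singletonOf n p).card) ∧
      ∀ p < n * n, ∀ v < n, candidatesCmd.run ρ μ 2 (pair p v) ↔ v ∈ F.splitOf n I p := by
  obtain ⟨a₁, a₂⟩ := Cmd.run_tab (μ := μ) (ρ := ρ) (a := 2) (x := 2) (y := 8) (e := thirdPower)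
    (f := .var 0) (φ := singletonFm) (E := n * n * n) (F := n) (by decide) (by rfl)
    (eval_thirdPower h₀) (fun i => by simpa [Function.update_apply] using h₀)
  set μ₁ := (Cmd.tab 2 2 thirdPower 8 (.var 0) singletonFm).run ρ μ
  have hμ₁ : F.HoldsMatrix n μ₁ := by
    intro i hi j hj
    rw [a₁ 0 (by decide)]
    exact hμ i hi j hj
  obtain ⟨b₁, b₂⟩ := Cmd.run_tab (μ := μ₁) (ρ := ρ) (a := 3) (x := 2) (y := 3) (e := thirdPower)
    (f := thirdPower) (φ := tripleAdjFm) (E := n * n * n) (F := n * n * n) (by decide)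
    (by rfl) (eval_thirdPower h₀) (fun i => eval_thirdPower h₀)
  set μ₂ := (Cmd.tab 3 2 thirdPower 3 thirdPower tripleAdjFm).run ρ μ₁
  have hC : ∀ p < n * n * n, ∀ v < n, μ₂ 2 (pair p v) ↔ v ∈ F.singletonOf n p := by
    intro p hp v hv
    rw [b₁ 2 (by decide)]
    exact (a₂ p hp v hv).trans (holds_singletonFm hμ h₀ hv)
  obtain ⟨I, hIM, c₁, c₂, hI₀, hI, hmax⟩ := LocalRatio.run_independentCmd (μ := μ₂)
    (M := n * n * n) h₀ (fun ρ => eval_thirdPower) (F.singletonOf n) (F.TripleAdj n)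
    (fun p hp v => ⟨fun h => ⟨(mem_singletonOf.1 h).1, (hC p hp v (mem_singletonOf.1 h).1).2 h⟩,
      fun h => (hC p hp v h.1).1 h.2⟩)
    (fun p hp q hq => (b₂ p hp q hq).trans (holds_tripleAdjFm hμ₁ h₀))
    tripleAdj_symm tripleAdj_eliminable
  set μ₃ := (LocalRatio.independentCmd thirdPower).run ρ μ₂
  have hμ₃ : F.HoldsMatrix n μ₃ := by
    intro i hi j hj
    rw [c₁ 0 (by decide), b₁ 0 (by decide)]
    exact hμ₁ i hi j hj
  obtain ⟨-, d₂⟩ := Cmd.run_tab (μ := μ₃) (ρ := ρ) (a := 2) (x := 2) (y := 8) (e := secondPower)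
    (f := .var 0) (φ := splitFm) (E := n * n) (F := n) (by decide) (by rfl)
    (eval_secondPower h₀) (fun i => by simpa [Function.update_apply] using h₀)
  refine ⟨I, hIM, hI₀, hI, hmax, fun p hp v hv => ?_⟩
  exact (d₂ p hp v hv).trans
    (holds_splitFm (ρ := Function.update (Function.update ρ 2 p) 8 v) hμ₃ h₀ hv c₂)

theorem run_completeSplitCmd (hμ : F.HoldsMatrix n μ) (h₀ : ρ 0 = n) :
    ∃ K ⊆ Finset.range n, F.IsCompleteSplit K ∧
      (∀ L ⊆ Finset.range n, F.IsCompleteSplit L → L.card ≤ K.card) ∧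
      ∀ v : Fin n, completeSplitCmd.run ρ μ 1 (pair 0 v) ↔ (v : ℕ) ∉ K := by
  classical
  obtain ⟨I₁, hIM, hI₀, hI, hmax, hC⟩ := run_candidatesCmd hμ h₀
  set μ₁ := candidatesCmd.run ρ μ
  obtain ⟨b₁, b₂⟩ := Cmd.run_tab (μ := μ₁) (ρ := ρ) (a := 3) (x := 2) (y := 3) (e := secondPower)
    (f := secondPower) (φ := .not (.eq (.var 2) (.var 3))) (E := n * n) (F := n * n) (by decide)
    (by rfl) (eval_secondPower h₀) (fun i => eval_secondPower h₀)
  set μ₂ := (Cmd.tab 3 2 secondPower 3 secondPower (.not (.eq (.var 2) (.var 3)))).run ρ μ₁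
  have hC₂ : ∀ p < n * n, ∀ v < n, μ₂ 2 (pair p v) ↔ v ∈ F.splitOf n I₁ p := by
    intro p hp v hv
    rw [b₁ 2 (by decide)]
    exact hC p hp v hv
  obtain ⟨I₂, hIM₂, c₁, c₂, hI₂', hI₂, hmax₂⟩ := LocalRatio.run_independentCmd (μ := μ₂)
    (M := n * n) h₀ (fun ρ => eval_secondPower) (F.splitOf n I₁) (fun p q => p ≠ q)
    (fun p hp v => ⟨fun h => ⟨(mem_splitOf.1 h).1, (hC₂ p hp v (mem_splitOf.1 h).1).2 h⟩,
      fun h => (hC₂ p hp v h.1).1 h.2⟩)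
    (fun p hp q hq => b₂ p hp q hq) (fun _ _ => Ne.symm)
    -- In the complete graph every vertex is simplicial; the independent set routine merely selects
    -- a pair with the largest set.
    (fun S _ ⟨p, hp⟩ => ⟨p, hp, fun q r _ _ _ _ => em (q = r)⟩)
  refine ⟨I₂.biUnion (F.splitOf n I₁), Finset.biUnion_subset.2 fun p _ => Finset.filter_subset _ _,
    isCompleteSplit_biUnion hI₀ hI hI₂ hI₂',
    fun L hL => card_le_of_isCompleteSplit hIM hI₀ hI hmax hI₂ hmax₂ hL, fun v => ?_⟩
  refine run_outputCmd (M := n * n) h₀ (fun ρ => eval_secondPower) (fun p hp v hv => ?_)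
    hIM₂ c₂ v
  rw [c₁ 2 (by decide)]
  exact hC₂ p hp v hv

open Classical in
/-- A command which computes the complements of maximum induced subgraphs solves the vertex
deletion problem. -/
theorem vertexDeletionInP {𝒞 : GraphClass} {P : Intervals → Finset ℕ → Prop} (c : Cmd)
    (hP : ∀ {F : Intervals} {n : ℕ} {G : SimpleGraph (Fin n)},
      (∀ i j : Fin n, G.Adj i j ↔ F.Near i j ∧ i ≠ j) →
      ∀ X, IsDeletionSet 𝒞 G X ↔ P F (kept X))
    (hc : ∀ {F : Intervals} {n : ℕ} {μ : Fin 16 → ℕ → Prop}, F.HoldsMatrix n μ →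
      ∃ K ⊆ Finset.range n, P F K ∧ (∀ L ⊆ Finset.range n, P F L → L.card ≤ K.card) ∧
        ∀ v : Fin n, c.run (vars n 0) μ 1 (pair 0 v) ↔ (v : ℕ) ∉ K) :
    VertexDeletionInP IntervalGraph 𝒞 := by
  refine vertexDeletionInP_of_cmd c 1 fun x μ hμ => ?_
  obtain ⟨F, hF⟩ := exists_of_intervalGraph x.mem
  obtain ⟨K, hK, hPK, hmax, hout⟩ := hc (F := F) (n := x.n) (μ := μ) fun i hi j hj => by
    rw [hμ ⟨i, hi⟩ ⟨j, hj⟩, hF, Ne, Fin.ext_iff]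
  exact isMinimumDeletionSet_of (hP hF) hK hPK hmax fun v => by
    rw [Finset.mem_filter, hout, and_iff_right (Finset.mem_univ _)]

end Intervals

theorem mainTheorem5 :
    VertexDeletionInP IntervalGraph CompleteSplitGraph ∧
      VertexDeletionInP IntervalGraph ClusterGraph :=
  ⟨Intervals.vertexDeletionInP Intervals.completeSplitCmd Intervals.isDeletionSet_completeSplit
    fun hμ => Intervals.run_completeSplitCmd hμ (vars_zero _ _),
  Intervals.vertexDeletionInP Intervals.clusterCmd Intervals.isDeletionSet_cluster
    fun hμ => Intervals.run_clusterCmd hμ (vars_zero _ _)⟩
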